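/- Let $\Bbbk$ be an algebraically closed field. All categories and functors are $\Bbbk$-linear. **Setup.** Let $\mathcal R$ be a finite abelian category, i.e. an abelian category equivalent to the category of finite-dimensional left modules over some finite-dimensional $\Bbbk$-algebra. Let $\{L(b)\mid b\in\mathbf B\}$ be representatives of the isomorphism classes of simple objects of $\mathcal R$, with projective covers $P(b)$ and injective hulls $I(b)$. Let $\Lambda$ be a poset, $\rho:\mathbf B\to\Lambda$ a function (this data is a *stratification* of $\mathcal R$), and $\varepsilon:\Lambda\to\{\pm\}$ a sign function. For $\lambda\in\Lambda$ let $\mathcal R_{\le\lambda}$ (resp. $\mathcal R_{<\lambda}$) be the full subcategory of objects all of whose composition factors are of the form $L(c)$ with $\rho(c)\le\lambda$ (resp. $\rho(c)<\lambda$). For $b\in\mathbf B$ with $\rho(b)=\lambda$, let $\Delta(b)$ be the largest quotient of $P(b)$ (resp. $\nabla(b)$ the largest subobject of $I(b)$) belonging to $\mathcal R_{\le\lambda}$, and let $\bar\Delta(b)$ be the largest quotient of $\Delta(b)$ (resp. $\bar\nabla(b)$ the largest subobject of $\nabla(b)$) all of whose composition factors, apart from its head (resp. socle) $L(b)$, belong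 to $\mathcal R_{<\lambda}$. Put $\Delta_\varepsilon(b)=\Delta(b)$, $\nabla_\varepsilon(b)=\bar\nabla(b)$ if $\varepsilon(\lambda)=+$, and $\Delta_\varepsilon(b)=\bar\Delta(b)$, $\nabla_\varepsilon(b)=\nabla(b)$ if $\varepsilon(\lambda)=-$. Let $\Delta_\varepsilon(\mathcal R)$ (resp. $\nabla_\varepsilon(\mathcal R)$) be the full subcategory of objects with a $\Delta_\varepsilon$-flag (resp. $\nabla_\varepsilon$-flag), that is, a finite filtration with sections of the form $\Delta_\varepsilon(b)$ (resp. $\nabla_\varepsilon(b)$), $b\in\mathbf B$. $\mathcal R$ is a *finite $\varepsilon$-stratified category* if for each $b\in\mathbf B$ there is a projective object with a $\Delta_\varepsilon$-flag with $\Delta_\varepsilon(b)$ at the top and other sections $\Delta_\varepsilon(c)$ for $c$ with $\rho(c)\ge\rho(b)$. Assume this. An *$\varepsilon$-tilting object* is an object with both a $\Delta_\varepsilon$-flag and a $\nabla_\varepsilon$-flag. $T_\varepsilon(b)$ denotes the (unique up to isomorphism) indecomposable $\varepsilon$-tilting object with a $\Delta_\varepsilon$-flag with bottom section $\Delta_\varepsilon(b)$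 and a $\nabla_\varepsilon$-flag with top section $\nabla_\varepsilon(b)$. Let $T$ be an *$\varepsilon$-tilting generator*, i.e. an $\varepsilon$-tilting object with a direct summand isomorphic to $T_\varepsilon(b)$ for every $b\in\mathbf B$. Let $A:=\operatorname{End}_{\mathcal R}(T)^{\mathrm{op}}$, let $\widetilde{\mathcal R}$ be the category of finite-dimensional left $A$-modules (the *Ringel dual* of $\mathcal R$ relative to $T$), and let $$F:=\operatorname{Hom}_{\mathcal R}(T,-),\qquad G:=\operatorname{Hom}_{\mathcal R}(-,T)^*\ :\ \mathcal R\to\widetilde{\mathcal R}.$$ **Theorem.** $\widetilde{\mathcal R}$ is a finite abelian category, and there are representatives $\widetilde L(b)$, $b\in\mathbf B$, of the isomorphism classes of simple objects of $\widetilde{\mathcal R}$ such that, with the stratification $\rho:\mathbf B\to\Lambda^{\mathrm{op}}$ and the sign function $-\varepsilon$, $\widetilde{\mathcal R}$ is a finite $(-\varepsilon)$-stratified category. Its distinguished objects (denoted with a tilde) satisfy, for all $b\in\mathbf B$, $$\widetilde P(b)\cong F T_\varepsilon(b),\quad \widetilde I(b)\cong G T_\varepsilon(b),\quad \widetilde L(b)\cong\operatorname{hd}\widetilde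 P(b)\cong\operatorname{soc}\widetilde I(b),$$ $$\widetilde\Delta_{-\varepsilon}(b)\cong F\nabla_\varepsilon(b),\quad \widetilde\nabla_{-\varepsilon}(b)\cong G\Delta_\varepsilon(b),\quad \widetilde T_{-\varepsilon}(b)\cong F I(b)\cong G P(b).$$ The functors restrict to equivalences $F:\nabla_\varepsilon(\mathcal R)\to\Delta_{-\varepsilon}(\widetilde{\mathcal R})$ and $G:\Delta_\varepsilon(\mathcal R)\to\nabla_{-\varepsilon}(\widetilde{\mathcal R})$. These restrictions are exact (they send short exact sequences with all terms in the subcategory to short exact sequences) and induce $\Bbbk$-linear isomorphisms $$\operatorname{Ext}^n_{\mathcal R}(V_1,V_2)\cong\operatorname{Ext}^n_{\widetilde{\mathcal R}}(FV_1,FV_2),\qquad \operatorname{Ext}^n_{\mathcal R}(W_1,W_2)\cong\operatorname{Ext}^n_{\widetilde{\mathcal R}}(GW_1,GW_2)$$ for all $V_i\in\nabla_\varepsilon(\mathcal R)$, $W_i\in\Delta_\varepsilon(\mathcal R)$ and $n\ge 0$. Here "induce" means that the isomorphisms are given by the functor on morphisms for $n=0$, send the class of a short exact sequence in the subcategory to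 the class of its image for $n=1$, and are compatible with Yoneda products. -/

import Mathlib

open CategoryTheory CategoryTheory.Limits CategoryTheory.Abelian

universe w w' v u u' v'

namespace RingelDuality

noncomputable section

/-! ### Finite-dimensional modules and finite abelian categories -/

section FiniteAbelian

open scoped ModuleCat

/-- The property of a left `A`-module of being finite-dimensional over the ground field `k`
(which acts through the structure map `k → A`). -/
def isFD (k : Type v) [Field k] (A : Type v) [Ring A] [Algebra k A] :
    ObjectProperty (ModuleCat.{v} A) :=
  fun M => Module.Finite k M

/-- The category `A-mod_fd` of finite-dimensional left modules over a `k`-algebra `A`. -/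
abbrev FDMod (k : Type v) [Field k] (A : Type v) [Ring A] [Algebra k A] : Type (v + 1) :=
  (isFD k A).FullSubcategory

variable (k : Type v) [Field k] (A : Type v) [Ring A] [Algebra k A]

instance : (isFD k A).IsClosedUnderSubobjects where
  prop_of_mono {M N} f _ hN :=
    haveI : Module.Finite k N := hN
    Module.Finite.of_injective (f.hom.restrictScalars k) ((ModuleCat.mono_iff_injective f).1 ‹_›)

instance : (isFD k A).IsClosedUnderQuotients where
  prop_of_epi {M N} f _ hM :=
    haveI : Module.Finite k M := hM
    Module.Finite.of_surjective (f.hom.restrictScalars k)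
      ((ModuleCat.epi_iff_surjective f).1 ‹_›)

instance : (isFD k A).ContainsZero where
  exists_zero := ⟨ModuleCat.of A PUnit.{v + 1}, ModuleCat.isZero_of_subsingleton _,
    ⟨⟨∅, eq_top_iff.2 fun x _ => by
      rw [show x = 0 from Subsingleton.elim (α := PUnit.{v + 1}) _ _]
      exact Submodule.zero_mem _⟩⟩⟩

instance : (isFD k A).IsClosedUnderFiniteProducts where
  isClosedUnderLimitsOfShape J _ :=
    { limitsOfShape_le := by
        rintro X ⟨p⟩
        have : ∀ j, Module.Finite k (p.diag.obj j) := p.prop_diag_obj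
        let g : X →ₗ[k] (∀ j, p.diag.obj j) :=
          LinearMap.pi fun j => (p.π.app j).hom.restrictScalars k
        refine Module.Finite.of_injective g fun x y hxy => ?_
        have hj : ∀ j, (p.π.app j).hom x = (p.π.app j).hom y := fun j => congrFun hxy j
        have := Concrete.isLimit_ext _ p.isLimit x y hj
        exact this }

/-- A `k`-linear abelian category is *finite abelian* if it is equivalent, by a `k`-linear
equivalence, to the category of finite-dimensional modules over some finite-dimensional
`k`-algebra. -/
class IsFiniteAbelian (k : Type v) [Field k] (C : Type u) [Category.{v'} C] [Abelian C]
    [Linear k C] : Prop where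
  exists_equiv : ∃ (A : Type v) (_ : Ring A) (_ : Algebra k A) (e : C ≌ FDMod k A),
    Module.Finite k A ∧ ∃ (_ : e.functor.Additive), e.functor.Linear k

instance finite_hom {C : Type u} [Category.{v'} C] [Abelian C] [Linear k C]
    [IsFiniteAbelian k C] (X Y : C) : Module.Finite k (X ⟶ Y) := by
  obtain ⟨A, _, _, e, -, _, _⟩ := IsFiniteAbelian.exists_equiv (k := k) (C := C)
  let M := (e.functor.obj X).obj
  let N := (e.functor.obj Y).obj
  have : Module.Finite k M := (e.functor.obj X).property
  have : Module.Finite k N := (e.functor.obj Y).property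
  let φ : (X ⟶ Y) →ₗ[k] (M →ₗ[k] N) :=
    { toFun := fun f => ((e.functor.map f).hom.hom).restrictScalars k
      map_add' := fun f g => by rw [e.functor.map_add]; rfl
      map_smul' := fun c f => by rw [Functor.map_smul]; rfl }
  refine Module.Finite.of_injective φ fun f g hfg => e.functor.map_injective ?_
  ext x
  exact LinearMap.congr_fun hfg x

end FiniteAbelian

/-! ### General notions in an abelian category -/

section General

variable {C : Type u} [Category.{v} C] [Abelian C]

/-- `S` is a composition factor of `X`: a simple subquotient of `X`. -/
def IsCompositionFactor (S X : C) : Prop :=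
  Simple S ∧ ∃ (U : C) (i : U ⟶ X) (p : U ⟶ S), Mono i ∧ Epi p

/-- `π : P ⟶ X` is a projective cover: `P` is projective and `π` is an essential epimorphism. -/
structure IsProjectiveCover {P X : C} (π : P ⟶ X) : Prop where
  projective : Projective P
  epi : Epi π
  essential : ∀ ⦃Y : C⦄ (f : Y ⟶ P), Epi (f ≫ π) → Epi f

/-- `ι : X ⟶ I` is an injective hull: `I` is injective and `ι` is an essential monomorphism. -/
structure IsInjectiveHull {X I : C} (ι : X ⟶ I) : Prop where
  injective : Injective I
  mono : Mono ι
  essential : ∀ ⦃Y : C⦄ (f : I ⟶ Y), Mono (ι ≫ f) → Mono f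

/-- `P` is (isomorphic to) the projective cover of `X`. -/
def ProjectiveCoverOf (X P : C) : Prop := ∃ π : P ⟶ X, IsProjectiveCover π

/-- `I` is (isomorphic to) the injective hull of `X`. -/
def InjectiveHullOf (X I : C) : Prop := ∃ ι : X ⟶ I, IsInjectiveHull ι

/-- A semisimple object: a finite direct sum (coproduct) of simple objects. -/
def IsSemisimpleObj (X : C) : Prop :=
  ∃ (n : ℕ) (S : Fin n → C), (∀ i, Simple (S i)) ∧ Nonempty (X ≅ ∐ S)

/-- `H` is (isomorphic to) the head of `X`, i.e. its largest semisimple quotient. -/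
def IsHead (X H : C) : Prop :=
  IsSemisimpleObj H ∧ ∃ p : X ⟶ H, Epi p ∧
    ∀ ⦃S : C⦄ (f : X ⟶ S), Epi f → IsSemisimpleObj S → ∃ g : H ⟶ S, p ≫ g = f

/-- `H` is (isomorphic to) the socle of `X`, i.e. its largest semisimple subobject. -/
def IsSocle (X H : C) : Prop :=
  IsSemisimpleObj H ∧ ∃ i : H ⟶ X, Mono i ∧
    ∀ ⦃S : C⦄ (f : S ⟶ X), Mono f → IsSemisimpleObj S → ∃ g : S ⟶ H, g ≫ i = f

/-- `Flag D [b₁, …, bₙ] V`: the object `V` has a finite filtration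
`0 = V₀ ⊆ V₁ ⊆ ⋯ ⊆ Vₙ = V` whose sections, read from top to bottom, satisfy
`D b₁, …, D bₙ`. -/
inductive Flag {B : Type w} (D : B → C → Prop) : List B → C → Prop
  | zero {V : C} (hV : IsZero V) : Flag D [] V
  | cons {b : B} {l : List B} {U V X : C} (i : U ⟶ V) (p : V ⟶ X) (zero : i ≫ p = 0)
      (exact : (ShortComplex.mk i p zero).ShortExact) (hU : Flag D l U) (hX : D b X) :
      Flag D (b :: l) V

end General

/-! ### Stratifications and `ε`-stratified categories -/

/-- A stratification of an abelian category `C` by the poset `Λ`: representatives `L b`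
(`b ∈ B`) of the isomorphism classes of simple objects, and a function `ρ : B → Λ`. -/
structure Stratification (C : Type u) [Category.{v} C] [Abelian C] (B : Type w) (Λ : Type w')
    [PartialOrder Λ] where
  /-- the simple objects -/
  L : B → C
  simple : ∀ b, Simple (L b)
  eq_of_iso : ∀ b c, Nonempty (L b ≅ L c) → b = c
  exists_iso : ∀ X : C, Simple X → ∃ b, Nonempty (X ≅ L b)
  /-- the stratification function -/
  ρ : B → Λ

namespace Stratification

variable {C : Type u} [Category.{v} C] [Abelian C] {B : Type w} {Λ : Type w'} [PartialOrder Λ]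
  (S : Stratification C B Λ)

/-- The Serre subcategory `R_{≤ x}`. -/
def le (x : Λ) : ObjectProperty C := fun V => ∀ b, IsCompositionFactor (S.L b) V → S.ρ b ≤ x

/-- The Serre subcategory `R_{< x}`. -/
def lt (x : Λ) : ObjectProperty C := fun V => ∀ b, IsCompositionFactor (S.L b) V → S.ρ b < x

/-- `V` is the standard object `Δ(b)`: the largest quotient of the projective cover `P(b)` of
`L(b)` that belongs to `R_{≤ ρ(b)}`. -/
def IsStandard (b : B) (V : C) : Prop :=
  ∃ (P : C) (q : P ⟶ V), ProjectiveCoverOf (S.L b) P ∧ Epi q ∧ S.le (S.ρ b) V ∧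
    ∀ ⦃W : C⦄ (f : P ⟶ W), Epi f → S.le (S.ρ b) W → ∃ g : V ⟶ W, q ≫ g = f

/-- `V` is the costandard object `∇(b)`: the largest subobject of the injective hull `I(b)` of
`L(b)` that belongs to `R_{≤ ρ(b)}`. -/
def IsCostandard (b : B) (V : C) : Prop :=
  ∃ (I : C) (i : V ⟶ I), InjectiveHullOf (S.L b) I ∧ Mono i ∧ S.le (S.ρ b) V ∧
    ∀ ⦃W : C⦄ (f : W ⟶ I), Mono f → S.le (S.ρ b) W → ∃ g : W ⟶ V, g ≫ i = f

/-- `V` has `L(b)` as a quotient and all remaining composition factors are in `R_{< ρ(b)}`. -/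
def TopProper (b : B) (V : C) : Prop :=
  ∃ h : V ⟶ S.L b, Epi h ∧ S.lt (S.ρ b) (kernel h)

/-- `V` has `L(b)` as a subobject and all remaining composition factors are in `R_{< ρ(b)}`. -/
def BottomProper (b : B) (V : C) : Prop :=
  ∃ h : S.L b ⟶ V, Mono h ∧ S.lt (S.ρ b) (cokernel h)

/-- `V` is the proper standard object `Δ̄(b)`: the largest quotient of `Δ(b)` such that all
composition factors apart from its head `L(b)` belong to `R_{< ρ(b)}`. -/
def IsProperStandard (b : B) (V : C) : Prop :=
  ∃ (D : C) (q : D ⟶ V), S.IsStandard b D ∧ Epi q ∧ S.TopProper b V ∧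
    ∀ ⦃W : C⦄ (f : D ⟶ W), Epi f → S.TopProper b W → ∃ g : V ⟶ W, q ≫ g = f

/-- `V` is the proper costandard object `∇̄(b)`: the largest subobject of `∇(b)` such that all
composition factors apart from its socle `L(b)` belong to `R_{< ρ(b)}`. -/
def IsProperCostandard (b : B) (V : C) : Prop :=
  ∃ (D : C) (i : V ⟶ D), S.IsCostandard b D ∧ Mono i ∧ S.BottomProper b V ∧
    ∀ ⦃W : C⦄ (f : W ⟶ D), Mono f → S.BottomProper b W → ∃ g : W ⟶ V, g ≫ i = f

variable (ε : Λ → ℤˣ)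

/-- `V` is the `ε`-standard object `Δ_ε(b)`: it is `Δ(b)` if `ε(ρ(b)) = +` and `Δ̄(b)` if
`ε(ρ(b)) = -`. -/
def IsEpsStandard (b : B) (V : C) : Prop :=
  (ε (S.ρ b) = 1 → S.IsStandard b V) ∧ (ε (S.ρ b) = -1 → S.IsProperStandard b V)

/-- `V` is the `ε`-costandard object `∇_ε(b)`: it is `∇̄(b)` if `ε(ρ(b)) = +` and `∇(b)` if
`ε(ρ(b)) = -`. -/
def IsEpsCostandard (b : B) (V : C) : Prop :=
  (ε (S.ρ b) = 1 → S.IsProperCostandard b V) ∧ (ε (S.ρ b) = -1 → S.IsCostandard b V)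

/-- `Δ_ε(R)`: the objects with a `Δ_ε`-flag. -/
def stdFiltered : ObjectProperty C := fun V => ∃ l : List B, Flag (S.IsEpsStandard ε) l V

/-- `∇_ε(R)`: the objects with a `∇_ε`-flag. -/
def costdFiltered : ObjectProperty C := fun V => ∃ l : List B, Flag (S.IsEpsCostandard ε) l V

/-- For each `b` there is a projective object with a `Δ_ε`-flag with `Δ_ε(b)` at the top and
other sections `Δ_ε(c)` for `c` with `ρ(c) ≥ ρ(b)`. -/
def HasProjectiveFlags : Prop :=
  ∀ b : B, ∃ (P : C) (l : List B), Projective P ∧ Flag (S.IsEpsStandard ε) (b :: l) P ∧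
    ∀ c ∈ l, S.ρ b ≤ S.ρ c

/-- The category, with the given stratification, is a finite `ε`-stratified category. -/
def IsFiniteStratified (k : Type u') [Field k] [Linear k C] : Prop :=
  IsFiniteAbelian k C ∧ S.HasProjectiveFlags ε

/-- `ε`-tilting objects. -/
def IsTilting (V : C) : Prop := S.stdFiltered ε V ∧ S.costdFiltered ε V

/-- `V` is the indecomposable `ε`-tilting object `T_ε(b)`: it is indecomposable, it has a
`Δ_ε`-flag with `Δ_ε(b)` at the bottom and a `∇_ε`-flag with `∇_ε(b)` at the top. -/
def IsIndecTilting (b : B) (V : C) : Prop :=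
  Indecomposable V ∧ (∃ l : List B, Flag (S.IsEpsStandard ε) (l ++ [b]) V) ∧
    ∃ l : List B, Flag (S.IsEpsCostandard ε) (b :: l) V

/-- `T` is an `ε`-tilting generator: an `ε`-tilting object having a direct summand isomorphic
to `T_ε(b)` for each `b`. -/
def IsTiltingGenerator (T : C) : Prop :=
  S.IsTilting ε T ∧ ∀ b : B, ∃ U : C, S.IsIndecTilting ε b U ∧ Nonempty (Retract U T)

end Stratification

/-- The negated sign function `-ε` on the opposite poset. -/
def negSign {Λ : Type w'} (ε : Λ → ℤˣ) : Λᵒᵈ → ℤˣ := fun x => -ε (OrderDual.ofDual x)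

/-! ### The Ringel dual and the Ringel duality functors -/

section Dual

variable (k : Type v) [Field k] {C : Type u} [Category.{v} C] [Abelian C] [Linear k C]

/-- The Ringel dual `A-mod_fd` relative to `T`, where `A = End(T)^op`. Here multiplication in
`End T` is composition of maps, so `A` acts on the left of `Hom(T, V)` by precomposition. -/
abbrev RingelDual (T : C) : Type (v + 1) := FDMod k (End T)ᵐᵒᵖ

/-- The dual vector space `Hom(V, T)^*`. -/
def HomDual (V T : C) : Type v := Module.Dual k (V ⟶ T)

instance (V T : C) : AddCommGroup (HomDual k V T) :=
  inferInstanceAs (AddCommGroup (Module.Dual k (V ⟶ T)))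

/-- The left action of `A = End(T)^op` on `Hom(V, T)^*` dual to the right action of `A` on
`Hom(V, T)`: `(a • φ)(f) = φ(a ∘ f)`. -/
instance (V T : C) : Module (End T)ᵐᵒᵖ (HomDual k V T) where
  smul a φ := LinearMap.comp (show Module.Dual k (V ⟶ T) from φ) (Linear.rightComp k V a.unop)
  one_smul φ := LinearMap.ext fun f =>
    congrArg (show Module.Dual k (V ⟶ T) from φ) (Category.comp_id f)
  mul_smul a b φ := LinearMap.ext fun f =>
    congrArg (show Module.Dual k (V ⟶ T) from φ) (Category.assoc f a.unop b.unop).symm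
  smul_zero _ := LinearMap.ext fun _ => rfl
  smul_add _ _ _ := LinearMap.ext fun _ => rfl
  add_smul _ _ φ := LinearMap.ext fun f =>
    (congrArg (show Module.Dual k (V ⟶ T) from φ) (Preadditive.comp_add _ _ _ f _ _)).trans
      (map_add (show Module.Dual k (V ⟶ T) from φ) _ _)
  zero_smul φ := LinearMap.ext fun _ =>
    (congrArg (show Module.Dual k (V ⟶ T) from φ) (comp_zero)).trans
      (map_zero (show Module.Dual k (V ⟶ T) from φ))

variable [IsFiniteAbelian k C] (T : C)

open scoped ModuleCat in
lemma isFD_hom (V : C) : isFD k (End T)ᵐᵒᵖ ((preadditiveCoyonedaObj T).obj V) := by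
  let φ : (T ⟶ V) →ₗ[k] ((preadditiveCoyonedaObj T).obj V) :=
    { toFun := fun f => f
      map_add' := fun _ _ => rfl
      map_smul' := fun c f => by
        change c • f = (c • 𝟙 T) ≫ f
        rw [Linear.smul_comp, Category.id_comp] }
  exact Module.Finite.of_surjective φ fun f => ⟨f, rfl⟩

/-- The Ringel duality functor `F = Hom(T, -)`. -/
def ringelF : C ⥤ RingelDual k T :=
  (isFD k (End T)ᵐᵒᵖ).lift (preadditiveCoyonedaObj T) (isFD_hom k T)

/-- The functor `V ↦ Hom(V, T)^*` with values in left `End(T)^op`-modules. -/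
def homDualFunctor : C ⥤ ModuleCat.{v} (End T)ᵐᵒᵖ where
  obj V := ModuleCat.of (End T)ᵐᵒᵖ (HomDual k V T)
  map {V W} f := ModuleCat.ofHom
    { toFun := fun φ =>
        LinearMap.comp (show Module.Dual k (V ⟶ T) from φ) (Linear.leftComp k T f)
      map_add' := fun _ _ => rfl
      map_smul' := fun a φ => LinearMap.ext fun g =>
        congrArg (show Module.Dual k (V ⟶ T) from φ) (Category.assoc f g a.unop) }
  map_id V := by
    ext φ
    exact LinearMap.ext fun g =>
      congrArg (show Module.Dual k (V ⟶ T) from φ) (Category.id_comp g)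
  map_comp {V W X} f g := by
    ext φ
    exact LinearMap.ext fun h =>
      congrArg (show Module.Dual k (V ⟶ T) from φ) (Category.assoc f g h)

open scoped ModuleCat in
lemma isFD_homDual (V : C) : isFD k (End T)ᵐᵒᵖ ((homDualFunctor k T).obj V) := by
  let φ : Module.Dual k (V ⟶ T) →ₗ[k] ((homDualFunctor k T).obj V) :=
    { toFun := fun f => f
      map_add' := fun _ _ => rfl
      map_smul' := fun c f => by
        refine LinearMap.ext fun g => ?_
        change c • f g = f (g ≫ (c • 𝟙 T))
        rw [Linear.comp_smul, Category.comp_id, map_smul] }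
  exact Module.Finite.of_surjective φ fun f => ⟨f, rfl⟩

/-- The Ringel duality functor `G = * ∘ Hom(-, T)`. -/
def ringelG : C ⥤ RingelDual k T :=
  (isFD k (End T)ᵐᵒᵖ).lift (homDualFunctor k T) (isFD_homDual k T)

instance : (ringelF k T).Additive where
  map_add {V W f g} := by
    apply ObjectProperty.hom_ext
    ext h
    exact Preadditive.comp_add _ _ _ h f g

instance : (ringelG k T).Additive where
  map_add {V W f g} := by
    apply ObjectProperty.hom_ext
    ext φ
    exact LinearMap.ext fun h =>
      (congrArg (show Module.Dual k (V ⟶ T) from φ) (Preadditive.add_comp _ _ _ f g h)).trans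
        (map_add (show Module.Dual k (V ⟶ T) from φ) _ _)

end Dual

/-! ### Equivalences of subcategories and induced maps on extension groups -/

section Induced

variable {C : Type u} [Category.{v} C] {D : Type u'} [Category.{v'} D]

/-- `F` restricts to an equivalence between the full subcategories given by `P` and `Q`. -/
def RestrictsToEquivalence (F : C ⥤ D) (P : ObjectProperty C) (Q : ObjectProperty D) : Prop :=
  ∃ h : ∀ X, P X → Q (F.obj X), (Q.lift (P.ι ⋙ F) fun X => h _ X.property).IsEquivalence

/-- `F` is exact on the full subcategory given by `P`, and the maps which it induces on the
extension groups between objects of that subcategory are isomorphisms: there are `k`-linear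
isomorphisms `Extⁿ(X, Y) ≃ Extⁿ(F X, F Y)` given by `F` on morphisms (`n = 0`), by applying `F`
to short exact sequences (`n = 1`), and compatible with Yoneda products. -/
def InducesExtIsos (k : Type w) [Field k] [Abelian C] [Linear k C] [Abelian D] [Linear k D]
    (F : C ⥤ D) [F.Additive] (P : ObjectProperty C) : Prop :=
  haveI : HasExt.{max u v} C := HasExt.standard C
  haveI : HasExt.{max u' v'} D := HasExt.standard D
  ∃ (exact : ∀ E : ShortComplex C, E.ShortExact → P E.X₁ → P E.X₂ → P E.X₃ →
      (E.map F).ShortExact)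
    (φ : ∀ (X Y : C), P X → P Y → ∀ n : ℕ,
      Ext.{max u v} X Y n ≃ₗ[k] Ext.{max u' v'} (F.obj X) (F.obj Y) n),
    (∀ (X Y : C) (hX : P X) (hY : P Y) (f : X ⟶ Y),
      φ X Y hX hY 0 (Ext.mk₀ f) = Ext.mk₀ (F.map f)) ∧
    (∀ (E : ShortComplex C) (hE : E.ShortExact) (h₁ : P E.X₁) (h₂ : P E.X₂) (h₃ : P E.X₃),
      φ E.X₃ E.X₁ h₃ h₁ 1 hE.extClass = (exact E hE h₁ h₂ h₃).extClass) ∧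
    (∀ (X Y Z : C) (hX : P X) (hY : P Y) (hZ : P Z) (a b c : ℕ) (h : a + b = c)
      (α : Ext.{max u v} X Y a) (β : Ext.{max u v} Y Z b),
      φ X Z hX hZ c (α.comp β h) = (φ X Y hX hY a α).comp (φ Y Z hY hZ b β) h)

end Induced

end

end RingelDuality

open RingelDuality

namespace RingelDuality

noncomputable section

/-! ### Short exact sequences -/

section Ses

variable {C : Type u} [Category.{v} C] [Abelian C]

/-! Everything rests on the vanishing of `Extⁿ(Δ_ε(b), ∇_ε(c))` for `n > 0` (`Setup.extZero_succ`).
It makes flags a homological matter: an object with `Ext¹(Δ_ε(c), -) = 0` for all `c` has a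
`∇_ε`-flag (`Setup.costdFiltered_of_extZero`). So injective objects have `∇_ε`-flags and the
hypotheses are self-dual (`Setup.op`): most results are proved on one side and carried to the other
through the opposite category with sign `-ε`.

Every object is a quotient of a `Δ_ε`-filtered object by a `∇_ε`-filtered one (`Setup.stdApprox`).
For an object with a `∇_ε`-flag this is a tilting cover with `∇_ε`-filtered kernel
(`Setup.exists_tilting_cover`). Moreover `T(b)` is a summand of every tilting object with bottom
section `Δ_ε(b)` (`Setup.retract_of_bottom`), so tilting objects are sums of the `T(b)`, whose
composition factors have labels at most `ρ b`.

The functor `F = Hom(T, -)` takes `T` to the regular module, hence `T(b)` to an indecomposable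
projective, whose head is the new simple object. Since `Ext¹(T, -)` vanishes on `∇_ε`-filtered
objects, `F` is exact there, and tilting covers make it fully faithful. A nonzero map `T(c) ⟶
∇_ε(b)` forces `ρ b ≤ ρ c`; this reverses the order, and the image under `F` of `T(b) ⟶ ∇_ε(b)`
presents a standard object for `-ε`.

As a functor between opposite categories, `G` satisfies the same axioms (`IsRingelFunctor`), because
`G T` is the dual of the regular module. The two sides are glued by the isomorphism of `soc G T(b)`
with `hd F T(b)` and by `F I(b) ≅ G P(b)`, which comes from a perfect pairing of `Hom(P, T)` with
`Hom(T, I)` (`exists_iso_ringelF_ringelG`). The isomorphisms of extension groups follow by dimension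
shifting along resolutions that are acyclic before and after the functor: tilting covers for `F`,
projective ones for `G`. -/

/-- `0 ⟶ A ⟶ X ⟶ Q ⟶ 0` is short exact. -/
structure Ses {A X Q : C} (i : A ⟶ X) (p : X ⟶ Q) : Prop where
  w : i ≫ p = 0
  mono : Mono i
  epi : Epi p
  lift : ∀ ⦃Z : C⦄ (f : Z ⟶ X), f ≫ p = 0 → ∃ g : Z ⟶ A, g ≫ i = f

namespace Ses

variable {A X Q : C} {i : A ⟶ X} {p : X ⟶ Q}

lemma shortExact (h : Ses i p) : (ShortComplex.mk i p h.w).ShortExact := by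
  have := h.mono
  have := h.epi
  refine ShortComplex.ShortExact.mk' ?_ ‹_› ‹_›
  apply ShortComplex.exact_of_f_is_kernel
  exact KernelFork.IsLimit.ofι' i h.w fun {Z} f hf =>
    ⟨(h.lift f hf).choose, (h.lift f hf).choose_spec⟩

lemma of_shortExact {E : ShortComplex C} (h : E.ShortExact) : Ses E.f E.g where
  w := E.zero
  mono := h.mono_f
  epi := h.epi_g
  lift Z f hf := by
    have := h.mono_f
    exact ⟨h.exact.lift f hf, h.exact.lift_f f hf⟩

lemma desc (h : Ses i p) {Z : C} (f : X ⟶ Z) (hf : i ≫ f = 0) : ∃ g : Q ⟶ Z, p ≫ g = f := by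
  have := h.epi
  exact ⟨h.shortExact.exact.desc f hf, h.shortExact.exact.g_desc f hf⟩

lemma op (h : Ses i p) : Ses p.op i.op := of_shortExact h.shortExact.op

lemma unop {A X Q : Cᵒᵖ} {i : A ⟶ X} {p : X ⟶ Q} (h : Ses i p) : Ses p.unop i.unop :=
  of_shortExact h.shortExact.unop

lemma of_epi (p : X ⟶ Q) [Epi p] : Ses (kernel.ι p) p where
  w := kernel.condition p
  mono := inferInstance
  epi := ‹_›
  lift _ f hf := ⟨kernel.lift p f hf, kernel.lift_ι p f hf⟩

lemma of_mono (i : A ⟶ X) [Mono i] : Ses i (cokernel.π i) where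
  w := cokernel.condition i
  mono := ‹_›
  epi := inferInstance
  lift _ f hf := ⟨Abelian.monoLift i f hf, Abelian.monoLift_comp i f hf⟩

lemma mk_of_desc (w : i ≫ p = 0) [Mono i] [Epi p]
    (h : ∀ ⦃Z : C⦄ (f : X ⟶ Z), i ≫ f = 0 → ∃ g : Q ⟶ Z, p ≫ g = f) : Ses i p := by
  refine of_shortExact (E := ShortComplex.mk i p w) (ShortComplex.ShortExact.mk' ?_ ‹_› ‹_›)
  apply ShortComplex.exact_of_g_is_cokernel
  exact CokernelCofork.IsColimit.ofπ' p w fun {Z} f hf =>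
    ⟨(h f hf).choose, (h f hf).choose_spec⟩

/-- The factorization of a morphism through its image. -/
lemma image_factor (f : A ⟶ X) : ∃ (I : C) (p : A ⟶ I) (i : I ⟶ X), Epi p ∧ Mono i ∧ p ≫ i = f :=
  ⟨_, factorThruImage f, image.ι f, inferInstance, inferInstance, image.fac f⟩

lemma comp_iso (h : Ses i p) {Q' : C} (e : Q ≅ Q') : Ses i (p ≫ e.hom) := by
  have := h.epi
  refine ⟨by rw [← Category.assoc, h.w, zero_comp], h.mono, epi_comp _ _, fun Z f hf => ?_⟩
  refine h.lift f ?_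
  rwa [← Category.assoc, Preadditive.IsIso.comp_right_eq_zero] at hf

lemma iso_comp (h : Ses i p) {A' : C} (e : A' ≅ A) : Ses (e.hom ≫ i) p := by
  have := h.mono
  refine ⟨by rw [Category.assoc, h.w, comp_zero], mono_comp _ _, h.epi, fun Z f hf => ?_⟩
  obtain ⟨g, hg⟩ := h.lift f hf
  exact ⟨g ≫ e.inv, by simpa using hg⟩

lemma iso_mid (h : Ses i p) {X' : C} (e : X ≅ X') : Ses (i ≫ e.hom) (e.inv ≫ p) := by
  have := h.mono
  have := h.epi
  refine ⟨by simp [h.w], mono_comp _ _, epi_comp _ _, fun Z f hf => ?_⟩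
  obtain ⟨g, hg⟩ := h.lift (f ≫ e.inv) (by simpa using hf)
  exact ⟨g, by rw [← Category.assoc, hg]; simp⟩

lemma isZero_left (X : C) {Z : C} (hZ : IsZero Z) : Ses (0 : Z ⟶ X) (𝟙 X) :=
  ⟨by simp, ⟨fun _ _ _ => hZ.eq_of_tgt _ _⟩, inferInstance, fun Y f hf =>
    ⟨0, by simpa using hf.symm⟩⟩

lemma isZero_right (X : C) {Z : C} (hZ : IsZero Z) : Ses (𝟙 X) (0 : X ⟶ Z) :=
  ⟨by simp, inferInstance, ⟨fun _ _ _ => hZ.eq_of_src _ _⟩, fun Y f _ => ⟨f, by simp⟩⟩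

lemma biprod (X Y : C) : Ses (biprod.inl : X ⟶ X ⊞ Y) (biprod.snd : X ⊞ Y ⟶ Y) := by
  refine ⟨by simp, inferInstance, inferInstance, fun Z f hf => ⟨f ≫ biprod.fst, ?_⟩⟩
  ext <;> simp [hf]

lemma isIso_of_isZero_right (h : Ses i p) (hQ : IsZero Q) : IsIso i := by
  have := h.mono
  obtain ⟨g, hg⟩ := h.lift (𝟙 X) (hQ.eq_of_tgt _ _)
  exact ⟨g, by rw [← cancel_mono i]; simp [hg], hg⟩

lemma isIso_of_isZero_left (h : Ses i p) (hA : IsZero A) : IsIso p := by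
  have := h.epi
  obtain ⟨g, hg⟩ := h.desc (𝟙 X) (hA.eq_of_src _ _)
  exact ⟨g, hg, by rw [← cancel_epi p, ← Category.assoc, hg]; simp⟩

/-- Pullback of a short exact sequence along a morphism to its right term. -/
theorem pullback (h : Ses i p) {V : C} (f : V ⟶ Q) :
    ∃ (E : C) (a : A ⟶ E) (b : E ⟶ V) (g : E ⟶ X), Ses a b ∧ a ≫ g = i ∧ g ≫ p = b ≫ f ∧
      -- These two clauses say that `g` inherits the kernel of an epimorphism `f` and, through `p`,
      -- the cokernel of a monomorphism `f`.
      (∀ ⦃W : C⦄ (k : W ⟶ V), Ses k f → ∃ k' : W ⟶ E, k' ≫ b = k ∧ Ses k' g) ∧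
      (∀ ⦃R : C⦄ (r : Q ⟶ R), Ses f r → Ses g (p ≫ r)) := by
  have := h.epi
  have := h.mono
  let a : A ⟶ Limits.pullback p f := pullback.lift i 0 (by simp [h.w])
  have ha : a ≫ pullback.fst p f = i := pullback.lift_fst _ _ _
  have hb : a ≫ pullback.snd p f = 0 := pullback.lift_snd _ _ _
  have : Mono a := mono_of_mono_fac ha
  refine ⟨Limits.pullback p f, a, pullback.snd p f, pullback.fst p f, ⟨hb, ‹_›, inferInstance,
    fun Z g hg => ?_⟩, ha, pullback.condition, fun W k hk => ?_, fun R r hr => ?_⟩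
  · obtain ⟨l, hl⟩ := h.lift (g ≫ pullback.fst p f) (by
      rw [Category.assoc, pullback.condition, ← Category.assoc, hg, zero_comp])
    refine ⟨l, ?_⟩
    ext
    · rw [Category.assoc, ha, hl]
    · rw [Category.assoc, hb, hg, comp_zero]
  · have := hk.mono
    have := hk.epi
    let k' : W ⟶ Limits.pullback p f := pullback.lift 0 k (by simp [hk.w])
    have h1 : k' ≫ pullback.snd p f = k := pullback.lift_snd _ _ _
    have h2 : k' ≫ pullback.fst p f = 0 := pullback.lift_fst _ _ _
    refine ⟨k', h1, h2, mono_of_mono_fac h1, inferInstance, fun Z g hg => ?_⟩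
    obtain ⟨l, hl⟩ := hk.lift (g ≫ pullback.snd p f) (by
      rw [Category.assoc, ← pullback.condition, ← Category.assoc, hg, zero_comp])
    refine ⟨l, ?_⟩
    ext
    · rw [Category.assoc, h2, hg, comp_zero]
    · rw [Category.assoc, h1, hl]
  · have := hr.mono
    have := hr.epi
    refine ⟨by rw [← Category.assoc, pullback.condition, Category.assoc, hr.w, comp_zero],
      inferInstance, epi_comp _ _, fun Z g hg => ?_⟩
    obtain ⟨l, hl⟩ := hr.lift (g ≫ p) (by rw [Category.assoc, hg])
    exact ⟨pullback.lift g l hl.symm, pullback.lift_fst _ _ _⟩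

/-- Pushout of a short exact sequence along a morphism from its left term. -/
theorem pushout (h : Ses i p) {V : C} (f : A ⟶ V) :
    ∃ (E : C) (a : V ⟶ E) (b : E ⟶ Q) (g : X ⟶ E), Ses a b ∧ g ≫ b = p ∧ i ≫ g = f ≫ a ∧
      (∀ ⦃W : C⦄ (k : V ⟶ W), Ses f k → ∃ k' : E ⟶ W, a ≫ k' = k ∧ Ses g k') ∧
      (∀ ⦃R : C⦄ (r : R ⟶ A), Ses r f → Ses (r ≫ i) g) := by
  -- A pushout is a pullback in the opposite category.
  obtain ⟨E, a, b, g, h1, h2, h3, h4, h5⟩ := h.op.pullback f.op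
  refine ⟨E.unop, b.unop, a.unop, g.unop, h1.unop, congrArg Quiver.Hom.unop h2,
    congrArg Quiver.Hom.unop h3, fun W k hk => ?_, fun R r hr => ?_⟩
  · obtain ⟨k', h6, h7⟩ := h4 k.op hk.op
    exact ⟨k'.unop, congrArg Quiver.Hom.unop h6, h7.unop⟩
  · exact (h5 r.op hr.op).unop

/-- Two monomorphisms in a row: the cokernel of the composite is an extension. -/
theorem comp_mono (h : Ses i p) {R Q' : C} {j : R ⟶ A} {q : A ⟶ Q'} (h' : Ses j q) :
    ∃ (E : C) (a : Q' ⟶ E) (b : E ⟶ Q) (g : X ⟶ E), Ses a b ∧ Ses (j ≫ i) g ∧ g ≫ b = p ∧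
      i ≫ g = q ≫ a := by
  obtain ⟨E, a, b, g, h1, h2, h3, -, h5⟩ := h.pushout q
  exact ⟨E, a, b, g, h1, h5 j h', h2, h3⟩

/-- Two epimorphisms in a row: the kernel of the composite is an extension. -/
theorem comp_epi (h : Ses i p) {R K : C} {j : K ⟶ Q} {q : Q ⟶ R} (h' : Ses j q) :
    ∃ (E : C) (a : A ⟶ E) (b : E ⟶ K) (g : E ⟶ X), Ses a b ∧ Ses g (p ≫ q) ∧ a ≫ g = i ∧
      g ≫ p = b ≫ j := by
  obtain ⟨E, a, b, g, h1, h2, h3, -, h5⟩ := h.pullback j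
  exact ⟨E, a, b, g, h1, h5 q h', h2, h3⟩

end Ses

lemma retract_summand {X Y : C} (r : Retract X Y) : ∃ (Z : C), Nonempty (Y ≅ X ⊞ Z) := by
  have : Mono r.i := ⟨fun a b h => by simpa using congrArg (· ≫ r.r) h⟩
  have h := Ses.of_mono r.i
  refine ⟨cokernel r.i, ⟨?_⟩⟩
  exact ((ShortComplex.Splitting.ofExactOfRetraction _ h.shortExact.exact r.r r.retract
    h.epi).isoBinaryBiproduct : _)

lemma Ses.summand_of_retraction {A X Q : C} {i : A ⟶ X} {p : X ⟶ Q} (h : Ses i p) (r : X ⟶ A)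
    (hr : i ≫ r = 𝟙 A) : Nonempty (X ≅ A ⊞ Q) :=
  ⟨(ShortComplex.Splitting.ofExactOfRetraction _ h.shortExact.exact r hr
    h.epi).isoBinaryBiproduct⟩

lemma retract_biprod_right (X Y : C) : Nonempty (Retract Y (X ⊞ Y)) :=
  ⟨⟨biprod.inr, biprod.snd, by simp⟩⟩

end Ses

/-! ### Length functions -/

/-- An additive length function on an abelian category, vanishing only on zero objects. -/
class HasLength (C : Type u) [Category.{v} C] [Abelian C] where
  /-- the length of an object -/
  len : C → ℕ
  len_eq_zero : ∀ X, len X = 0 ↔ IsZero X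
  len_add : ∀ {A X Q : C} {i : A ⟶ X} {p : X ⟶ Q}, Ses i p → len X = len A + len Q

section Length

open scoped ZeroObject

variable {C : Type u} [Category.{v} C] [Abelian C]

open HasLength

instance [HasLength C] : HasLength Cᵒᵖ where
  len X := len X.unop
  len_eq_zero X := (len_eq_zero X.unop).trans ⟨fun h => h.op, fun h => h.unop⟩
  len_add h := (len_add h.unop).trans (add_comm _ _)

variable [HasLength C]

lemma len_pos {X : C} (h : ¬ IsZero X) : 0 < len X :=
  Nat.pos_of_ne_zero fun h' => h ((len_eq_zero X).1 h')

lemma len_iso {X Y : C} (e : X ≅ Y) : len X = len Y := by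
  have h : Ses e.hom (0 : Y ⟶ 0) := by
    simpa using (Ses.isZero_right Y (isZero_zero C)).iso_comp e
  rw [len_add h, (len_eq_zero (0 : C)).2 (isZero_zero C), add_zero]

lemma len_le_of_epi {X Y : C} (f : X ⟶ Y) [Epi f] : len Y ≤ len X :=
  (Nat.le_add_left _ _).trans (len_add (Ses.of_epi f)).ge

lemma isIso_of_mono_of_len {X Y : C} (f : X ⟶ Y) [Mono f] (h : len Y ≤ len X) : IsIso f := by
  have h1 := Ses.of_mono f
  refine h1.isIso_of_isZero_right ((len_eq_zero _).1 ?_)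
  have := len_add h1
  omega

lemma isIso_of_epi_of_len {X Y : C} (f : X ⟶ Y) [Epi f] (h : len X ≤ len Y) : IsIso f := by
  have h1 := Ses.of_epi f
  refine h1.isIso_of_isZero_left ((len_eq_zero _).1 ?_)
  have := len_add h1
  omega

lemma len_induction {motive : C → Prop} (X : C)
    (h : ∀ X, (∀ Y, len Y < len X → motive Y) → motive X) : motive X := by
  suffices ∀ n (X : C), len X = n → motive X from this _ X rfl
  intro n
  induction n using Nat.strong_induction_on with
  | _ n ih => exact fun X hX => h X fun Y hY => ih _ (hX ▸ hY) Y rfl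

/-- A nonzero object has a simple subobject. -/
theorem exists_simple_sub (X : C) (hX : ¬ IsZero X) :
    ∃ (L : C) (i : L ⟶ X), Simple L ∧ Mono i := by
  induction X using len_induction with
  | h X ih =>
    by_cases hs : Simple X
    · exact ⟨X, 𝟙 X, hs, inferInstance⟩
    · have : ∃ (Y : C) (f : Y ⟶ X), Mono f ∧ f ≠ 0 ∧ ¬ IsIso f := by
        by_contra! hc
        refine hs ⟨fun {Y} f hf => ⟨fun h h0 => hX ?_, fun h => hc Y f hf h⟩⟩
        subst h0
        exact (IsZero.iff_id_eq_zero X).2 (by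
          rw [← IsIso.inv_hom_id (0 : Y ⟶ X)]; simp)
      obtain ⟨Y, f, hf, h0, hi⟩ := this
      have hY : ¬ IsZero Y := fun h => h0 (h.eq_of_src _ _)
      obtain ⟨L, i, hL, hi'⟩ := ih Y (by
        by_contra! h
        exact hi (isIso_of_mono_of_len f h)) hY
      exact ⟨L, i ≫ f, hL, mono_comp _ _⟩

end Length

/-! ### Simple objects in the opposite category -/

section OpSimple

variable {C : Type u} [Category.{v} C] [Abelian C]

lemma simple_op {X : C} (h : Simple X) : Simple (Opposite.op X) := by
  refine ⟨fun {Y} f hf => ⟨fun _ h0 => ?_, fun h0 => ?_⟩⟩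
  · have : IsIso (0 : X ⟶ Y.unop) := by
      have h1 : IsIso f.unop := inferInstance
      rw [h0] at h1
      exact h1
    exact Simple.not_isZero X ((IsZero.iff_id_eq_zero X).2 (by
      rw [← IsIso.hom_inv_id (0 : X ⟶ Y.unop), zero_comp]))
  · have : Epi f.unop := inferInstance
    have : IsIso f.unop := isIso_of_epi_of_nonzero fun h1 => h0 (by
      rw [← f.op_unop, h1]; rfl)
    rw [← f.op_unop]
    infer_instance

lemma simple_unop {X : Cᵒᵖ} (h : Simple X) : Simple X.unop := by
  refine simple_of_cosimple _ fun {Z} f _ => ?_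
  have h1 := h.mono_isIso_iff_nonzero f.op
  rw [isIso_op_iff] at h1
  rw [h1]
  exact ⟨fun h h0 => h (by rw [h0]; rfl), fun h h0 => h (Quiver.Hom.op_inj h0)⟩

/-- A nonzero object has a simple quotient. -/
theorem exists_simple_quotient [HasLength C] (X : C) (hX : ¬ IsZero X) :
    ∃ (L : C) (p : X ⟶ L), Simple L ∧ Epi p := by
  obtain ⟨L, i, hL, hi⟩ := exists_simple_sub (Opposite.op X) fun h => hX h.unop
  exact ⟨L.unop, i.unop, simple_unop hL, inferInstance⟩

lemma isIso_of_simple {X Y : C} (hX : Simple X) (hY : Simple Y) {f : X ⟶ Y} (hf : f ≠ 0) :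
    IsIso f := isIso_of_hom_simple hf

lemma mono_of_simple {X Y : C} (hX : Simple X) {f : X ⟶ Y} (hf : f ≠ 0) : Mono f :=
  mono_of_nonzero_from_simple hf

lemma epi_of_simple {X Y : C} (hY : Simple Y) {f : X ⟶ Y} (hf : f ≠ 0) : Epi f :=
  epi_of_nonzero_to_simple hf

end OpSimple

/-! ### Endomorphisms of indecomposable objects -/

section Indecomposable

variable {C : Type u} [Category.{v} C] [Abelian C]

lemma Retract.isZero_or_of_indecomposable {X Y : C} (hY : Indecomposable Y) (r : Retract X Y) :
    IsZero X ∨ IsIso r.i := by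
  have : Mono r.i := ⟨fun a b h => by simpa using congrArg (· ≫ r.r) h⟩
  have h := Ses.of_mono r.i
  obtain ⟨e⟩ := h.summand_of_retraction r.r r.retract
  rcases hY.2 _ _ e with h1 | h1
  · exact Or.inl h1
  · exact Or.inr (h.isIso_of_isZero_right h1)

/-- The endomorphism ring of an indecomposable object of finite length is local. -/
theorem isIso_or_isIso_id_sub [HasLength C] {X : C} (hX : Indecomposable X) (e : X ⟶ X) :
    IsIso e ∨ IsIso (𝟙 X - e) := by
  let e' : End X := e
  -- Fitting's argument: choose a power of `e` whose image has minimal length. The shift to `n + 1`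
  -- keeps exponents positive, and the square of that power has index `2 * n + 1`.
  let m : ℕ → ℕ := fun n => HasLength.len (image (show X ⟶ X from e' ^ (n + 1)))
  obtain ⟨n, hn⟩ : ∃ n, ∀ n', m n ≤ m n' :=
    ⟨Function.argmin m, fun a => Function.argmin_le m a⟩
  obtain ⟨f, hf⟩ : ∃ f : X ⟶ X, f = (e' ^ (n + 1) : End X) := ⟨_, rfl⟩
  obtain ⟨f2, hf2⟩ : ∃ f2 : X ⟶ X, f2 = (e' ^ ((2 * n + 1) + 1) : End X) := ⟨_, rfl⟩
  have hff : f ≫ f = f2 := by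
    rw [hf, hf2]
    change (e' ^ (n + 1) : End X) * (e' ^ (n + 1)) = _
    rw [← pow_add]
    congr 1
    ring
  have hlen : HasLength.len (image f) ≤ HasLength.len (image f2) := by
    rw [hf, hf2]
    exact hn _
  -- `j` is `f` restricted to its image. The image of the square of `f` is a quotient of the image
  -- of `j`, so minimality makes `j` invertible and the image of `f` a direct summand of `X`.
  let j := Limits.image.ι f ≫ Limits.factorThruImage f
  have hfac : f2 = (Limits.factorThruImage f ≫ Limits.factorThruImage j) ≫
      (Limits.image.ι j ≫ Limits.image.ι f) := by
    rw [← hff]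
    conv_lhs => rw [← Limits.image.fac f]
    have := Limits.image.fac j
    simp only [Category.assoc]
    rw [reassoc_of% this]
    simp [j]
  have hl2 : HasLength.len (image f2) ≤ HasLength.len (image j) := by
    have : Epi (image.preComp (Limits.factorThruImage f ≫ Limits.factorThruImage j)
      (Limits.image.ι j ≫ Limits.image.ι f)) := inferInstance
    have h1 : HasLength.len (image f2) =
        HasLength.len (image (Limits.image.ι j ≫ Limits.image.ι f)) := by
      have e1 : image f2 ≅ image ((Limits.factorThruImage f ≫ Limits.factorThruImage j) ≫
        (Limits.image.ι j ≫ Limits.image.ι f)) := image.eqToIso hfac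
      have : IsIso (image.preComp (Limits.factorThruImage f ≫ Limits.factorThruImage j)
        (Limits.image.ι j ≫ Limits.image.ι f)) := isIso_of_mono_of_epi _
      exact len_iso (e1 ≪≫ asIso (image.preComp (Limits.factorThruImage f ≫ Limits.factorThruImage j)
        (Limits.image.ι j ≫ Limits.image.ι f)))
    rw [h1]
    exact len_le_of_epi (Limits.factorThruImage (Limits.image.ι j ≫ Limits.image.ι f))
  have : Epi j := by
    have : IsIso (Limits.image.ι j) := isIso_of_mono_of_len _ (hlen.trans hl2)
    rw [← Limits.image.fac j]
    exact epi_comp _ _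
  have hj : IsIso j := isIso_of_epi_of_len j le_rfl
  let r : Retract (image f) X := ⟨Limits.image.ι f, Limits.factorThruImage f ≫ inv j, by
    rw [← Category.assoc]; exact IsIso.hom_inv_id j⟩
  have hunit : IsIso f → IsIso e := by
    intro hi
    have h1 : IsUnit (e' ^ (n + 1)) := by
      rw [isUnit_iff_isIso]
      rw [← hf]; exact hi
    have h2 := (isUnit_pow_iff (Nat.succ_ne_zero n)).1 h1
    rwa [isUnit_iff_isIso] at h2
  rcases Retract.isZero_or_of_indecomposable hX r with h0 | hi
  · right
    have hf0 : f = 0 := by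
      rw [← Limits.image.fac f, h0.eq_of_src (Limits.image.ι f) 0, comp_zero]
    have hnil : IsNilpotent e' := ⟨n + 1, by rw [← hf]; exact hf0⟩
    have := hnil.isUnit_one_sub
    rwa [isUnit_iff_isIso] at this
  · left
    apply hunit
    have : IsIso (Limits.image.ι f) := hi
    have h2 : IsIso (Limits.factorThruImage f) := by
      have : Limits.factorThruImage f = inv (Limits.image.ι f) ≫ j := by simp [j]
      rw [this]
      infer_instance
    rw [← Limits.image.fac f]
    infer_instance

lemma indecomposable_op {X : C} (hX : Indecomposable X) : Indecomposable (Opposite.op X) := by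
  refine ⟨fun h => hX.1 h.unop, fun Y Z e => ?_⟩
  have hs := (Ses.biprod Y Z).unop
  have := hs.summand_of_retraction (biprod.inr : Z ⟶ Y ⊞ Z).unop (by
    rw [← unop_comp, biprod.inr_snd]; rfl)
  obtain ⟨e'⟩ := this
  rcases hX.2 _ _ (e.unop.symm ≪≫ e') with h | h
  · exact Or.inr h.op
  · exact Or.inl h.op

lemma indecomposable_unop {X : Cᵒᵖ} (hX : Indecomposable X) : Indecomposable X.unop := by
  refine ⟨fun h => hX.1 h.op, fun Y Z e => ?_⟩
  have hs := (Ses.biprod Y Z).op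
  obtain ⟨e'⟩ := hs.summand_of_retraction (biprod.inr : Z ⟶ Y ⊞ Z).op (by
    rw [← op_comp, biprod.inr_snd]; rfl)
  rcases hX.2 _ _ (e.op.symm ≪≫ e') with h | h
  · exact Or.inr h.unop
  · exact Or.inl h.unop

lemma indecomposable_of_iso {X Y : C} (e : X ≅ Y) (hX : Indecomposable X) : Indecomposable Y :=
  ⟨fun h => hX.1 (h.of_iso e), fun A A' f => hX.2 A A' (e ≪≫ f)⟩

/-- An object all of whose idempotent endomorphisms are trivial is indecomposable. -/
lemma indecomposable_of_idempotents {X : C} (h0 : ¬ IsZero X)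
    (h : ∀ e : X ⟶ X, e ≫ e = e → e = 0 ∨ e = 𝟙 X) : Indecomposable X := by
  refine ⟨h0, fun Y Z e => ?_⟩
  rcases h (e.hom ≫ biprod.fst ≫ biprod.inl ≫ e.inv) (by simp) with h1 | h1
  · left
    rw [IsZero.iff_id_eq_zero]
    have := congrArg (fun t => biprod.inl ≫ e.inv ≫ t ≫ e.hom ≫ biprod.fst) h1
    simpa using this
  · right
    rw [IsZero.iff_id_eq_zero]
    have := congrArg (fun t => biprod.inr ≫ e.inv ≫ t ≫ e.hom ≫ biprod.snd) h1
    simpa using this.symm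

end Indecomposable

/-! ### Vanishing of extension groups -/

section ExtZero

variable {C : Type u} [Category.{v} C] [Abelian C] [HasExt.{w} C]

/-- The extension group `Extⁿ(X, Y)` vanishes. -/
def ExtZero (n : ℕ) (X Y : C) : Prop := ∀ e : Ext.{w} X Y n, e = 0

namespace ExtZero

variable {A X Q Y : C} {i : A ⟶ X} {p : X ⟶ Q} {n : ℕ}

lemma of_projective (P : C) [Projective P] (Y : C) (n : ℕ) : ExtZero.{w} (n + 1) P Y :=
  fun e => e.eq_zero_of_projective

lemma of_injective (X : C) (I : C) [Injective I] (n : ℕ) : ExtZero.{w} (n + 1) X I :=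
  fun e => e.eq_zero_of_injective

/-- Extension of a morphism along a monomorphism. -/
lemma extend (h : Ses i p) (h1 : ExtZero.{w} 1 Q Y) (f : A ⟶ Y) : ∃ g : X ⟶ Y, i ≫ g = f := by
  obtain ⟨x, hx⟩ := Ext.contravariant_sequence_exact₁ h.shortExact Y (Ext.mk₀ f) (add_zero 1)
    (h1 _)
  obtain ⟨g, rfl⟩ := (Ext.mk₀_bijective X Y).2 x
  exact ⟨g, (Ext.mk₀_bijective A Y).1 (by rw [← hx, Ext.mk₀_comp_mk₀])⟩

/-- Lifting of a morphism along an epimorphism. -/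
lemma lift (h : Ses i p) (h1 : ExtZero.{w} 1 Y A) (f : Y ⟶ Q) : ∃ g : Y ⟶ X, g ≫ p = f := by
  obtain ⟨x, hx⟩ := Ext.covariant_sequence_exact₃ Y h.shortExact (Ext.mk₀ f) (zero_add 1)
    (h1 _)
  obtain ⟨g, rfl⟩ := (Ext.mk₀_bijective Y X).2 x
  exact ⟨g, (Ext.mk₀_bijective Y Q).1 (by rw [← hx, Ext.mk₀_comp_mk₀])⟩

lemma covariant_mid (h : Ses i p) (h1 : ExtZero.{w} n Y A) (h2 : ExtZero.{w} n Y Q) :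
    ExtZero.{w} n Y X := by
  intro e
  obtain ⟨x, hx⟩ := Ext.covariant_sequence_exact₂ Y h.shortExact e (h2 _)
  rw [← hx, h1 x, Ext.zero_comp]

lemma contravariant_mid (h : Ses i p) (h1 : ExtZero.{w} n A Y) (h2 : ExtZero.{w} n Q Y) :
    ExtZero.{w} n X Y := by
  intro e
  obtain ⟨x, hx⟩ := Ext.contravariant_sequence_exact₂ h.shortExact Y e (h1 _)
  rw [← hx, h2 x, Ext.comp_zero]

lemma covariant_right (h : Ses i p) (h1 : ExtZero.{w} n Y X) (h2 : ExtZero.{w} (n + 1) Y A) :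
    ExtZero.{w} n Y Q := by
  intro e
  obtain ⟨x, hx⟩ := Ext.covariant_sequence_exact₃ Y h.shortExact e rfl (h2 _)
  rw [← hx, h1 x, Ext.zero_comp]

lemma contravariant_right (h : Ses i p) (h1 : ExtZero.{w} n A Y)
    (h2 : ExtZero.{w} (n + 1) X Y) : ExtZero.{w} (n + 1) Q Y := by
  intro e
  obtain ⟨x, hx⟩ := Ext.contravariant_sequence_exact₃ h.shortExact Y e (h2 _) (add_comm 1 n)
  rw [← hx, h1 x, Ext.comp_zero]

/-- `Ext¹(Q, Y)` vanishes if morphisms to `Y` extend along `A ⟶ X` and `Ext¹(X, Y)` vanishes. -/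
lemma one_of_extend (h : Ses i p) (h1 : ExtZero.{w} 1 X Y)
    (h2 : ∀ f : A ⟶ Y, ∃ g : X ⟶ Y, i ≫ g = f) : ExtZero.{w} 1 Q Y := by
  intro e
  obtain ⟨x, hx⟩ := Ext.contravariant_sequence_exact₃ h.shortExact Y e (h1 _) (add_zero 1)
  obtain ⟨f, rfl⟩ := (Ext.mk₀_bijective _ _).2 x
  obtain ⟨g, rfl⟩ := h2 f
  rw [← hx, ← Ext.mk₀_comp_mk₀, ← Ext.comp_assoc_of_second_deg_zero]
  have := h.shortExact.extClass_comp
  dsimp at this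
  rw [this, Ext.zero_comp]

/-- `Ext¹(Y, A)` vanishes if morphisms from `Y` lift along `X ⟶ Q` and `Ext¹(Y, X)` vanishes. -/
lemma one_of_lift (h : Ses i p) (h1 : ExtZero.{w} 1 Y X)
    (h2 : ∀ f : Y ⟶ Q, ∃ g : Y ⟶ X, g ≫ p = f) : ExtZero.{w} 1 Y A := by
  intro e
  obtain ⟨x, hx⟩ := Ext.covariant_sequence_exact₁ Y h.shortExact e (h1 _) (zero_add 1)
  obtain ⟨f, rfl⟩ := (Ext.mk₀_bijective _ _).2 x
  obtain ⟨g, rfl⟩ := h2 f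
  rw [← hx, ← Ext.mk₀_comp_mk₀, Ext.comp_assoc_of_second_deg_zero]
  have := h.shortExact.comp_extClass
  dsimp at this
  rw [this, Ext.comp_zero]

lemma of_isZero_left (hX : IsZero X) (Y : C) (n : ℕ) : ExtZero.{w} n X Y := by
  intro e
  rw [← Ext.mk₀_id_comp e, hX.eq_of_src (𝟙 X) 0, Ext.mk₀_zero, Ext.zero_comp]

lemma of_isZero_right (X : C) (hY : IsZero Y) (n : ℕ) : ExtZero.{w} n X Y := by
  intro e
  rw [← Ext.comp_mk₀_id e, hY.eq_of_src (𝟙 Y) 0, Ext.mk₀_zero, Ext.comp_zero]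

lemma of_retract_right (r : Retract Y Q) (h : ExtZero.{w} n X Q) : ExtZero.{w} n X Y := by
  intro e
  rw [← Ext.comp_mk₀_id e, ← r.retract, ← Ext.mk₀_comp_mk₀, ← Ext.comp_assoc_of_second_deg_zero,
    h (e.comp (Ext.mk₀ r.i) (add_zero n)), Ext.zero_comp]

end ExtZero

end ExtZero

/-! ### Composition factors -/

section CompositionFactors

variable {C : Type u} [Category.{v} C] [Abelian C]

namespace IsCompositionFactor

variable {S X Y Q A : C}

lemma of_mono (h : IsCompositionFactor S X) (f : X ⟶ Y) [Mono f] : IsCompositionFactor S Y := by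
  obtain ⟨hS, U, i, p, hi, hp⟩ := h
  exact ⟨hS, U, i ≫ f, p, mono_comp _ _, hp⟩

lemma of_epi (h : IsCompositionFactor S Y) (f : X ⟶ Y) [Epi f] : IsCompositionFactor S X := by
  obtain ⟨hS, U, i, p, hi, hp⟩ := h
  exact ⟨hS, pullback f i, pullback.fst f i, pullback.snd f i ≫ p, inferInstance,
    epi_comp _ _⟩

/-- Intersect the source `U` of the subquotient with `A`. If the intersection still maps
nontrivially to the simple `S`, then `S` occurs in `A`; otherwise `U ⟶ S` factors through the image
of `U` in `Q`. -/
lemma of_ses {i : A ⟶ X} {p : X ⟶ Q} (h : Ses i p) (hX : IsCompositionFactor S X) :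
    IsCompositionFactor S A ∨ IsCompositionFactor S Q := by
  obtain ⟨hS, U, j, q, hj, hq⟩ := hX
  have := h.mono
  have := h.epi
  by_cases h0 : pullback.snd i j ≫ q = 0
  · right
    obtain ⟨I, a, b, ha, hb, hab⟩ := Ses.image_factor (j ≫ p)
    have hk : Ses (kernel.ι a) a := Ses.of_epi a
    obtain ⟨g, hg⟩ := hk.desc q (by
      obtain ⟨l, hl⟩ := h.lift (kernel.ι a ≫ j) (by
        rw [Category.assoc, ← hab, ← Category.assoc, kernel.condition, zero_comp])
      have : kernel.ι a = pullback.lift l (kernel.ι a) hl ≫ pullback.snd i j :=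
        (pullback.lift_snd _ _ _).symm
      rw [this, Category.assoc, h0, comp_zero])
    have : Epi g := epi_of_epi_fac hg
    exact ⟨hS, I, b, g, hb, this⟩
  · left
    exact ⟨hS, _, pullback.fst i j, pullback.snd i j ≫ q, inferInstance,
      epi_of_simple hS h0⟩

lemma self (h : Simple S) : IsCompositionFactor S S := ⟨h, S, 𝟙 S, 𝟙 S, inferInstance, inferInstance⟩

lemma of_simple_epi (h : Simple S) (f : X ⟶ S) [Epi f] : IsCompositionFactor S X :=
  (self h).of_epi f

lemma of_simple_mono (h : Simple S) (f : S ⟶ X) [Mono f] : IsCompositionFactor S X :=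
  (self h).of_mono f

lemma not_isZero (h : IsCompositionFactor S X) : ¬ IsZero X := by
  intro hX
  obtain ⟨hS, U, i, p, hi, hp⟩ := h
  have hU : IsZero U := by
    rw [IsZero.iff_id_eq_zero, ← cancel_mono i]
    exact hX.eq_of_tgt _ _
  exact Simple.not_isZero S (by
    rw [IsZero.iff_id_eq_zero, ← cancel_epi p]
    exact hU.eq_of_src _ _)

lemma iso_of_simple (h : IsCompositionFactor S X) (hX : Simple X) : Nonempty (S ≅ X) := by
  obtain ⟨hS, U, i, p, hi, hp⟩ := h
  have hi0 : i ≠ 0 := by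
    rintro rfl
    have hU : IsZero U := by
      rw [IsZero.iff_id_eq_zero, ← cancel_mono (0 : U ⟶ X)]
      simp
    exact Simple.not_isZero S (by
      rw [IsZero.iff_id_eq_zero, ← cancel_epi p]
      exact hU.eq_of_src _ _)
  have : IsIso i := isIso_of_mono_of_nonzero hi0
  have h0 : inv i ≫ p ≠ 0 := by
    intro h0
    have hp0 : p = 0 := by simpa using h0
    exact Simple.not_isZero S (by
      rw [IsZero.iff_id_eq_zero, ← cancel_epi p, hp0]
      simp)
  have := isIso_of_simple hX hS h0
  exact ⟨(asIso (inv i ≫ p)).symm⟩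

lemma op (h : IsCompositionFactor S X) :
    IsCompositionFactor (Opposite.op S) (Opposite.op X) := by
  obtain ⟨hS, U, i, p, hi, hp⟩ := h
  exact ⟨simple_op hS, Opposite.op (pushout i p), (pushout.inl i p).op, (pushout.inr i p).op,
    inferInstance, inferInstance⟩

lemma unop {S X : Cᵒᵖ} (h : IsCompositionFactor S X) :
    IsCompositionFactor S.unop X.unop := by
  obtain ⟨hS, U, i, p, hi, hp⟩ := h
  exact ⟨simple_unop hS, (pushout i p).unop, (pushout.inl i p).unop, (pushout.inr i p).unop,
    inferInstance, inferInstance⟩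

end IsCompositionFactor

end CompositionFactors

/-! ### Essential epimorphisms onto simple objects and projective covers -/

section Local

variable {C : Type u} [Category.{v} C] [Abelian C]

/-- `h : V ⟶ S` exhibits the simple object `S` as the head of `V`. -/
structure IsLocal {V S : C} (h : V ⟶ S) : Prop where
  simple : Simple S
  epi : Epi h
  essential : ∀ ⦃Y : C⦄ (f : Y ⟶ V), f ≫ h ≠ 0 → Epi f

lemma IsProjectiveCover.isLocal {P S : C} {π : P ⟶ S} (h : IsProjectiveCover π) (hS : Simple S) :
    IsLocal π :=
  ⟨hS, h.epi, fun _ f hf => h.essential f (epi_of_simple hS hf)⟩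

lemma IsLocal.isProjectiveCover {P S : C} {π : P ⟶ S} (h : IsLocal π) (hP : Projective P) :
    IsProjectiveCover π :=
  ⟨hP, h.epi, fun Y f hf => h.essential f fun h0 => by
    rw [h0] at hf
    have := h.simple
    exact Simple.not_isZero S (by
      rw [IsZero.iff_id_eq_zero, ← cancel_epi (0 : Y ⟶ S)]
      simp)⟩

namespace IsLocal

variable {V S : C} {h : V ⟶ S}

lemma ne_zero (hl : IsLocal h) : h ≠ 0 := by
  rintro rfl
  have := hl.simple
  have := hl.epi
  exact Simple.not_isZero S (by
    rw [IsZero.iff_id_eq_zero, ← cancel_epi (0 : V ⟶ S)]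
    simp)

lemma not_isZero (hl : IsLocal h) : ¬ IsZero V := fun h0 => hl.ne_zero (h0.eq_of_src _ _)

/-- A nonzero quotient of a local object is local. -/
lemma factor (hl : IsLocal h) {X : C} {f : V ⟶ X} (hf : Epi f) (h0 : f ≠ 0) :
    ∃ h' : X ⟶ S, f ≫ h' = h ∧ IsLocal h' := by
  have := hl.epi
  -- Otherwise the inclusion of the kernel would be epi and `f` would vanish.
  have hk : kernel.ι f ≫ h = 0 := by
    by_contra hne
    have := hl.essential _ hne
    exact h0 (by rw [← cancel_epi (kernel.ι f), kernel.condition, comp_zero])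
  obtain ⟨h', hh'⟩ := (Ses.of_epi f).desc h hk
  refine ⟨h', hh', hl.simple, epi_of_epi_fac hh', fun Y g hg => ?_⟩
  have : pullback.fst f g ≫ h ≠ 0 := by
    rw [← hh', ← Category.assoc, pullback.condition, Category.assoc]
    intro h1
    exact hg (by rwa [← cancel_epi (pullback.snd f g), comp_zero])
  have := hl.essential _ this
  have h2 : Epi (pullback.snd f g ≫ g) := by
    rw [← pullback.condition]; exact epi_comp _ _
  exact epi_of_epi (pullback.snd f g) g

lemma factor_image (hl : IsLocal h) {X : C} {f : V ⟶ X} (h0 : f ≠ 0) :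
    ∃ (I : C) (p : V ⟶ I) (i : I ⟶ X) (h' : I ⟶ S), Epi p ∧ Mono i ∧ p ≫ i = f ∧
      p ≫ h' = h ∧ IsLocal h' := by
  obtain ⟨I, p, i, hp, hi, hpi⟩ := Ses.image_factor f
  obtain ⟨h', h1, h2⟩ := hl.factor hp (by rintro rfl; exact h0 (by rw [← hpi, zero_comp]))
  exact ⟨I, p, i, h', hp, hi, hpi, h1, h2⟩

/-- The head of a local object is a composition factor of every object that it maps to. -/
lemma isCompositionFactor (hl : IsLocal h) {X : C} {f : V ⟶ X} (h0 : f ≠ 0) :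
    IsCompositionFactor S X := by
  obtain ⟨I, p, i, h', hp, hi, hpi, h1, h2⟩ := hl.factor_image h0
  exact ⟨hl.simple, I, i, h', hi, h2.epi⟩

lemma to_simple (hl : IsLocal h) {X : C} (hX : Simple X) {f : V ⟶ X} (h0 : f ≠ 0) :
    ∃ e : S ≅ X, h ≫ e.hom = f := by
  have := epi_of_simple hX h0
  obtain ⟨h', h1, h2⟩ := hl.factor this h0
  have := hl.simple
  have : IsIso h' := isIso_of_simple hX hl.simple h2.ne_zero
  exact ⟨(asIso h').symm, by simp [← h1]⟩

lemma comp_iso (hl : IsLocal h) {S' : C} (e : S ≅ S') : IsLocal (h ≫ e.hom) := by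
  have := hl.simple
  have := hl.epi
  refine ⟨Simple.of_iso e.symm, epi_comp _ _, fun Y f hf => hl.essential f fun h0 => hf ?_⟩
  rw [← Category.assoc, h0, zero_comp]

lemma iso_comp (hl : IsLocal h) {V' : C} (e : V' ≅ V) : IsLocal (e.hom ≫ h) := by
  have := hl.epi
  refine ⟨hl.simple, epi_comp _ _, fun Y f hf => ?_⟩
  have : Epi (f ≫ e.hom) := hl.essential _ (by simpa using hf)
  have h2 : Epi ((f ≫ e.hom) ≫ e.inv) := epi_comp _ _
  simpa using h2

/-- Some summand maps nontrivially to the head; its inclusion is then epi, which forces the other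
summand to vanish. -/
lemma indecomposable (hl : IsLocal h) : Indecomposable V := by
  refine ⟨hl.not_isZero, fun Y Z e => ?_⟩
  by_cases h1 : biprod.inl ≫ e.inv ≫ h = 0
  · left
    have h2 : (biprod.inr ≫ e.inv) ≫ h ≠ 0 := by
      intro h2
      refine hl.ne_zero ?_
      rw [← cancel_epi e.inv, comp_zero]
      ext
      · simpa using h1
      · simpa using h2
    have h3 := hl.essential _ h2
    have h4 : (biprod.inr ≫ e.inv) ≫ e.hom ≫ biprod.fst = (0 : Z ⟶ Y) := by simp
    have h5 : e.hom ≫ (biprod.fst : Y ⊞ Z ⟶ Y) = 0 := by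
      rw [← cancel_epi (biprod.inr ≫ e.inv), h4, comp_zero]
    rw [IsZero.iff_id_eq_zero]
    have := congrArg (fun t => biprod.inl ≫ e.inv ≫ t) h5
    simpa using this
  · right
    have h3 := hl.essential (biprod.inl ≫ e.inv) (by simpa using h1)
    have h4 : (biprod.inl ≫ e.inv) ≫ e.hom ≫ biprod.snd = (0 : Y ⟶ Z) := by simp
    have h5 : e.hom ≫ (biprod.snd : Y ⊞ Z ⟶ Z) = 0 := by
      rw [← cancel_epi (biprod.inl ≫ e.inv), h4, comp_zero]
    rw [IsZero.iff_id_eq_zero]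
    have := congrArg (fun t => biprod.inr ≫ e.inv ≫ t) h5
    simpa using this

end IsLocal

/-- Composition factors are detected by morphisms from a projective cover. -/
lemma IsProjectiveCover.isCompositionFactor_iff {P S : C} {π : P ⟶ S} (h : IsProjectiveCover π)
    (hS : Simple S) (X : C) : IsCompositionFactor S X ↔ ∃ f : P ⟶ X, f ≠ 0 := by
  refine ⟨fun ⟨_, U, i, p, hi, hp⟩ => ?_, fun ⟨f, hf⟩ => (h.isLocal hS).isCompositionFactor hf⟩
  have := h.projective
  refine ⟨Projective.factorThru π p ≫ i, fun h0 => (h.isLocal hS).ne_zero ?_⟩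
  rw [← Projective.factorThru_comp π p, zero_of_comp_mono i h0, zero_comp]

/-- Projective covers are unique up to isomorphism. -/
lemma IsProjectiveCover.exists_iso [HasLength C] {P P' S S' : C} {π : P ⟶ S} {π' : P' ⟶ S'}
    (h : IsProjectiveCover π) (h' : IsProjectiveCover π') (e : S ≅ S') :
    ∃ φ : P ≅ P', φ.hom ≫ π' = π ≫ e.hom := by
  have := h.projective
  have := h'.projective
  have := h.epi
  have := h'.epi
  have ha := Projective.factorThru_comp (π ≫ e.hom) π'
  have hb := Projective.factorThru_comp (π' ≫ e.inv) π
  have h1 : Epi (Projective.factorThru (π ≫ e.hom) π') :=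
    h'.essential _ (by rw [ha]; exact epi_comp _ _)
  have h2 : Epi (Projective.factorThru (π' ≫ e.inv) π) :=
    h.essential _ (by rw [hb]; exact epi_comp _ _)
  have := isIso_of_epi_of_len (Projective.factorThru (π ≫ e.hom) π')
    (len_le_of_epi (Projective.factorThru (π' ≫ e.inv) π))
  exact ⟨asIso (Projective.factorThru (π ≫ e.hom) π'), ha⟩

/-- An indecomposable projective object is local. -/
lemma isLocal_of_indecomposable_projective [HasLength C] {P S : C} (hP : Projective P)
    (hi : Indecomposable P) (hS : Simple S) {π : P ⟶ S} (h0 : π ≠ 0) : IsLocal π := by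
  have he := epi_of_simple hS h0
  refine ⟨hS, he, fun Y f hf => ?_⟩
  have := epi_of_simple hS hf
  -- Lifting `π` along `f ≫ π` gives `s : P ⟶ Y` with `(𝟙 P - s ≫ f) ≫ π = 0`. As `End P` is local,
  -- `s ≫ f` is invertible, so `f` is epi.
  have h1 := Projective.factorThru_comp π (f ≫ π)
  have h2 : ¬ IsIso (𝟙 P - Projective.factorThru π (f ≫ π) ≫ f) := by
    intro h3
    refine h0 ?_
    have h4 : (𝟙 P - Projective.factorThru π (f ≫ π) ≫ f) ≫ π = 0 := by
      simp [Preadditive.sub_comp, h1]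
    exact (Preadditive.IsIso.comp_left_eq_zero _ _).1 h4
  have h3 := (isIso_or_isIso_id_sub hi (Projective.factorThru π (f ≫ π) ≫ f)).resolve_right h2
  exact epi_of_epi (Projective.factorThru π (f ≫ π)) f

end Local

/-! ### Flags -/

section Flags

variable {C : Type u} [Category.{v} C] [Abelian C] {B : Type w} {D : B → C → Prop}

lemma Flag.cons_of_ses {b : B} {l : List B} {U V X : C} {i : U ⟶ V} {p : V ⟶ X} (h : Ses i p)
    (hU : Flag D l U) (hX : D b X) : Flag D (b :: l) V :=
  Flag.cons i p h.w h.shortExact hU hX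

lemma Flag.iso {l : List B} {V W : C} (h : Flag D l V) (e : V ≅ W) : Flag D l W := by
  cases h with
  | zero hV => exact Flag.zero (hV.of_iso e.symm)
  | cons i p w hs hU hX =>
    exact Flag.cons_of_ses ((Ses.of_shortExact hs).iso_mid e) hU hX

lemma Flag.isZero {V : C} (h : Flag D [] V) : IsZero V := by
  cases h with
  | zero hV => exact hV

lemma Flag.exists_ses {b : B} {l : List B} {V : C} (h : Flag D (b :: l) V) :
    ∃ (U X : C) (i : U ⟶ V) (p : V ⟶ X), Ses i p ∧ Flag D l U ∧ D b X := by
  cases h with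
  | cons i p w hs hU hX => exact ⟨_, _, i, p, Ses.of_shortExact hs, hU, hX⟩

lemma Flag.single {b : B} {V : C} (h : D b V) : Flag D [b] V :=
  Flag.cons_of_ses (Ses.isZero_left V (isZero_zero C)) (Flag.zero (isZero_zero C)) h

/-- Flags of the outer terms of a short exact sequence yield a flag of the middle term. -/
theorem Flag.append {l l' : List B} {U V X : C} {i : U ⟶ V} {p : V ⟶ X} (h : Ses i p)
    (hX : Flag D l X) (hU : Flag D l' U) : Flag D (l ++ l') V := by
  induction l generalizing V X with
  | nil =>
    have := h.isIso_of_isZero_right hX.isZero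
    exact hU.iso (asIso i)
  | cons b l ih =>
    obtain ⟨X', Y, j, q, hs, hX', hY⟩ := hX.exists_ses
    obtain ⟨E, a, c, g, h1, h2, -, -⟩ := h.comp_epi hs
    exact Flag.cons_of_ses h2 (ih h1 hX') hY

/-- The bottom section of a flag. -/
theorem Flag.exists_bottom {l : List B} {b : B} {V : C} (h : Flag D (l ++ [b]) V) :
    ∃ (X Q : C) (i : X ⟶ V) (p : V ⟶ Q), Ses i p ∧ D b X ∧ Flag D l Q := by
  induction l generalizing V with
  | nil =>
    obtain ⟨U, X, i, p, hs, hU, hX⟩ := h.exists_ses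
    have := hs.isIso_of_isZero_left hU.isZero
    exact ⟨X, U, inv p, 0, by simpa using (Ses.isZero_right V hU.isZero).iso_comp (asIso p).symm,
      hX, hU⟩
  | cons c l ih =>
    obtain ⟨U, Y, i, p, hs, hU, hY⟩ := h.exists_ses
    obtain ⟨X, Q, j, q, hs', hX, hQ⟩ := ih hU
    obtain ⟨E, a, b, g, h1, h2, -, -⟩ := hs.comp_mono hs'
    exact ⟨X, E, j ≫ i, g, h2, hX, Flag.cons_of_ses h1 hQ hY⟩

lemma Flag.of_bottom {l : List B} {b : B} {X V Q : C} {i : X ⟶ V} {p : V ⟶ Q} (h : Ses i p)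
    (hX : D b X) (hQ : Flag D l Q) : Flag D (l ++ [b]) V :=
  Flag.append h hQ (Flag.single hX)

lemma Flag.op {D' : B → Cᵒᵖ → Prop} (hD : ∀ b X, D b X → D' b (Opposite.op X)) {l : List B}
    {V : C} (h : Flag D l V) : Flag D' l.reverse (Opposite.op V) := by
  induction l generalizing V with
  | nil => exact Flag.zero h.isZero.op
  | cons b l ih =>
    obtain ⟨U, X, i, p, hs, hU, hX⟩ := h.exists_ses
    rw [List.reverse_cons]
    exact Flag.of_bottom hs.op (hD _ _ hX) (ih hU)

lemma Flag.unop {D' : B → Cᵒᵖ → Prop} (hD : ∀ b X, D' b X → D b X.unop) {l : List B}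
    {V : Cᵒᵖ} (h : Flag D' l V) : Flag D l.reverse V.unop := by
  induction l generalizing V with
  | nil => exact Flag.zero h.isZero.unop
  | cons b l ih =>
    obtain ⟨U, X, i, p, hs, hU, hX⟩ := h.exists_ses
    rw [List.reverse_cons]
    exact Flag.of_bottom hs.unop (hD _ _ hX) (ih hU)

end Flags

/-! ### Projective covers and injective hulls under passage to the opposite category -/

section Covers

variable {C : Type u} [Category.{v} C]

lemma ProjectiveCoverOf.op {X P : C} (h : ProjectiveCoverOf X P) :
    InjectiveHullOf (Opposite.op X) (Opposite.op P) := by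
  obtain ⟨π, h1, h2, h3⟩ := h
  refine ⟨π.op, inferInstance, inferInstance, fun Y f hf => ?_⟩
  have : Epi (f.unop ≫ π) := by
    have : Epi (π.op ≫ f).unop := inferInstance
    exact this
  have := h3 _ this
  rw [← f.op_unop]
  infer_instance

lemma InjectiveHullOf.op {X P : C} (h : InjectiveHullOf X P) :
    ProjectiveCoverOf (Opposite.op X) (Opposite.op P) := by
  obtain ⟨π, h1, h2, h3⟩ := h
  refine ⟨π.op, inferInstance, inferInstance, fun Y f hf => ?_⟩
  have : Mono (π ≫ f.unop) := by
    have : Mono (f ≫ π.op).unop := inferInstance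
    exact this
  have := h3 _ this
  rw [← f.op_unop]
  infer_instance

lemma ProjectiveCoverOf.unop {X P : Cᵒᵖ} (h : ProjectiveCoverOf X P) :
    InjectiveHullOf X.unop P.unop := by
  obtain ⟨π, h1, h2, h3⟩ := h
  refine ⟨π.unop, inferInstance, inferInstance, fun Y f hf => ?_⟩
  have : Epi (f.op ≫ π) := by
    have : Epi (π.unop ≫ f).op := inferInstance
    exact this
  have := h3 _ this
  rw [← f.unop_op]
  infer_instance

lemma InjectiveHullOf.unop {X P : Cᵒᵖ} (h : InjectiveHullOf X P) :
    ProjectiveCoverOf X.unop P.unop := by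
  obtain ⟨π, h1, h2, h3⟩ := h
  refine ⟨π.unop, inferInstance, inferInstance, fun Y f hf => ?_⟩
  have : Mono (π ≫ f.op) := by
    have : Mono (f ≫ π.unop).op := inferInstance
    exact this
  have := h3 _ this
  rw [← f.unop_op]
  infer_instance

end Covers

/-! ### Serre subcategories attached to a stratification, and the opposite stratification -/

namespace Stratification

variable {C : Type u} [Category.{v} C] [Abelian C] {B : Type w} {Λ : Type w'} [PartialOrder Λ]
  (S : Stratification C B Λ)

/-- The Serre subcategory of objects whose composition factors have labels in `Γ`. -/
def supp (Γ : Set Λ) : ObjectProperty C := fun V => ∀ b, IsCompositionFactor (S.L b) V → S.ρ b ∈ Γ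

lemma le_iff {x : Λ} {V : C} : S.le x V ↔ S.supp (Set.Iic x) V := Iff.rfl

lemma lt_iff {x : Λ} {V : C} : S.lt x V ↔ S.supp (Set.Iio x) V := Iff.rfl

section supp

variable {S} {Γ Γ' : Set Λ} {A X Q : C}

lemma supp_mono (h : Γ ⊆ Γ') (hX : S.supp Γ X) : S.supp Γ' X := fun b hb => h (hX b hb)

lemma supp_of_mono (hX : S.supp Γ X) (f : A ⟶ X) [Mono f] : S.supp Γ A :=
  fun b hb => hX b (hb.of_mono f)

lemma supp_of_epi (hX : S.supp Γ X) (f : X ⟶ Q) [Epi f] : S.supp Γ Q :=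
  fun b hb => hX b (hb.of_epi f)

lemma supp_of_ses {i : A ⟶ X} {p : X ⟶ Q} (h : Ses i p) (hA : S.supp Γ A) (hQ : S.supp Γ Q) :
    S.supp Γ X := fun b hb => (IsCompositionFactor.of_ses h hb).elim (hA b) (hQ b)

lemma supp_of_isZero (hX : IsZero X) : S.supp Γ X := fun _ hb => absurd hX hb.not_isZero

lemma supp_L {b : B} (hb : S.ρ b ∈ Γ) : S.supp Γ (S.L b) := fun c hc => by
  rw [S.eq_of_iso c b (hc.iso_of_simple (S.simple b))]
  exact hb

lemma supp_biprod (hX : S.supp Γ X) (hQ : S.supp Γ Q) : S.supp Γ (X ⊞ Q) :=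
  supp_of_ses (Ses.biprod X Q) hX hQ

lemma supp_of_retract (r : Retract A X) (hX : S.supp Γ X) : S.supp Γ A := by
  have : Mono r.i := ⟨fun a b h => by simpa using congrArg (· ≫ r.r) h⟩
  exact supp_of_mono hX r.i

end supp

/-- An arbitrary short exact sequence replaces the chosen kernel; this form passes to the opposite
category. -/
lemma topProper_iff {b : B} {V : C} : S.TopProper b V ↔
    ∃ (K : C) (k : K ⟶ V) (h : V ⟶ S.L b), Ses k h ∧ S.supp (Set.Iio (S.ρ b)) K := by
  constructor
  · rintro ⟨h, hh, hk⟩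
    exact ⟨_, _, h, Ses.of_epi h, hk⟩
  · rintro ⟨K, k, h, hs, hK⟩
    have := hs.epi
    obtain ⟨g, hg⟩ := hs.lift (kernel.ι h) (kernel.condition h)
    have : Mono g := mono_of_mono_fac hg
    exact ⟨h, hs.epi, supp_of_mono hK g⟩

lemma bottomProper_iff {b : B} {V : C} : S.BottomProper b V ↔
    ∃ (K : C) (h : S.L b ⟶ V) (k : V ⟶ K), Ses h k ∧ S.supp (Set.Iio (S.ρ b)) K := by
  constructor
  · rintro ⟨h, hh, hk⟩
    exact ⟨_, h, _, Ses.of_mono h, hk⟩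
  · rintro ⟨K, h, k, hs, hK⟩
    have := hs.mono
    obtain ⟨g, hg⟩ := hs.desc (cokernel.π h) (cokernel.condition h)
    have : Epi g := epi_of_epi_fac hg
    exact ⟨h, hs.mono, supp_of_epi hK g⟩

/-- The opposite category, with the same labels. -/
@[simps] def op : Stratification Cᵒᵖ B Λ where
  L b := Opposite.op (S.L b)
  simple b := simple_op (S.simple b)
  eq_of_iso b c h := S.eq_of_iso b c (h.map fun e => e.unop.symm)
  exists_iso X hX := (S.exists_iso X.unop (simple_unop hX)).imp fun _ h => h.map fun e => e.op.symm
  ρ := S.ρ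

variable {S}

lemma supp_op {Γ : Set Λ} {X : C} (h : S.supp Γ X) : S.op.supp Γ (Opposite.op X) :=
  fun b hb => h b hb.unop

lemma supp_unop {Γ : Set Λ} {X : Cᵒᵖ} (h : S.op.supp Γ X) : S.supp Γ X.unop :=
  fun b hb => h b hb.op

lemma le_op {x : Λ} {X : C} (h : S.le x X) : S.op.le x (Opposite.op X) :=
  fun b hb => h b hb.unop

lemma le_unop {x : Λ} {X : Cᵒᵖ} (h : S.op.le x X) : S.le x X.unop :=
  fun b hb => h b hb.op

lemma IsCostandard.op {b : B} {V : C} (h : S.IsCostandard b V) :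
    S.op.IsStandard b (Opposite.op V) := by
  obtain ⟨I, i, hI, hi, hV, hu⟩ := h
  refine ⟨_, i.op, hI.op, inferInstance, le_op hV, fun W f hf hW => ?_⟩
  obtain ⟨g, hg⟩ := hu f.unop inferInstance (le_unop hW)
  exact ⟨g.op, congrArg Quiver.Hom.op hg⟩

lemma IsStandard.op {b : B} {V : C} (h : S.IsStandard b V) :
    S.op.IsCostandard b (Opposite.op V) := by
  obtain ⟨I, i, hI, hi, hV, hu⟩ := h
  refine ⟨_, i.op, hI.op, inferInstance, le_op hV, fun W f hf hW => ?_⟩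
  obtain ⟨g, hg⟩ := hu f.unop inferInstance (le_unop hW)
  exact ⟨g.op, congrArg Quiver.Hom.op hg⟩

lemma IsCostandard.unop {b : B} {V : Cᵒᵖ} (h : S.op.IsCostandard b V) :
    S.IsStandard b V.unop := by
  obtain ⟨I, i, hI, hi, hV, hu⟩ := h
  refine ⟨_, i.unop, hI.unop, inferInstance, le_unop hV, fun W f hf hW => ?_⟩
  obtain ⟨g, hg⟩ := hu f.op inferInstance (le_op hW)
  exact ⟨g.unop, congrArg Quiver.Hom.unop hg⟩

lemma IsStandard.unop {b : B} {V : Cᵒᵖ} (h : S.op.IsStandard b V) :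
    S.IsCostandard b V.unop := by
  obtain ⟨I, i, hI, hi, hV, hu⟩ := h
  refine ⟨_, i.unop, hI.unop, inferInstance, le_unop hV, fun W f hf hW => ?_⟩
  obtain ⟨g, hg⟩ := hu f.op inferInstance (le_op hW)
  exact ⟨g.unop, congrArg Quiver.Hom.unop hg⟩

lemma BottomProper.op {b : B} {V : C} (h : S.BottomProper b V) :
    S.op.TopProper b (Opposite.op V) := by
  rw [bottomProper_iff] at h
  obtain ⟨K, h, k, hs, hK⟩ := h
  exact S.op.topProper_iff.2 ⟨_, _, _, hs.op, supp_op hK⟩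

lemma TopProper.op {b : B} {V : C} (h : S.TopProper b V) :
    S.op.BottomProper b (Opposite.op V) := by
  rw [topProper_iff] at h
  obtain ⟨K, h, k, hs, hK⟩ := h
  exact S.op.bottomProper_iff.2 ⟨_, _, _, hs.op, supp_op hK⟩

lemma BottomProper.unop {b : B} {V : Cᵒᵖ} (h : S.op.BottomProper b V) :
    S.TopProper b V.unop := by
  rw [bottomProper_iff] at h
  obtain ⟨K, h, k, hs, hK⟩ := h
  exact S.topProper_iff.2 ⟨_, _, _, hs.unop, supp_unop hK⟩

lemma TopProper.unop {b : B} {V : Cᵒᵖ} (h : S.op.TopProper b V) :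
    S.BottomProper b V.unop := by
  rw [topProper_iff] at h
  obtain ⟨K, h, k, hs, hK⟩ := h
  exact S.bottomProper_iff.2 ⟨_, _, _, hs.unop, supp_unop hK⟩

lemma IsProperCostandard.op {b : B} {V : C} (h : S.IsProperCostandard b V) :
    S.op.IsProperStandard b (Opposite.op V) := by
  obtain ⟨I, i, hI, hi, hV, hu⟩ := h
  refine ⟨_, i.op, hI.op, inferInstance, hV.op, fun W f hf hW => ?_⟩
  obtain ⟨g, hg⟩ := hu f.unop inferInstance hW.unop
  exact ⟨g.op, congrArg Quiver.Hom.op hg⟩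

lemma IsProperStandard.op {b : B} {V : C} (h : S.IsProperStandard b V) :
    S.op.IsProperCostandard b (Opposite.op V) := by
  obtain ⟨I, i, hI, hi, hV, hu⟩ := h
  refine ⟨_, i.op, hI.op, inferInstance, hV.op, fun W f hf hW => ?_⟩
  obtain ⟨g, hg⟩ := hu f.unop inferInstance hW.unop
  exact ⟨g.op, congrArg Quiver.Hom.op hg⟩

lemma IsProperCostandard.unop {b : B} {V : Cᵒᵖ} (h : S.op.IsProperCostandard b V) :
    S.IsProperStandard b V.unop := by
  obtain ⟨I, i, hI, hi, hV, hu⟩ := h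
  refine ⟨_, i.unop, hI.unop, inferInstance, hV.unop, fun W f hf hW => ?_⟩
  obtain ⟨g, hg⟩ := hu f.op inferInstance hW.op
  exact ⟨g.unop, congrArg Quiver.Hom.unop hg⟩

lemma IsProperStandard.unop {b : B} {V : Cᵒᵖ} (h : S.op.IsProperStandard b V) :
    S.IsProperCostandard b V.unop := by
  obtain ⟨I, i, hI, hi, hV, hu⟩ := h
  refine ⟨_, i.unop, hI.unop, inferInstance, hV.unop, fun W f hf hW => ?_⟩
  obtain ⟨g, hg⟩ := hu f.op inferInstance hW.op
  exact ⟨g.unop, congrArg Quiver.Hom.unop hg⟩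

variable {ε : Λ → ℤˣ} {b : B}

/-- The sign changes because proper objects stay proper: `∇̄(b)` belongs to the sign `+` and becomes
`Δ̄(b)`, which belongs to the sign `-`. Labels and their order are untouched. -/
lemma IsEpsCostandard.op {V : C} (h : S.IsEpsCostandard ε b V) :
    S.op.IsEpsStandard (-ε) b (Opposite.op V) :=
  ⟨fun he => (h.2 (neg_eq_iff_eq_neg.1 he)).op, fun he => (h.1 (neg_inj.1 he)).op⟩

lemma IsEpsStandard.op {V : C} (h : S.IsEpsStandard ε b V) :
    S.op.IsEpsCostandard (-ε) b (Opposite.op V) :=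
  ⟨fun he => (h.2 (neg_eq_iff_eq_neg.1 he)).op, fun he => (h.1 (neg_inj.1 he)).op⟩

lemma IsEpsCostandard.unop {V : Cᵒᵖ} (h : S.op.IsEpsCostandard (-ε) b V) :
    S.IsEpsStandard ε b V.unop :=
  ⟨fun he => (h.2 (by simp [he])).unop, fun he => (h.1 (by simp [he])).unop⟩

lemma IsEpsStandard.unop {V : Cᵒᵖ} (h : S.op.IsEpsStandard (-ε) b V) :
    S.IsEpsCostandard ε b V.unop :=
  ⟨fun he => (h.2 (by simp [he])).unop, fun he => (h.1 (by simp [he])).unop⟩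

lemma stdFiltered_op {V : C} (h : S.stdFiltered ε V) :
    S.op.costdFiltered (-ε) (Opposite.op V) :=
  h.elim fun _ hl => ⟨_, hl.op fun _ _ h => h.op⟩

lemma costdFiltered_op {V : C} (h : S.costdFiltered ε V) :
    S.op.stdFiltered (-ε) (Opposite.op V) :=
  h.elim fun _ hl => ⟨_, hl.op fun _ _ h => h.op⟩

lemma stdFiltered_unop {V : Cᵒᵖ} (h : S.op.stdFiltered (-ε) V) : S.costdFiltered ε V.unop :=
  h.elim fun _ hl => ⟨_, hl.unop fun _ _ h => h.unop⟩

lemma costdFiltered_unop {V : Cᵒᵖ} (h : S.op.costdFiltered (-ε) V) : S.stdFiltered ε V.unop :=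
  h.elim fun _ hl => ⟨_, hl.unop fun _ _ h => h.unop⟩

lemma IsTilting.op {V : C} (h : S.IsTilting ε V) : S.op.IsTilting (-ε) (Opposite.op V) :=
  ⟨costdFiltered_op h.2, stdFiltered_op h.1⟩

lemma IsIndecTilting.op {V : C} (h : S.IsIndecTilting ε b V) :
    S.op.IsIndecTilting (-ε) b (Opposite.op V) := by
  obtain ⟨hi, ⟨l, hl⟩, ⟨l', hl'⟩⟩ := h
  refine ⟨indecomposable_op hi, ⟨l'.reverse, ?_⟩, ⟨l.reverse, ?_⟩⟩
  · rw [← List.reverse_cons]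
    exact hl'.op fun _ _ h => h.op
  · have := hl.op (D' := S.op.IsEpsCostandard (-ε)) fun _ _ h => h.op
    rwa [List.reverse_append] at this

lemma IsIndecTilting.unop {V : Cᵒᵖ} (h : S.op.IsIndecTilting (-ε) b V) :
    S.IsIndecTilting ε b V.unop := by
  obtain ⟨hi, ⟨l, hl⟩, ⟨l', hl'⟩⟩ := h
  refine ⟨indecomposable_unop hi, ⟨l'.reverse, ?_⟩, ⟨l.reverse, ?_⟩⟩
  · rw [← List.reverse_cons]
    exact hl'.unop fun _ _ h => h.unop
  · have := hl.unop (D := S.IsEpsCostandard ε) fun _ _ h => h.unop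
    rwa [List.reverse_append] at this

lemma IsTiltingGenerator.op {T : C} (h : S.IsTiltingGenerator ε T) :
    S.op.IsTiltingGenerator (-ε) (Opposite.op T) :=
  ⟨h.1.op, fun b => (h.2 b).elim fun _ hU => ⟨_, hU.1.op,
    hU.2.map fun r => ⟨r.r.op, r.i.op, congrArg Quiver.Hom.op r.retract⟩⟩⟩

end Stratification

/-! ### Basic properties of standard and costandard objects -/

section Colocal

variable {C : Type u} [Category.{v} C] [Abelian C]

/-- `h : S ⟶ V` exhibits the simple object `S` as the socle of `V`. -/
def IsColocal {V S : C} (h : S ⟶ V) : Prop := IsLocal h.op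

lemma IsColocal.isCompositionFactor {V S X : C} {h : S ⟶ V} (hl : IsColocal h) {f : X ⟶ V}
    (h0 : f ≠ 0) : IsCompositionFactor S X :=
  (IsLocal.isCompositionFactor hl (f := f.op) fun h => h0 (Quiver.Hom.op_inj h)).unop

lemma IsColocal.mono {V S : C} {h : S ⟶ V} (hl : IsColocal h) : Mono h := by
  have : Epi h.op := IsLocal.epi hl
  have : Mono h.op.unop := inferInstance
  exact this

lemma IsColocal.ne_zero {V S : C} {h : S ⟶ V} (hl : IsColocal h) : h ≠ 0 :=
  fun h0 => IsLocal.ne_zero hl (by rw [h0]; rfl)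

lemma IsColocal.mono_of_comp {V S X : C} {h : S ⟶ V} (hl : IsColocal h) (f : V ⟶ X)
    (h0 : h ≫ f ≠ 0) : Mono f := by
  have : Epi f.op := IsLocal.essential hl f.op fun h1 => h0 (Quiver.Hom.op_inj h1)
  have : Mono f.op.unop := inferInstance
  exact this

end Colocal

namespace Stratification

variable {C : Type u} [Category.{v} C] [Abelian C] {B : Type w} {Λ : Type w'} [PartialOrder Λ]
  {S : Stratification C B Λ} {ε : Λ → ℤˣ} {b : B}

lemma IsStandard.exists_iso [HasLength C] {V W : C} (h : S.IsStandard b V)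
    (h' : S.IsStandard b W) : Nonempty (V ≅ W) := by
  obtain ⟨P, q, ⟨π, hP⟩, hq, hV, hu⟩ := h
  obtain ⟨P', q', ⟨π', hP'⟩, hq', hW, hu'⟩ := h'
  obtain ⟨φ, -⟩ := hP.exists_iso hP' (Iso.refl _)
  obtain ⟨g, hg⟩ := hu (φ.hom ≫ q') (epi_comp _ _) hW
  obtain ⟨g', hg'⟩ := hu' (φ.inv ≫ q) (epi_comp _ _) hV
  refine ⟨⟨g, g', ?_, ?_⟩⟩
  · rw [← cancel_epi q, ← Category.assoc, hg, Category.assoc, hg']; simp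
  · rw [← cancel_epi q', ← Category.assoc, hg', Category.assoc, hg]; simp

lemma IsProperStandard.exists_iso [HasLength C] {V W : C} (h : S.IsProperStandard b V)
    (h' : S.IsProperStandard b W) : Nonempty (V ≅ W) := by
  obtain ⟨P, q, hP, hq, hV, hu⟩ := h
  obtain ⟨P', q', hP', hq', hW, hu'⟩ := h'
  obtain ⟨φ⟩ := hP.exists_iso hP'
  obtain ⟨g, hg⟩ := hu (φ.hom ≫ q') (epi_comp _ _) hW
  obtain ⟨g', hg'⟩ := hu' (φ.inv ≫ q) (epi_comp _ _) hV
  refine ⟨⟨g, g', ?_, ?_⟩⟩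
  · rw [← cancel_epi q, ← Category.assoc, hg, Category.assoc, hg']; simp
  · rw [← cancel_epi q', ← Category.assoc, hg', Category.assoc, hg]; simp

lemma IsEpsStandard.exists_iso [HasLength C] {V W : C} (h : S.IsEpsStandard ε b V)
    (h' : S.IsEpsStandard ε b W) : Nonempty (V ≅ W) := by
  rcases Int.units_eq_one_or (ε (S.ρ b)) with he | he
  · exact (h.1 he).exists_iso (h'.1 he)
  · exact (h.2 he).exists_iso (h'.2 he)

lemma IsEpsCostandard.exists_iso [HasLength C] {V W : C} (h : S.IsEpsCostandard ε b V)
    (h' : S.IsEpsCostandard ε b W) : Nonempty (V ≅ W) :=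
  (h.op.exists_iso h'.op).map fun e => e.unop.symm

/-- The presentation of a standard object by a projective cover. -/
theorem IsStandard.presentation {V : C} (hV : S.IsStandard b V) :
    ∃ (P K : C) (k : K ⟶ P) (q : P ⟶ V) (h : V ⟶ S.L b), IsProjectiveCover (q ≫ h) ∧ Ses k q ∧
      IsLocal h ∧ S.supp (Set.Iic (S.ρ b)) V ∧
      ∀ ⦃Y : C⦄, S.supp (Set.Iic (S.ρ b)) Y → ∀ f : K ⟶ Y, f = 0 := by
  obtain ⟨P, q, ⟨π, hP⟩, hq, hV, hu⟩ := hV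
  have hl := hP.isLocal (S.simple b)
  obtain ⟨h, hh⟩ := hu π hP.epi (S.le_iff.2 (supp_L (Set.mem_Iic.2 le_rfl)))
  have hq0 : q ≠ 0 := by
    rintro rfl
    exact hl.ne_zero (by rw [← hh, zero_comp])
  obtain ⟨h', hh', hl'⟩ := hl.factor hq hq0
  have : h' = h := by rw [← cancel_epi q, hh, hh']
  subst this
  refine ⟨P, _, _, q, h', by rwa [hh], Ses.of_epi q, hl', hV, fun Y hY f => ?_⟩
  -- The pushout lies in `R_{≤ ρ b}`, so the image of `P` in it factors through `V`. Hence `k` dies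
  -- in the pushout, and `f` vanishes because `a` is mono.
  obtain ⟨E, a, c, g, h1, h2, h3, -, -⟩ := (Ses.of_epi q).pushout f
  have hE : S.supp (Set.Iic (S.ρ b)) E := supp_of_ses h1 hY hV
  obtain ⟨I, p, i, hp, hi, hpi⟩ := Ses.image_factor g
  obtain ⟨t, ht⟩ := hu p hp (S.le_iff.2 (supp_of_mono hE i))
  have := h1.mono
  rw [← cancel_mono a, ← h3, ← hpi, ← ht]
  simp

/-- In the pushout of the cover along a map `K ⟶ Y` with `Y` in `R_{< ρ b}`, the image of `P` still
has `L b` on top and all other factors strictly below. It therefore factors through `Δ(b)` and then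
through `V`, which kills the given map. -/
theorem IsProperStandard.presentation {V : C} (hV : S.IsProperStandard b V) :
    ∃ (P K : C) (k : K ⟶ P) (q : P ⟶ V) (h : V ⟶ S.L b), IsProjectiveCover (q ≫ h) ∧ Ses k q ∧
      IsLocal h ∧ S.supp (Set.Iic (S.ρ b)) V ∧ (∃ (N : C) (n : N ⟶ V), Ses n h ∧
        S.supp (Set.Iio (S.ρ b)) N) ∧
      ∀ ⦃Y : C⦄, S.supp (Set.Iio (S.ρ b)) Y → ∀ f : K ⟶ Y, f = 0 := by
  obtain ⟨D, q', ⟨P, q, ⟨π, hP⟩, hq, hD, hu⟩, hq', hV, hu'⟩ := hV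
  obtain ⟨N, n, h, hs, hN⟩ := S.topProper_iff.1 hV
  have := hs.epi
  have hl := hP.isLocal (S.simple b)
  have hne : (q ≫ q') ≫ h ≠ 0 := by
    intro h0
    have h1 : h = 0 := by
      have := epi_comp q q'
      rw [← cancel_epi (q ≫ q'), h0, comp_zero]
    rw [h1] at hs
    have := hs.epi
    have := S.simple b
    exact Simple.not_isZero (S.L b) (by
      rw [IsZero.iff_id_eq_zero, ← cancel_epi (0 : V ⟶ S.L b)]
      simp)
  obtain ⟨e, he⟩ := hl.to_simple (S.simple b) hne
  have hl2 : IsLocal ((q ≫ q') ≫ h) := he ▸ hl.comp_iso e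
  have hqq : Epi (q ≫ q') := epi_comp _ _
  have hqq0 : q ≫ q' ≠ 0 := fun h0 => hne (by rw [h0, zero_comp])
  obtain ⟨h', hh', hl'⟩ := hl2.factor hqq hqq0
  have : h' = h := by rw [← cancel_epi (q ≫ q'), hh']
  subst this
  refine ⟨P, _, _, q ≫ q', h', hl2.isProjectiveCover hP.projective, Ses.of_epi _, hl',
    supp_of_epi (S.le_iff.1 hD) q', ⟨N, n, hs, hN⟩, fun Y hY f => ?_⟩
  obtain ⟨E, a, c, g, h1, h2, h3, -, -⟩ := (Ses.of_epi (q ≫ q')).pushout f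
  have hE : S.supp (Set.Iic (S.ρ b)) E := supp_of_ses h1
    (supp_mono Set.Iio_subset_Iic_self hY) (supp_of_epi (S.le_iff.1 hD) q')
  obtain ⟨I, p, i, hp, hi, hpi⟩ := Ses.image_factor g
  obtain ⟨t, ht⟩ := hu p hp (S.le_iff.2 (supp_of_mono hE i))
  have ht' : Epi t := epi_of_epi_fac ht
  have hepi : Epi (i ≫ c ≫ h') := by
    have h4 : p ≫ i ≫ c ≫ h' = (q ≫ q') ≫ h' := by
      rw [← Category.assoc, hpi, ← Category.assoc, h2]
    have := hl2.epi
    exact epi_of_epi_fac h4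
  have hI : S.TopProper b I := by
    refine ⟨i ≫ c ≫ h', hepi, ?_⟩
    obtain ⟨E', a', b', g', h5, h6, -, -⟩ := h1.comp_epi hs
    obtain ⟨l, hl⟩ := h6.lift (kernel.ι (i ≫ c ≫ h') ≫ i) (by simp)
    have : Mono (l ≫ g') := by rw [hl]; exact mono_comp _ _
    have : Mono l := mono_of_mono l g'
    exact S.lt_iff.2 (supp_of_mono (supp_of_ses h5 hY hN) l)
  obtain ⟨t', ht'⟩ := hu' t ht' hI
  have := h1.mono
  rw [← cancel_mono a, ← h3, ← hpi, ← ht, ← ht']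
  have := kernel.condition (q ≫ q')
  simp only [Category.assoc] at this ⊢
  rw [reassoc_of% this]
  simp

namespace IsEpsStandard

variable {V : C}

theorem head (hV : S.IsEpsStandard ε b V) : ∃ h : V ⟶ S.L b, IsLocal h ∧
    (ε (S.ρ b) = -1 → ∃ (N : C) (n : N ⟶ V), Ses n h ∧ S.supp (Set.Iio (S.ρ b)) N) := by
  rcases Int.units_eq_one_or (ε (S.ρ b)) with he | he
  · obtain ⟨P, K, k, q, h, h1, h2, h3, h4, h5⟩ := (hV.1 he).presentation
    exact ⟨h, h3, fun h => absurd (he.symm.trans h) (by decide)⟩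
  · obtain ⟨P, K, k, q, h, h1, h2, h3, h4, h5, h6⟩ := (hV.2 he).presentation
    exact ⟨h, h3, fun _ => h5⟩

theorem exists_cover (hV : S.IsEpsStandard ε b V) : ∃ (P : C) (q : P ⟶ V) (h : V ⟶ S.L b),
    IsProjectiveCover (q ≫ h) ∧ Epi q ∧ IsLocal h := by
  rcases Int.units_eq_one_or (ε (S.ρ b)) with he | he
  · obtain ⟨P, K, k, q, h, h1, h2, h3, h4, h5⟩ := (hV.1 he).presentation
    exact ⟨P, q, h, h1, h2.epi, h3⟩
  · obtain ⟨P, K, k, q, h, h1, h2, h3, h4, h5, h6⟩ := (hV.2 he).presentation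
    exact ⟨P, q, h, h1, h2.epi, h3⟩

theorem supp (hV : S.IsEpsStandard ε b V) : S.supp (Set.Iic (S.ρ b)) V := by
  rcases Int.units_eq_one_or (ε (S.ρ b)) with he | he
  · obtain ⟨P, K, k, q, h, h1, h2, h3, h4, h5⟩ := (hV.1 he).presentation
    exact h4
  · obtain ⟨P, K, k, q, h, h1, h2, h3, h4, h5, h6⟩ := (hV.2 he).presentation
    exact h4

theorem exists_kernel_hom_eq_zero (hV : S.IsEpsStandard ε b V) :
    ∃ (P K : C) (k : K ⟶ P) (q : P ⟶ V), Projective P ∧ Ses k q ∧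
      ∀ ⦃Y : C⦄, (ε (S.ρ b) = 1 → S.supp (Set.Iic (S.ρ b)) Y) →
        (ε (S.ρ b) = -1 → S.supp (Set.Iio (S.ρ b)) Y) → ∀ f : K ⟶ Y, f = 0 := by
  rcases Int.units_eq_one_or (ε (S.ρ b)) with he | he
  · obtain ⟨P, K, k, q, h, h1, h2, h3, h4, h5⟩ := (hV.1 he).presentation
    exact ⟨P, K, k, q, h1.projective, h2, fun Y hY _ => h5 (hY he)⟩
  · obtain ⟨P, K, k, q, h, h1, h2, h3, h4, h5, h6⟩ := (hV.2 he).presentation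
    exact ⟨P, K, k, q, h1.projective, h2, fun Y _ hY => h6 (hY he)⟩

/-- `Ext¹(V, Y)` is a quotient of `Hom(K, Y)` for the kernel `K` of a projective presentation, and
this group is zero. -/
theorem extZero [HasExt.{u'} C] (hV : S.IsEpsStandard ε b V) {Y : C}
    (h1 : ε (S.ρ b) = 1 → S.supp (Set.Iic (S.ρ b)) Y)
    (h2 : ε (S.ρ b) = -1 → S.supp (Set.Iio (S.ρ b)) Y) : ExtZero.{u'} 1 V Y := by
  obtain ⟨P, K, k, q, hP, hs, h⟩ := hV.exists_kernel_hom_eq_zero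
  exact ExtZero.one_of_extend hs (ExtZero.of_projective _ _ _) fun f =>
    ⟨0, by rw [comp_zero, h h1 h2 f]⟩

lemma not_isZero (hV : S.IsEpsStandard ε b V) : ¬ IsZero V := by
  obtain ⟨h, hl, -⟩ := hV.head
  exact hl.not_isZero

/-- A nonzero morphism from a standard object detects a composition factor. -/
lemma isCompositionFactor (hV : S.IsEpsStandard ε b V) {X : C} {f : V ⟶ X} (hf : f ≠ 0) :
    IsCompositionFactor (S.L b) X := by
  obtain ⟨h, hl, -⟩ := hV.head
  exact hl.isCompositionFactor hf

end IsEpsStandard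

namespace IsEpsCostandard

variable {V : C}

theorem socle (hV : S.IsEpsCostandard ε b V) : ∃ h : S.L b ⟶ V, IsColocal h ∧
    (ε (S.ρ b) = 1 → ∃ (N : C) (n : V ⟶ N), Ses h n ∧ S.supp (Set.Iio (S.ρ b)) N) := by
  obtain ⟨h, hl, hs⟩ := hV.op.head
  refine ⟨h.unop, hl, fun he => ?_⟩
  obtain ⟨N, n, h1, h2⟩ := hs (by simp [he])
  exact ⟨N.unop, n.unop, h1.unop, supp_unop h2⟩

theorem supp (hV : S.IsEpsCostandard ε b V) : S.supp (Set.Iic (S.ρ b)) V :=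
  supp_unop hV.op.supp

theorem exists_hull (hV : S.IsEpsCostandard ε b V) : ∃ I : C, InjectiveHullOf (S.L b) I := by
  obtain ⟨P, q, h, h1, -⟩ := hV.op.exists_cover
  exact ⟨P.unop, ProjectiveCoverOf.unop (X := Opposite.op (S.L b)) ⟨_, h1⟩⟩

theorem extZero [HasExt.{u'} C] (hV : S.IsEpsCostandard ε b V) {Y : C}
    (h1 : ε (S.ρ b) = -1 → S.supp (Set.Iic (S.ρ b)) Y)
    (h2 : ε (S.ρ b) = 1 → S.supp (Set.Iio (S.ρ b)) Y) : ExtZero.{u'} 1 Y V := by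
  obtain ⟨P, K, k, q, hP, hs, h⟩ := hV.op.exists_kernel_hom_eq_zero
  have : Injective P.unop := inferInstance
  refine ExtZero.one_of_lift hs.unop (ExtZero.of_injective _ _ _) fun f =>
    ⟨0, ?_⟩
  have := h (Y := Opposite.op Y) (fun he => supp_op (h1 (by simpa using neg_eq_iff_eq_neg.1 he)))
    (fun he => supp_op (h2 (by simpa using he))) f.op
  rw [zero_comp]
  exact congrArg Quiver.Hom.unop this.symm

lemma not_isZero (hV : S.IsEpsCostandard ε b V) : ¬ IsZero V := fun h => hV.op.not_isZero h.op

lemma isCompositionFactor (hV : S.IsEpsCostandard ε b V) {X : C} {f : X ⟶ V} (hf : f ≠ 0) :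
    IsCompositionFactor (S.L b) X := by
  obtain ⟨h, hl, -⟩ := hV.socle
  exact hl.isCompositionFactor hf

end IsEpsCostandard

/-! ### Morphisms from standard to costandard objects -/

/-- There are no nonzero morphisms between standard and costandard objects with different
labels; with the same label they factor through the head and the socle. -/
theorem hom_std_costd {c : B} {V W : C} (hV : S.IsEpsStandard ε b V)
    (hW : S.IsEpsCostandard ε c W) {f : V ⟶ W} (hf : f ≠ 0) :
    b = c ∧ ∀ (h : V ⟶ S.L b) (_ : IsLocal h), ∃ g : S.L b ⟶ W, f = h ≫ g := by
  have h1 := hV.isCompositionFactor hf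
  have h2 := hW.isCompositionFactor hf
  have h3 : S.ρ b ≤ S.ρ c := hW.supp b h1
  have h4 : S.ρ c ≤ S.ρ b := hV.supp c h2
  have h5 := le_antisymm h3 h4
  obtain ⟨h₀, hl₀, hp⟩ := hV.head
  obtain ⟨s, hs, hq⟩ := hW.socle
  have key : ∃ g : S.L b ⟶ W, f = h₀ ≫ g := by
    -- For the sign `+`, the factors of `W` above its socle have labels strictly below `ρ b = ρ c`,
    -- so `f` lands in the socle. For the sign `-`, dually, `f` kills the radical of `V`.
    rcases Int.units_eq_one_or (ε (S.ρ b)) with he | he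
    · obtain ⟨N, n, hsn, hN⟩ := hq (h5 ▸ he)
      have hz : f ≫ n = 0 := by
        by_contra hne
        exact lt_irrefl _ (h5 ▸ hN b (hV.isCompositionFactor hne) : S.ρ b < S.ρ b)
      obtain ⟨g, hg⟩ := hsn.lift f hz
      have hg0 : g ≠ 0 := by
        rintro rfl
        exact hf (by rw [← hg, zero_comp])
      obtain ⟨e, he⟩ := hl₀.to_simple (S.simple c) hg0
      exact ⟨e.hom ≫ s, by rw [← hg, ← he, Category.assoc]⟩
    · obtain ⟨N, n, hsn, hN⟩ := hp he
      have hz : n ≫ f = 0 := by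
        by_contra hne
        exact lt_irrefl _ (h5 ▸ hN c (hW.isCompositionFactor hne) : S.ρ b < S.ρ b)
      obtain ⟨g, hg⟩ := hsn.desc f hz
      exact ⟨g, hg.symm⟩
  obtain ⟨g, hg⟩ := key
  refine ⟨?_, fun h hl => ?_⟩
  · have hg0 : g ≠ 0 := by
      rintro rfl
      exact hf (by rw [hg, comp_zero])
    exact (S.eq_of_iso c b ((hW.isCompositionFactor hg0).iso_of_simple (S.simple b))).symm
  · obtain ⟨e, he⟩ := hl.to_simple (S.simple b) hl₀.ne_zero
    exact ⟨e.hom ≫ g, by rw [hg, ← he, Category.assoc]⟩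

/-- The canonical nonzero morphism from a standard object to the costandard object with the
same label. -/
lemma exists_hom_std_costd {V W : C} (hV : S.IsEpsStandard ε b V)
    (hW : S.IsEpsCostandard ε b W) : ∃ f : V ⟶ W, f ≠ 0 := by
  obtain ⟨h, hl, -⟩ := hV.head
  obtain ⟨s, hs, -⟩ := hW.socle
  have := hl.epi
  refine ⟨h ≫ s, fun h0 => hs.ne_zero ?_⟩
  rw [← cancel_epi h, h0, comp_zero]

end Stratification

/-! ### The homological theory of stratified categories -/

namespace Stratification

variable {C : Type u} [Category.{v} C] [Abelian C] {B : Type w} {Λ : Type w'} [PartialOrder Λ]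

/-- The standing assumptions on a stratified category. They are self-dual, see `Setup.op`. -/
structure Setup (S : Stratification C B Λ) (ε : Λ → ℤˣ) : Prop where
  finite : Finite B
  -- In the application these endomorphisms are scalars. Automorphisms of the identity functor
  -- express this without a linear structure and in a self-dual way.
  schur : ∀ (b : B) (f : S.L b ⟶ S.L b), f ≠ 0 → ∃ s : 𝟭 C ≅ 𝟭 C, s.hom.app (S.L b) = f
  std : ∀ b, ∃ V, S.IsEpsStandard ε b V
  costd : ∀ b, ∃ V, S.IsEpsCostandard ε b V
  flags : S.HasProjectiveFlags ε

lemma not_isZero_L (S : Stratification C B Λ) (b : B) : ¬ IsZero (S.L b) := by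
  have := S.simple b
  exact Simple.not_isZero (S.L b)

variable {S : Stratification C B Λ} {ε : Λ → ℤˣ}

lemma hom_eq_zero_of_flag {D : B → C → Prop} {l : List B} {V Y : C} (hV : Flag D l V)
    (h : ∀ c ∈ l, ∀ X, D c X → ∀ f : X ⟶ Y, f = 0) (f : V ⟶ Y) : f = 0 := by
  induction l generalizing V with
  | nil => exact hV.isZero.eq_of_src _ _
  | cons b l ih =>
    obtain ⟨U, X, i, p, hs, hU, hX⟩ := hV.exists_ses
    obtain ⟨g, hg⟩ := hs.desc f (ih hU (fun c hc => h c (List.mem_cons_of_mem _ hc)) _)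
    rw [← hg, h b List.mem_cons_self X hX g, comp_zero]

lemma extZero_of_flags [HasExt.{u'} C] {n : ℕ}
    (H : ∀ b c V W, S.IsEpsStandard ε b V → S.IsEpsCostandard ε c W → ExtZero.{u'} n V W)
    {l l' : List B} {V W : C} (hV : Flag (S.IsEpsStandard ε) l V)
    (hW : Flag (S.IsEpsCostandard ε) l' W) : ExtZero.{u'} n V W := by
  induction l generalizing V with
  | nil => exact ExtZero.of_isZero_left hV.isZero _ _
  | cons b l ih =>
    obtain ⟨U, X, i, p, hs, hU, hX⟩ := hV.exists_ses
    refine ExtZero.contravariant_mid hs (ih hU) ?_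
    clear ih
    induction l' generalizing W with
    | nil => exact ExtZero.of_isZero_right _ hW.isZero _
    | cons c l' ih =>
      obtain ⟨U', X', i', p', hs', hU', hX'⟩ := hW.exists_ses
      exact ExtZero.covariant_mid hs' (ih hU') (H _ _ _ _ hX hX')

/-- Dévissage for the vanishing of extension groups. -/
lemma extZero_of_compositionFactors [HasLength C] [HasExt.{u'} C] {n : ℕ} {X W : C}
    (H : ∀ b, IsCompositionFactor (S.L b) X → ExtZero.{u'} n (S.L b) W) : ExtZero.{u'} n X W := by
  induction X using len_induction with
  | h X ih =>
    by_cases hX : IsZero X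
    · exact ExtZero.of_isZero_left hX _ _
    obtain ⟨L, i, hL, hi⟩ := exists_simple_sub X hX
    obtain ⟨b, ⟨e⟩⟩ := S.exists_iso L hL
    have hs := (Ses.of_mono i).iso_comp e.symm
    have := hs.mono
    refine ExtZero.contravariant_mid hs (H b ?_) (ih _ ?_ fun c hc => H c (hc.of_epi (cokernel.π i)))
    · exact IsCompositionFactor.of_simple_mono (S.simple b) (e.symm.hom ≫ i)
    · have h1 := HasLength.len_add hs
      have h2 := len_pos (S.not_isZero_L b)
      omega

/-- A nonzero morphism restricts to a nonzero morphism on a simple subquotient. -/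
lemma exists_hom_L_ne_zero [HasLength C] {X W : C} {f : X ⟶ W} (hf : f ≠ 0) :
    ∃ (b : B) (g : S.L b ⟶ W), Mono g ∧ IsCompositionFactor (S.L b) X := by
  obtain ⟨I, p, i, hp, hi, hpi⟩ := Ses.image_factor f
  have hI : ¬ IsZero I := fun h => hf (by rw [← hpi, h.eq_of_src i 0, comp_zero])
  obtain ⟨L, j, hL, hj⟩ := exists_simple_sub I hI
  obtain ⟨b, ⟨e⟩⟩ := S.exists_iso L hL
  exact ⟨b, e.inv ≫ j ≫ i, inferInstance,
    (IsCompositionFactor.of_simple_mono (S.simple b) (e.inv ≫ j)).of_epi p⟩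

lemma costdFiltered_of_ses {U V W : C} {i : U ⟶ V} {p : V ⟶ W} (h : Ses i p)
    (hU : S.costdFiltered ε U) (hW : S.costdFiltered ε W) : S.costdFiltered ε V :=
  hU.elim fun _ h1 => hW.elim fun _ h2 => ⟨_, Flag.append h h2 h1⟩

lemma stdFiltered_of_ses {U V W : C} {i : U ⟶ V} {p : V ⟶ W} (h : Ses i p)
    (hU : S.stdFiltered ε U) (hW : S.stdFiltered ε W) : S.stdFiltered ε V :=
  hU.elim fun _ h1 => hW.elim fun _ h2 => ⟨_, Flag.append h h2 h1⟩

/-! ### Vanishing of `Ext` between standard and costandard objects, and its consequences for flags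
-/

namespace Setup

variable (hS : S.Setup ε)

include hS

/-- Nonzero morphisms from a standard to a costandard object are unique up to an automorphism of
the identity functor. -/
lemma hom_unique {b : B} {V W : C} (hV : S.IsEpsStandard ε b V) (hW : S.IsEpsCostandard ε b W)
    {f f' : V ⟶ W} (hf : f ≠ 0) (hf' : f' ≠ 0) : ∃ s : 𝟭 C ≅ 𝟭 C, f' = s.hom.app V ≫ f := by
  obtain ⟨h, hl, -⟩ := hV.head
  obtain ⟨s, hs, -⟩ := hW.socle
  -- Every nonzero map is the head of `V`, an automorphism of `L b` and the socle of `W`. Two such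
  -- maps differ by an automorphism of `L b`, which `schur` makes natural.
  have key : ∀ f : V ⟶ W, f ≠ 0 → ∃ e : S.L b ≅ S.L b, f = h ≫ e.hom ≫ s := by
    intro f hf
    obtain ⟨g, hg⟩ := (hom_std_costd hV hW hf).2 h hl
    have hg0 : g ≠ 0 := by
      rintro rfl
      exact hf (by rw [hg, comp_zero])
    obtain ⟨e, he⟩ := IsLocal.to_simple hs (simple_op (S.simple b))
      (f := g.op) fun h => hg0 (Quiver.Hom.op_inj h)
    have he' : e.hom.unop ≫ s = g := congrArg Quiver.Hom.unop he
    exact ⟨e.unop, by rw [hg, ← he']; rfl⟩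
  obtain ⟨e, he⟩ := key f hf
  obtain ⟨e', he'⟩ := key f' hf'
  have := S.simple b
  obtain ⟨t, ht⟩ := hS.schur b (e' ≪≫ e.symm).hom fun h0 => by
    have h1 : 𝟙 (S.L b) = 0 := by
      rw [← (e' ≪≫ e.symm).hom_inv_id, h0, zero_comp]
    exact id_nonzero _ h1
  refine ⟨t, ?_⟩
  have h2 := t.hom.naturality h
  simp only [Functor.id_obj, Functor.id_map] at h2
  rw [he, ← reassoc_of% h2, ht, he']
  simp

variable [HasLength C]

lemma exists_flag_cover {b : B} {V : C} (hV : S.IsEpsStandard ε b V) :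
    ∃ (P K : C) (k : K ⟶ P) (q : P ⟶ V) (l : List B), Projective P ∧ Ses k q ∧
      Flag (S.IsEpsStandard ε) l K ∧ ∀ c ∈ l, S.ρ b ≤ S.ρ c := by
  obtain ⟨P, l, hP, hl, hc⟩ := hS.flags b
  obtain ⟨U, X, i, p, hs, hU, hX⟩ := hl.exists_ses
  obtain ⟨e⟩ := hX.exists_iso hV
  exact ⟨P, U, i, _, l, hP, hs.comp_iso e, hU, hc⟩

/-- If `ρ b < ρ c`, the injective presentation of `W` does it; if the labels agree, the sign tells
whether to use the projective presentation of `V` or the injective one of `W`. In the remaining case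
a projective with a flag covers `V`: a nonzero map from its kernel to `W` would come from a section
`Δ_ε(d)` and give `ρ b ≤ ρ d ≤ ρ c`. -/
lemma extZero_one [HasExt.{u'} C] {b c : B} {V W : C} (hV : S.IsEpsStandard ε b V)
    (hW : S.IsEpsCostandard ε c W) : ExtZero.{u'} 1 V W := by
  by_cases hbc : S.ρ b ≤ S.ρ c
  · rcases hbc.eq_or_lt with h | h
    · rcases Int.units_eq_one_or (ε (S.ρ b)) with he | he
      · exact hV.extZero (fun _ => h ▸ hW.supp) fun h' => absurd (he.symm.trans h') (by decide)
      · exact hW.extZero (fun _ => h ▸ hV.supp) fun h' => absurd (he.symm.trans (h ▸ h'))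
          (by decide)
    · exact hW.extZero (fun _ => supp_mono (Set.Iic_subset_Iic.2 hbc) hV.supp)
        fun _ => supp_mono (Set.Iic_subset_Iio.2 h) hV.supp
  · obtain ⟨P, K, k, q, l, hP, hs, hK, hl⟩ := hS.exists_flag_cover hV
    refine ExtZero.one_of_extend hs (ExtZero.of_projective _ _ _) fun f => ⟨0, ?_⟩
    rw [comp_zero, hom_eq_zero_of_flag hK (fun d hd X hX f => ?_) f]
    by_contra hf
    exact hbc ((hl d hd).trans (hW.supp d (hX.isCompositionFactor hf)))

/-- Higher extensions between standard and costandard objects vanish. -/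
theorem extZero_succ [HasExt.{u'} C] (n : ℕ) {l l' : List B} {V W : C}
    (hV : Flag (S.IsEpsStandard ε) l V) (hW : Flag (S.IsEpsCostandard ε) l' W) :
    ExtZero.{u'} (n + 1) V W := by
  induction n generalizing l l' V W with
  | zero => exact extZero_of_flags (fun _ _ _ _ => hS.extZero_one) hV hW
  | succ n ih =>
    refine extZero_of_flags (fun b c V W hV hW => ?_) hV hW
    -- Dimension shift: the kernel of the flagged projective cover again has a standard flag.
    obtain ⟨P, K, k, q, l, hP, hs, hK, hl⟩ := hS.exists_flag_cover hV
    exact ExtZero.contravariant_right hs (ih hK (Flag.single hW)) (ExtZero.of_projective _ _ _)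

theorem extZero [HasExt.{u'} C] (n : ℕ) {V W : C} (hV : S.stdFiltered ε V)
    (hW : S.costdFiltered ε W) : ExtZero.{u'} (n + 1) V W :=
  hS.extZero_succ n hV.choose_spec hW.choose_spec

/-- Descending from `Δ_ε(c)` to its head, the obstruction is a map from the radical to `W`. Its
image would contain a simple object with label below `x`, which `hmin` forbids; when `ρ c = x`, the
sign `-` ensures that the radical lies strictly below `x`. -/
lemma extZero_simple [HasExt.{u'} C] {W : C} {x : Λ} {c : B}
    (h : ∀ (b : B) (V : C), S.IsEpsStandard ε b V → ExtZero.{u'} 1 V W)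
    (hmin : ∀ d, S.ρ d < x → ∀ f : S.L d ⟶ W, f = 0) (hc : S.ρ c ≤ x)
    (hc' : S.ρ c = x → ε x = -1) : ExtZero.{u'} 1 (S.L c) W := by
  obtain ⟨V, hV⟩ := hS.std c
  obtain ⟨π, hl, hN⟩ := hV.head
  have : ∃ (K : C) (k : K ⟶ V), Ses k π ∧ ∀ d, IsCompositionFactor (S.L d) K → S.ρ d < x := by
    rcases hc.eq_or_lt with he | hlt
    · obtain ⟨N, n, hs, hN⟩ := hN (he ▸ hc' he)
      exact ⟨N, n, hs, fun d hd => he ▸ hN d hd⟩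
    · have := hl.epi
      exact ⟨_, _, Ses.of_epi π, fun d hd =>
        (hV.supp d (hd.of_mono (kernel.ι π))).trans_lt hlt⟩
  obtain ⟨K, k, hs, hK⟩ := this
  refine ExtZero.one_of_extend hs (h c V hV) fun f => ⟨0, ?_⟩
  rw [comp_zero]
  by_contra hf
  obtain ⟨d, g, hg, hd⟩ := exists_hom_L_ne_zero (S := S) (Ne.symm hf)
  have := hmin d (hK d hd) g
  subst this
  have := S.simple d
  exact Simple.not_isZero (S.L d) (by
    rw [IsZero.iff_id_eq_zero, ← cancel_mono (0 : S.L d ⟶ W)]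
    simp)

/-- Splitting off a costandard subobject. -/
lemma exists_costd_sub [HasExt.{u'} C] {W N : C} {b : B}
    (h : ∀ (c : B) (V : C), S.IsEpsStandard ε c V → ExtZero.{u'} 1 V W)
    (s : S.L b ⟶ W) (hs : Mono s) (hmin : ∀ d, S.ρ d < S.ρ b → ∀ f : S.L d ⟶ W, f = 0)
    (hN : S.IsEpsCostandard ε b N) : ∃ (i : N ⟶ W), Mono i ∧
      ∀ (c : B) (V : C), S.IsEpsStandard ε c V → ExtZero.{u'} 1 V (cokernel i) := by
  obtain ⟨j, hj, hj'⟩ := hN.socle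
  have hjm := hj.mono
  have : ∃ (Q : C) (q : N ⟶ Q), Ses j q ∧ ∀ c, IsCompositionFactor (S.L c) Q →
      S.ρ c ≤ S.ρ b ∧ (S.ρ c = S.ρ b → ε (S.ρ b) = -1) := by
    rcases Int.units_eq_one_or (ε (S.ρ b)) with he | he
    · obtain ⟨Q, q, hq, hQ⟩ := hj' he
      exact ⟨Q, q, hq, fun c hc => ⟨(hQ c hc).le, fun h => absurd h (ne_of_lt (hQ c hc))⟩⟩
    · exact ⟨_, _, Ses.of_mono j, fun c hc => ⟨hN.supp c (hc.of_epi (cokernel.π j)), fun _ => he⟩⟩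
  obtain ⟨Q, q, hq, hQ⟩ := this
  -- The inclusion of `L b` extends over `N` since the factors of `N / L b` have no `Ext¹` with `W`.
  -- The extension is mono because it is so on the socle of `N`.
  obtain ⟨i, hi⟩ := ExtZero.extend hq (extZero_of_compositionFactors (S := S) fun c hc =>
    hS.extZero_simple h hmin (hQ c hc).1 (hQ c hc).2) s
  have hi' : Mono i := hj.mono_of_comp i fun h0 => by
    rw [hi] at h0
    subst h0
    have := S.simple b
    exact Simple.not_isZero (S.L b) (by
      rw [IsZero.iff_id_eq_zero, ← cancel_mono (0 : S.L b ⟶ W)]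
      simp)
  -- The hypothesis passes to the quotient because `Ext²(Δ_ε, ∇_ε)` vanishes.
  exact ⟨i, hi', fun c V hV => ExtZero.covariant_right (Ses.of_mono i) (h c V hV)
    (hS.extZero_succ 1 (Flag.single hV) (Flag.single hN))⟩

/-- The homological criterion for the existence of a costandard flag. -/
theorem costdFiltered_of_extZero [HasExt.{u'} C] {W : C}
    (h : ∀ (c : B) (V : C), S.IsEpsStandard ε c V → ExtZero.{u'} 1 V W) :
    S.costdFiltered ε W := by
  induction W using len_induction with
  | h W ih =>
    by_cases hW : IsZero W
    · exact ⟨[], Flag.zero hW⟩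
    have := hS.finite
    obtain ⟨L, i, hL, hi⟩ := exists_simple_sub W hW
    obtain ⟨b₀, ⟨e⟩⟩ := S.exists_iso L hL
    let s : Set B := {b | ∃ f : S.L b ⟶ W, f ≠ 0}
    have hs : s.Nonempty := ⟨b₀, e.inv ≫ i, fun h0 => Simple.not_isZero L (by
      have h1 : i = 0 := by simpa using h0
      subst h1
      rw [IsZero.iff_id_eq_zero, ← cancel_mono (0 : L ⟶ W)]
      simp)⟩
    -- A simple subobject of minimal label can be enlarged to a costandard one; the quotient is
    -- shorter and satisfies the same hypothesis.
    obtain ⟨b, ⟨f, hf⟩, hmin⟩ := s.toFinite.exists_minimalFor S.ρ s hs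
    obtain ⟨N, hN⟩ := hS.costd b
    obtain ⟨j, hj, hj'⟩ := hS.exists_costd_sub h f (mono_of_simple (S.simple b) hf)
      (fun d hd g => by
        by_contra hg
        exact hd.not_ge (hmin ⟨g, hg⟩ hd.le)) hN
    obtain ⟨l, hl⟩ := ih (cokernel j) (by
      have h1 := HasLength.len_add (Ses.of_mono j)
      have h2 := len_pos hN.not_isZero
      omega) hj'
    exact ⟨l ++ [b], Flag.of_bottom (Ses.of_mono j) hN hl⟩

/-- Vanishing of `Ext¹` lifts the canonical map from `Δ_ε(c)` to a section `∇_ε(c)`. This is how the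
labels occurring in a flag are controlled. -/
lemma exists_hom_of_mem_costd_flag {l : List B} {V W : C} {c : B}
    (hW : Flag (S.IsEpsCostandard ε) l W) (hc : c ∈ l) (hV : S.IsEpsStandard ε c V) :
    ∃ f : V ⟶ W, f ≠ 0 := by
  have := HasExt.standard C
  induction l generalizing W with
  | nil => simp at hc
  | cons b l ih =>
    obtain ⟨U, X, i, p, hs, hU, hX⟩ := hW.exists_ses
    have := hs.mono
    by_cases hcl : c ∈ l
    · obtain ⟨f, hf⟩ := ih hU hcl
      exact ⟨f ≫ i, fun h0 => hf (zero_of_comp_mono i h0)⟩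
    · have : c = b := by simpa [hcl] using hc
      subst this
      obtain ⟨f, hf⟩ := exists_hom_std_costd hV hX
      obtain ⟨g, hg⟩ := ExtZero.lift hs (hS.extZero_succ 0 (Flag.single hV) hU) f
      exact ⟨g, fun h0 => hf (by rw [← hg, h0, zero_comp])⟩

/-- Injective hulls of simple objects have costandard flags. -/
theorem injectiveHull_flag {b : B} {I : C} (hI : InjectiveHullOf (S.L b) I) :
    ∃ l : List B, Flag (S.IsEpsCostandard ε) (l ++ [b]) I ∧ ∀ c ∈ l, S.ρ b ≤ S.ρ c := by
  have := HasExt.standard C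
  obtain ⟨N, hN⟩ := hS.costd b
  have hcol : ∃ s : S.L b ⟶ I, IsColocal s := by
    obtain ⟨π, hπ⟩ := hI.op
    have := hπ.isLocal (simple_op (S.simple b))
    exact ⟨π.unop, this⟩
  obtain ⟨ι, hι⟩ := hI
  have := hι.injective
  obtain ⟨s, hs⟩ := hcol
  -- The socle of `I` is `L b`, so minimality of the label is automatic.
  obtain ⟨i, hi, hi'⟩ := hS.exists_costd_sub (W := I)
    (fun c V _ => ExtZero.of_injective _ _ _) s hs.mono (fun d hd f => by
      by_contra hf
      have h1 := S.eq_of_iso b d ((hs.isCompositionFactor hf).iso_of_simple (S.simple d))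
      exact lt_irrefl _ (h1 ▸ hd)) hN
  obtain ⟨l, hl⟩ := hS.costdFiltered_of_extZero hi'
  refine ⟨l, Flag.of_bottom (Ses.of_mono i) hN hl, fun c hc => ?_⟩
  obtain ⟨V, hV⟩ := hS.std c
  obtain ⟨f, hf⟩ := hS.exists_hom_of_mem_costd_flag hl hc hV
  -- A nonzero map from `Δ_ε(c)` to the quotient lifts to `I`, whose socle `L b` must then be a
  -- factor of `Δ_ε(c)`.
  obtain ⟨g, hg⟩ := ExtZero.lift (Ses.of_mono i)
    (hS.extZero_succ 0 (Flag.single hV) (Flag.single hN)) f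
  exact hV.supp b (hs.isCompositionFactor (f := g) fun h0 => hf (by rw [← hg, h0, zero_comp]))

/-- The standing assumptions are self-dual. -/
theorem op : S.op.Setup (-ε) where
  finite := hS.finite
  schur b f hf := by
    obtain ⟨s, hs⟩ := hS.schur b f.unop fun h0 => hf (Quiver.Hom.unop_inj h0)
    refine ⟨NatIso.ofComponents (fun X => (s.app X.unop).op) fun {X Y} f => ?_, ?_⟩
    · have := s.hom.naturality f.unop
      exact congrArg Quiver.Hom.op this.symm
    · exact congrArg Quiver.Hom.op hs
  std b := (hS.costd b).elim fun _ h => ⟨_, h.op⟩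
  costd b := (hS.std b).elim fun _ h => ⟨_, h.op⟩
  flags b := by
    obtain ⟨N, hN⟩ := hS.costd b
    -- Projective objects with standard flags in the opposite category are injective hulls with
    -- costandard flags here.
    obtain ⟨I, hI⟩ := hN.exists_hull
    obtain ⟨l, hl, hc⟩ := hS.injectiveHull_flag hI
    obtain ⟨ι, hι⟩ := hI
    have := hι.injective
    refine ⟨Opposite.op I, l.reverse, inferInstance, ?_, fun c hc' => hc c (List.mem_reverse.1 hc')⟩
    have := hl.op (D' := S.op.IsEpsStandard (-ε)) fun _ _ h => h.op
    rwa [List.reverse_append] at this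

/-- A retract of a flagged object carries no evident flag, but vanishing of `Ext¹` does pass to
retracts. -/
lemma costdFiltered_of_retract {X Y : C} (r : Retract X Y) (hY : S.costdFiltered ε Y) :
    S.costdFiltered ε X := by
  have := HasExt.standard C
  exact hS.costdFiltered_of_extZero fun c V hV =>
    ExtZero.of_retract_right r (hS.extZero 0 ⟨_, Flag.single hV⟩ hY)

lemma costdFiltered_cokernel {U V W : C} {i : U ⟶ V} {p : V ⟶ W} (h : Ses i p)
    (hU : S.costdFiltered ε U) (hV : S.costdFiltered ε V) : S.costdFiltered ε W := by
  have := HasExt.standard C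
  exact hS.costdFiltered_of_extZero fun c X hX =>
    ExtZero.covariant_right h (hS.extZero 0 ⟨_, Flag.single hX⟩ hV)
      (hS.extZero 1 ⟨_, Flag.single hX⟩ hU)

lemma costdFiltered_of_injective (I : C) [Injective I] : S.costdFiltered ε I := by
  have := HasExt.standard C
  exact hS.costdFiltered_of_extZero fun c X hX => ExtZero.of_injective _ _ _

lemma stdFiltered_of_retract {X Y : C} (r : Retract X Y) (hY : S.stdFiltered ε Y) :
    S.stdFiltered ε X :=
  costdFiltered_unop (hS.op.costdFiltered_of_retract
    ⟨r.r.op, r.i.op, congrArg Quiver.Hom.op r.retract⟩ (stdFiltered_op hY))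

lemma stdFiltered_kernel {U V W : C} {i : U ⟶ V} {p : V ⟶ W} (h : Ses i p)
    (hV : S.stdFiltered ε V) (hW : S.stdFiltered ε W) : S.stdFiltered ε U :=
  costdFiltered_unop (hS.op.costdFiltered_cokernel h.op (stdFiltered_op hW) (stdFiltered_op hV))

lemma stdFiltered_of_projective (P : C) [Projective P] : S.stdFiltered ε P :=
  costdFiltered_unop (hS.op.costdFiltered_of_injective (Opposite.op P))

end Setup

end Stratification

/-! ### Approximations by objects with flags -/

section LiftExtension

variable {C : Type u} [Category.{v} C] [Abelian C]

/-- Let `V ⟶ Y` be an epimorphism with kernel `W`. An extension of `Z` by `Y` lifts to an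
extension of `Z` by `V` as soon as morphisms from the kernel `K` of an epimorphism `P ⟶ Z`, with
`P` projective, lift along `V ⟶ Y`. -/
theorem Ses.lift_extension {Y E Z W V K P : C} {a : Y ⟶ E} {b : E ⟶ Z} (h : Ses a b)
    {w : W ⟶ V} {v : V ⟶ Y} (hv : Ses w v) {k : K ⟶ P} {q : P ⟶ Z} (hq : Ses k q)
    (hP : Projective P) (hK : ∀ f : K ⟶ Y, ∃ f' : K ⟶ V, f' ≫ v = f) :
    ∃ (E' : C) (a' : V ⟶ E') (b' : E' ⟶ Z) (n : W ⟶ E') (m : E' ⟶ E),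
      Ses a' b' ∧ Ses n m := by
  have := h.epi
  have := h.mono
  have := hv.mono
  have := hv.epi
  have := hq.epi
  have ht := Projective.factorThru_comp q b
  set t := Projective.factorThru q b
  obtain ⟨f, hf⟩ := h.lift (k ≫ t) (by rw [Category.assoc, ht, hq.w])
  obtain ⟨f', hf'⟩ := hK f
  have hk := hq.mono
  -- The given extension corresponds to a map `K ⟶ Y`; the new one is the pushout of `K ⟶ P` along a
  -- lift of that map to `V`.
  let a' := Limits.pushout.inr k f'
  let b' : Limits.pushout k f' ⟶ Z := Limits.pushout.desc q 0 (by simp [hq.w])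
  let m : Limits.pushout k f' ⟶ E := Limits.pushout.desc t (v ≫ a) (by
    rw [← hf, ← hf', Category.assoc])
  have hab : a' ≫ b' = 0 := Limits.pushout.inr_desc _ _ _
  have hgb : Limits.pushout.inl k f' ≫ b' = q := Limits.pushout.inl_desc _ _ _
  have ham : a' ≫ m = v ≫ a := Limits.pushout.inr_desc _ _ _
  have hgm : Limits.pushout.inl k f' ≫ m = t := Limits.pushout.inl_desc _ _ _
  have hmb : m ≫ b = b' := by
    ext
    · rw [← Category.assoc, hgm, ht, hgb]
    · change a' ≫ m ≫ b = a' ≫ b'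
      rw [← Category.assoc, ham, Category.assoc, h.w, comp_zero, hab]
  have hb' : Epi b' := epi_of_epi_fac hgb
  have hs : Ses a' b' := by
    refine Ses.mk_of_desc hab fun X x hx => ?_
    obtain ⟨g, hg⟩ := hq.desc (Limits.pushout.inl k f' ≫ x) (by
      rw [← Category.assoc, Limits.pushout.condition, Category.assoc]
      change f' ≫ a' ≫ x = 0
      rw [hx, comp_zero])
    refine ⟨g, ?_⟩
    ext
    · rw [← Category.assoc, hgb, hg]
    · change a' ≫ b' ≫ g = a' ≫ x
      rw [← Category.assoc, hab, hx, zero_comp]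
  refine ⟨_, a', b', w ≫ a', m, hs, ⟨?_, mono_comp _ _, ?_, fun X x hx => ?_⟩⟩
  · rw [Category.assoc, ham, ← Category.assoc, hv.w, zero_comp]
  · refine Preadditive.epi_of_cancel_zero _ fun {X} x hx => ?_
    have h1 : a ≫ x = 0 := by
      rw [← cancel_epi v, ← Category.assoc, ← ham, Category.assoc, hx, comp_zero, comp_zero]
    obtain ⟨y, hy⟩ := h.desc x h1
    have h2 : y = 0 := by
      rw [← cancel_epi b', ← hmb, Category.assoc, hy, hx, comp_zero]
    rw [← hy, h2, comp_zero]
  · obtain ⟨y, hy⟩ := hs.lift x (by rw [← hmb, ← Category.assoc, hx, zero_comp])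
    obtain ⟨z, hz⟩ := hv.lift y (by
      rw [← cancel_mono a, Category.assoc, ← ham, ← Category.assoc, hy, hx, zero_comp])
    exact ⟨z, by rw [← Category.assoc, hz, hy]⟩

end LiftExtension

namespace Stratification

variable {C : Type u} [Category.{v} C] [Abelian C] {B : Type w} {Λ : Type w'} [PartialOrder Λ]

/-- `X` is a quotient of an object with a standard flag by an object with a costandard flag whose
composition factors have labels in `Γ`. -/
def StdApprox (S : Stratification C B Λ) (ε : Λ → ℤˣ) (Γ : Set Λ) (X : C) : Prop :=
  ∃ (W V : C) (i : W ⟶ V) (p : V ⟶ X), Ses i p ∧ S.costdFiltered ε W ∧ S.supp Γ W ∧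
    S.stdFiltered ε V

/-- `X` is a subobject of an object with a costandard flag such that the quotient has a standard
flag and composition factors with labels in `Γ`. -/
def CostdApprox (S : Stratification C B Λ) (ε : Λ → ℤˣ) (Γ : Set Λ) (X : C) : Prop :=
  ∃ (V W : C) (i : X ⟶ V) (p : V ⟶ W), Ses i p ∧ S.stdFiltered ε W ∧ S.supp Γ W ∧
    S.costdFiltered ε V

variable {S : Stratification C B Λ} {ε : Λ → ℤˣ} {Γ Γ' : Set Λ}

lemma StdApprox.op {X : C} (h : S.StdApprox ε Γ X) :
    S.op.CostdApprox (-ε) Γ (Opposite.op X) := by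
  obtain ⟨W, V, i, p, h1, h2, h3, h4⟩ := h
  exact ⟨_, _, _, _, h1.op, costdFiltered_op h2, supp_op h3, stdFiltered_op h4⟩

lemma CostdApprox.op {X : C} (h : S.CostdApprox ε Γ X) :
    S.op.StdApprox (-ε) Γ (Opposite.op X) := by
  obtain ⟨W, V, i, p, h1, h2, h3, h4⟩ := h
  exact ⟨_, _, _, _, h1.op, stdFiltered_op h2, supp_op h3, costdFiltered_op h4⟩

lemma StdApprox.unop {X : Cᵒᵖ} (h : S.op.StdApprox (-ε) Γ X) : S.CostdApprox ε Γ X.unop := by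
  obtain ⟨W, V, i, p, h1, h2, h3, h4⟩ := h
  exact ⟨_, _, _, _, h1.unop, costdFiltered_unop h2, supp_unop h3, stdFiltered_unop h4⟩

lemma CostdApprox.unop {X : Cᵒᵖ} (h : S.op.CostdApprox (-ε) Γ X) : S.StdApprox ε Γ X.unop := by
  obtain ⟨W, V, i, p, h1, h2, h3, h4⟩ := h
  exact ⟨_, _, _, _, h1.unop, stdFiltered_unop h2, supp_unop h3, costdFiltered_unop h4⟩

lemma StdApprox.weaken {X : C} (h : S.StdApprox ε Γ X) (hΓ : Γ ⊆ Γ') : S.StdApprox ε Γ' X := by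
  obtain ⟨W, V, i, p, h1, h2, h3, h4⟩ := h
  exact ⟨W, V, i, p, h1, h2, supp_mono hΓ h3, h4⟩

lemma CostdApprox.weaken {X : C} (h : S.CostdApprox ε Γ X) (hΓ : Γ ⊆ Γ') :
    S.CostdApprox ε Γ' X := by
  obtain ⟨W, V, i, p, h1, h2, h3, h4⟩ := h
  exact ⟨W, V, i, p, h1, h2, supp_mono hΓ h3, h4⟩

namespace Setup

variable [HasLength C] (hS : S.Setup ε)

include hS

lemma exists_projective_epi (X : C) : ∃ (P : C) (π : P ⟶ X), Projective P ∧ Epi π := by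
  induction X using len_induction with
  | h X ih =>
    by_cases hX : IsZero X
    · exact ⟨X, 𝟙 X, ⟨fun f e _ => ⟨0, hX.eq_of_src _ _⟩⟩, inferInstance⟩
    obtain ⟨L, p, hL, hp⟩ := exists_simple_quotient X hX
    obtain ⟨b, ⟨e⟩⟩ := S.exists_iso L hL
    obtain ⟨V, hV⟩ := hS.std b
    obtain ⟨Q, q, h, h1, -, -⟩ := hV.exists_cover
    have hs := (Ses.of_epi p).comp_iso e
    have := hs.epi
    have := h1.projective
    have := h1.epi
    obtain ⟨P, π, hP, hπ⟩ := ih (kernel p) (by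
      have h1 := HasLength.len_add hs
      have h2 := len_pos (S.not_isZero_L b)
      omega)
    have hl := Projective.factorThru_comp (q ≫ h) (p ≫ e.hom)
    refine ⟨P ⊞ Q, biprod.desc (π ≫ kernel.ι p) (Projective.factorThru (q ≫ h) (p ≫ e.hom)),
      inferInstance, Preadditive.epi_of_cancel_zero _ fun {Z} x hx => ?_⟩
    have hx1 : (π ≫ kernel.ι p) ≫ x = 0 := by
      have := congrArg (biprod.inl ≫ ·) hx
      simpa using this
    have hx2 : Projective.factorThru (q ≫ h) (p ≫ e.hom) ≫ x = 0 := by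
      have := congrArg (biprod.inr ≫ ·) hx
      simpa using this
    have hx3 : kernel.ι p ≫ x = 0 := by rw [← cancel_epi π, ← Category.assoc, hx1, comp_zero]
    obtain ⟨y, hy⟩ := hs.desc x hx3
    have : y = 0 := by
      rw [← cancel_epi (q ≫ h), ← hl, Category.assoc, hy, hx2, comp_zero]
    rw [← hy, this, comp_zero]

/-- A horseshoe argument. Pulling back along `V₂ ⟶ Z` gives an extension of `V₂` by `X`, which must
be lifted to one by `V₁`. The obstruction in `Ext²(V₂, W₁)` vanishes; it is met as `Ext¹(K, W₁)` for
the kernel `K` of a projective cover of `V₂`. The kernel of the resulting map onto `Y` is an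
extension of `W₂` by `W₁`. -/
lemma stdApprox_of_ses {X Y Z : C} {i : X ⟶ Y} {p : Y ⟶ Z} (h : Ses i p)
    (hX : S.StdApprox ε Γ X) (hZ : S.StdApprox ε Γ Z) : S.StdApprox ε Γ Y := by
  have := HasExt.standard C
  obtain ⟨W₁, V₁, w₁, v₁, h₁, hW₁, hW₁', hV₁⟩ := hX
  obtain ⟨W₂, V₂, w₂, v₂, h₂, hW₂, hW₂', hV₂⟩ := hZ
  obtain ⟨E, a, b, g, h3, -, -, h4, -⟩ := h.pullback v₂
  obtain ⟨w₂', -, h5⟩ := h4 w₂ h₂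
  obtain ⟨P, q, hP, hq⟩ := hS.exists_projective_epi V₂
  have hK := hS.stdFiltered_kernel (Ses.of_epi q) (hS.stdFiltered_of_projective P) hV₂
  obtain ⟨E', a', b', n, m, h6, h7⟩ := h3.lift_extension h₁ (Ses.of_epi q) hP fun f =>
    ExtZero.lift h₁ (hS.extZero 0 hK hW₁) f
  obtain ⟨W, a'', b'', g', h8, h9, -, -⟩ := h7.comp_epi h5
  exact ⟨W, E', g', _, h9, costdFiltered_of_ses h8 hW₁ hW₂, supp_of_ses h8 hW₁' hW₂',
    stdFiltered_of_ses h6 hV₁ hV₂⟩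

lemma stdApprox_of_compositionFactors {X : C}
    (H : ∀ b, IsCompositionFactor (S.L b) X → S.StdApprox ε Γ (S.L b)) : S.StdApprox ε Γ X := by
  induction X using len_induction with
  | h X ih =>
    by_cases hX : IsZero X
    · exact ⟨X, X, 0, 𝟙 X, Ses.isZero_left X hX, ⟨[], Flag.zero hX⟩, supp_of_isZero hX,
        ⟨[], Flag.zero hX⟩⟩
    obtain ⟨L, i, hL, hi⟩ := exists_simple_sub X hX
    obtain ⟨b, ⟨e⟩⟩ := S.exists_iso L hL
    have hs := (Ses.of_mono i).iso_comp e.symm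
    have := hs.mono
    refine hS.stdApprox_of_ses hs (H b ?_) (ih _ ?_ fun c hc => H c (hc.of_epi (cokernel.π i)))
    · exact IsCompositionFactor.of_simple_mono (S.simple b) (e.symm.hom ≫ i)
    · have h1 := HasLength.len_add hs
      have h2 := len_pos (S.not_isZero_L b)
      omega

lemma costdApprox_of_compositionFactors {X : C}
    (H : ∀ b, IsCompositionFactor (S.L b) X → S.CostdApprox ε Γ (S.L b)) :
    S.CostdApprox ε Γ X :=
  (hS.op.stdApprox_of_compositionFactors (X := Opposite.op X) fun b hb => (H b hb.unop).op).unop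

/-- For the sign `+`, the quotient of `∇̄(b)` by its socle lies strictly below `ρ b`. The pullback
of `∇̄(b)` along a standard approximation `V` of that quotient is an extension of `V` by `L b`, and
also of `∇̄(b)` by a costandardly filtered object. -/
lemma costdApprox_L {b : B} (he : ε (S.ρ b) = 1)
    (H : ∀ c, S.ρ c < S.ρ b → S.StdApprox ε (Set.Iic (S.ρ c)) (S.L c)) :
    S.CostdApprox ε (Set.Iio (S.ρ b)) (S.L b) := by
  obtain ⟨N, hN⟩ := hS.costd b
  obtain ⟨j, -, hj⟩ := hN.socle
  obtain ⟨Q, n, hs, hQ⟩ := hj he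
  obtain ⟨W, V, i, p, h1, h2, h3, h4⟩ := hS.stdApprox_of_compositionFactors
    (Γ := Set.Iio (S.ρ b)) fun c hc => (H c (hQ c hc)).weaken (Set.Iic_subset_Iio.2 (hQ c hc))
  obtain ⟨E, a, c, g, h5, -, -, h6, -⟩ := hs.pullback p
  obtain ⟨k, -, h7⟩ := h6 i h1
  exact ⟨E, V, a, c, h5, h4, supp_of_ses h1 h3 hQ, costdFiltered_of_ses h7 h2 ⟨_, Flag.single hN⟩⟩

/-- The pushout of `Δ_ε(b)` along a costandard approximation of its radical is an extension of `L b`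
by a costandardly filtered object, and also of a standardly filtered object by `Δ_ε(b)`. -/
lemma stdApprox_L {b : B}
    (H : ∀ c, S.ρ c ≤ S.ρ b → S.CostdApprox ε (Set.Iic (S.ρ b)) (S.L c)) :
    S.StdApprox ε (Set.Iic (S.ρ b)) (S.L b) := by
  obtain ⟨V, hV⟩ := hS.std b
  obtain ⟨π, hl, -⟩ := hV.head
  have := hl.epi
  have hK : S.supp (Set.Iic (S.ρ b)) (kernel π) := supp_of_mono hV.supp (kernel.ι π)
  obtain ⟨W, V', i, p, h1, h2, h3, h4⟩ := hS.costdApprox_of_compositionFactors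
    fun c hc => H c (hK c hc)
  obtain ⟨E, a, c, g, h5, -, -, h6, -⟩ := (Ses.of_epi π).pushout i
  obtain ⟨k, -, h7⟩ := h6 p h1
  exact ⟨W, E, a, c, h5, h4, supp_of_ses h1 hK h3, stdFiltered_of_ses h7 ⟨_, Flag.single hV⟩ h2⟩

/-- All simple objects have standard and costandard approximations. -/
theorem approx_L (b : B) : S.StdApprox ε (Set.Iic (S.ρ b)) (S.L b) ∧
    S.CostdApprox ε (Set.Iic (S.ρ b)) (S.L b) ∧
    (ε (S.ρ b) = 1 → S.CostdApprox ε (Set.Iio (S.ρ b)) (S.L b)) ∧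
    (ε (S.ρ b) = -1 → S.StdApprox ε (Set.Iio (S.ρ b)) (S.L b)) := by
  have := hS.finite
  have hwf : WellFounded fun a b : B => S.ρ a < S.ρ b :=
    haveI : IsTrans B fun a b : B => S.ρ a < S.ρ b := ⟨fun _ _ _ => lt_trans⟩
    haveI : Std.Irrefl fun a b : B => S.ρ a < S.ρ b := ⟨fun _ => lt_irrefl _⟩
    Finite.wellFounded_of_trans_of_irrefl _
  induction b using hwf.induction with
  | _ b ih =>
    -- For the sign `+`, costandard approximations in the stratum need only smaller labels, and the
    -- standard ones then use them for the whole stratum. For the sign `-` the roles are exchanged.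
    rcases Int.units_eq_one_or (ε (S.ρ b)) with he | he
    · have h1 : ∀ c, S.ρ c = S.ρ b → S.CostdApprox ε (Set.Iio (S.ρ b)) (S.L c) := fun c hc => by
        rw [← hc]
        exact hS.costdApprox_L (hc ▸ he) fun d hd => (ih d (hc ▸ hd)).1
      refine ⟨hS.stdApprox_L fun c hc => ?_, (h1 b rfl).weaken Set.Iio_subset_Iic_self,
        fun _ => h1 b rfl, fun h => absurd (he.symm.trans h) (by decide)⟩
      rcases hc.eq_or_lt with h | h
      · exact (h1 c h).weaken Set.Iio_subset_Iic_self
      · exact (ih c h).2.1.weaken (Set.Iic_subset_Iic.2 hc)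
    · have h1 : ∀ c, S.ρ c = S.ρ b → S.StdApprox ε (Set.Iio (S.ρ b)) (S.L c) := fun c hc => by
        rw [← hc]
        exact (hS.op.costdApprox_L (b := c) (by simp [hc, he]) fun d hd =>
          (ih d (hc ▸ hd)).2.1.op).unop
      have h2 := hS.op.stdApprox_L (b := b) fun c hc => by
        rcases LE.le.eq_or_lt hc with h | h
        · exact ((h1 c h).weaken Set.Iio_subset_Iic_self).op
        · exact ((ih c h).1.weaken (Set.Iic_subset_Iic.2 hc)).op
      exact ⟨(h1 b rfl).weaken Set.Iio_subset_Iic_self, h2.unop,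
        fun h => absurd (he.symm.trans h) (by decide), fun _ => h1 b rfl⟩

theorem stdApprox (X : C) : S.StdApprox ε Set.univ X :=
  hS.stdApprox_of_compositionFactors fun b _ => (hS.approx_L b).1.weaken (Set.subset_univ _)

theorem costdApprox_Iio {x : Λ} (hx : ε x = 1) {X : C} (hX : S.supp (Set.Iic x) X) :
    S.CostdApprox ε (Set.Iio x) X :=
  hS.costdApprox_of_compositionFactors fun b hb => by
    rcases LE.le.eq_or_lt (hX b hb) with h | h
    · exact h ▸ (hS.approx_L b).2.2.1 (h ▸ hx)
    · exact (hS.approx_L b).2.1.weaken (Set.Iic_subset_Iio.2 h)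

end Setup

end Stratification

/-! ### Indecomposable tilting objects -/

namespace Stratification

variable {C : Type u} [Category.{v} C] [Abelian C] {B : Type w} {Λ : Type w'} [PartialOrder Λ]
  {S : Stratification C B Λ} {ε : Λ → ℤˣ}

lemma IsIndecTilting.isTilting {b : B} {U : C} (h : S.IsIndecTilting ε b U) : S.IsTilting ε U :=
  ⟨h.2.1.imp' _ fun _ h => h, h.2.2.imp' _ fun _ h => h⟩

lemma IsTilting.iso {U V : C} (h : S.IsTilting ε U) (e : U ≅ V) : S.IsTilting ε V :=
  ⟨h.1.imp fun _ h => h.iso e, h.2.imp fun _ h => h.iso e⟩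

lemma IsIndecTilting.iso {b : B} {U V : C} (h : S.IsIndecTilting ε b U) (e : U ≅ V) :
    S.IsIndecTilting ε b V :=
  ⟨indecomposable_of_iso e h.1, h.2.1.imp fun _ h => h.iso e, h.2.2.imp fun _ h => h.iso e⟩

lemma IsIndecTilting.exists_bottom {b : B} {U : C} (h : S.IsIndecTilting ε b U) :
    ∃ (X Q : C) (i : X ⟶ U) (p : U ⟶ Q), Ses i p ∧ S.IsEpsStandard ε b X ∧
      S.stdFiltered ε Q := by
  obtain ⟨-, ⟨l, hl⟩, -⟩ := h
  obtain ⟨X, Q, i, p, hs, hX, hQ⟩ := hl.exists_bottom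
  exact ⟨X, Q, i, p, hs, hX, l, hQ⟩

lemma IsIndecTilting.exists_top {b : B} {U : C} (h : S.IsIndecTilting ε b U) :
    ∃ (K X : C) (i : K ⟶ U) (p : U ⟶ X) (l : List B), Ses i p ∧ S.IsEpsCostandard ε b X ∧
      Flag (S.IsEpsCostandard ε) l K := by
  obtain ⟨-, -, ⟨l, hl⟩⟩ := h
  obtain ⟨K, X, i, p, hs, hK, hX⟩ := hl.exists_ses
  exact ⟨K, X, i, p, l, hs, hX, hK⟩

namespace Setup

variable [HasLength C] (hS : S.Setup ε)

include hS

lemma isTilting_of_retract {X Y : C} (r : Retract X Y) (hY : S.IsTilting ε Y) :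
    S.IsTilting ε X :=
  ⟨hS.stdFiltered_of_retract r hY.1, hS.costdFiltered_of_retract r hY.2⟩

/-- An indecomposable tilting object is a summand of every tilting object with the same bottom
section. -/
theorem retract_of_bottom {b : B} {U V X Y Q R : C} (hU : Indecomposable U)
    (hUc : S.costdFiltered ε U) (hVc : S.costdFiltered ε V) {i : X ⟶ U} {p : U ⟶ Q}
    (h : Ses i p) {j : Y ⟶ V} {q : V ⟶ R} (h' : Ses j q) (hX : S.IsEpsStandard ε b X)
    (hY : S.IsEpsStandard ε b Y) (hQ : S.stdFiltered ε Q) (hR : S.stdFiltered ε R) :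
    Nonempty (Retract U V) := by
  have := HasExt.standard C
  obtain ⟨e⟩ := hX.exists_iso hY
  -- The isomorphism of bottom sections extends to `f` and `g` in both directions. Since `f ≫ g`
  -- fixes `X`, the difference `𝟙 U - f ≫ g` is not invertible, so by locality `f ≫ g` is.
  obtain ⟨f, hf⟩ := ExtZero.extend h (hS.extZero 0 hQ hVc) (e.hom ≫ j)
  obtain ⟨g, hg⟩ := ExtZero.extend h' (hS.extZero 0 hR hUc) (e.inv ≫ i)
  have hfg : i ≫ f ≫ g = i := by rw [reassoc_of% hf, hg]; simp
  have hni : ¬ IsIso (𝟙 U - f ≫ g) := by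
    intro hi
    have h0 : i ≫ (𝟙 U - f ≫ g) = 0 := by rw [Preadditive.comp_sub, hfg]; simp
    have h1 : i = 0 := (Preadditive.IsIso.comp_right_eq_zero _ _).1 h0
    have := h.mono
    refine hX.not_isZero ?_
    rw [IsZero.iff_id_eq_zero, ← cancel_mono i, h1]
    simp
  have := (isIso_or_isIso_id_sub hU (f ≫ g)).resolve_right hni
  exact ⟨⟨f, g ≫ inv (f ≫ g), by rw [← Category.assoc]; exact IsIso.hom_inv_id (f ≫ g)⟩⟩

theorem indecTilting_iso {b : B} {U V : C} (hU : S.IsIndecTilting ε b U)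
    (hV : S.IsIndecTilting ε b V) : Nonempty (U ≅ V) := by
  obtain ⟨X, Q, i, p, h, hX, hQ⟩ := hU.exists_bottom
  obtain ⟨Y, R, j, q, h', hY, hR⟩ := hV.exists_bottom
  obtain ⟨r⟩ := hS.retract_of_bottom hU.1 hU.isTilting.2 hV.isTilting.2 h h' hX hY hQ hR
  rcases Retract.isZero_or_of_indecomposable hV.1 r with h0 | h0
  · exact absurd h0 hU.1.1
  · exact ⟨asIso r.i⟩

/-- The costandard approximation of `Δ_ε(b)` starts with the same bottom section as `T(b)`, so
`T(b)` is a summand of it; for the sign `+` the rest of the approximation lies strictly below `ρ b`.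
-/
lemma indecTilting_approx {b : B} {U : C} (hU : S.IsIndecTilting ε b U) (he : ε (S.ρ b) = 1) :
    ∃ (X M Q : C) (i : X ⟶ M) (p : M ⟶ Q) (_ : Retract U M), Ses i p ∧ S.IsEpsStandard ε b X ∧
      S.supp (Set.Iio (S.ρ b)) Q := by
  obtain ⟨X, Q, i, p, h, hX, hQ⟩ := hU.exists_bottom
  obtain ⟨M, R, j, q, h', hR, hR', hM⟩ := hS.costdApprox_Iio he hX.supp
  obtain ⟨r⟩ := hS.retract_of_bottom hU.1 hU.isTilting.2 hM h h' hX hX hQ hR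
  exact ⟨X, M, R, j, q, r, h', hX, hR'⟩

/-- The composition factors of `T(b)` have labels at most that of `b`. -/
theorem indecTilting_supp {b : B} {U : C} (hU : S.IsIndecTilting ε b U) :
    S.supp (Set.Iic (S.ρ b)) U := by
  rcases Int.units_eq_one_or (ε (S.ρ b)) with he | he
  · obtain ⟨X, M, Q, i, p, r, h, hX, hQ⟩ := hS.indecTilting_approx hU he
    exact supp_of_retract r (supp_of_ses h hX.supp (supp_mono Set.Iio_subset_Iic_self hQ))
  · obtain ⟨X, M, Q, i, p, r, h, hX, hQ⟩ := hS.op.indecTilting_approx hU.op (by simp [he])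
    exact supp_unop (supp_of_retract r (supp_of_ses h hX.supp
      (supp_mono (S := S.op) Set.Iio_subset_Iic_self hQ)))

/-- If `ε = +` at the label of `b`, the only costandard object with label not below that of `b`
which receives a nonzero morphism from `T(b)` is the one labelled by `b`, and the morphism is
essentially unique. -/
theorem indecTilting_hom {b c : B} {U W : C} (hU : S.IsIndecTilting ε b U)
    (he : ε (S.ρ b) = 1) (hW : S.IsEpsCostandard ε c W) (hc : ¬ S.ρ c < S.ρ b) {f f' : U ⟶ W}
    (hf : f ≠ 0) (hf' : f' ≠ 0) : b = c ∧ ∃ s : 𝟭 C ≅ 𝟭 C, f' = s.hom.app U ≫ f := by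
  obtain ⟨X, M, Q, i, p, r, h, hX, hQ⟩ := hS.indecTilting_approx hU he
  -- A map that vanishes on the bottom section factors through `Q`, whose labels are strictly below
  -- `ρ b`. Restriction to `X` is thus injective and reduces the claim to standard objects.
  have key : ∀ f : U ⟶ W, f ≠ 0 → i ≫ r.r ≫ f ≠ 0 := by
    intro f hf h0
    obtain ⟨g, hg⟩ := h.desc (r.r ≫ f) h0
    have hg0 : g ≠ 0 := by
      rintro rfl
      refine hf ?_
      rw [← Category.id_comp f, ← r.retract, Category.assoc, ← hg]
      simp
    exact hc (hQ c (hW.isCompositionFactor hg0))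
  obtain rfl := (hom_std_costd hX hW (key f hf)).1
  obtain ⟨s, hs⟩ := hS.hom_unique hX hW (key f hf) (key f' hf')
  refine ⟨rfl, s, ?_⟩
  let t : U ⟶ U := s.hom.app U
  change f' = t ≫ f
  by_contra hne
  refine key (f' - t ≫ f) (sub_ne_zero.2 hne) ?_
  have h1 : (i ≫ r.r) ≫ t = s.hom.app X ≫ i ≫ r.r := s.hom.naturality (i ≫ r.r)
  rw [Preadditive.comp_sub, Preadditive.comp_sub, hs]
  simp only [Category.assoc, Functor.id_obj] at h1 ⊢
  rw [reassoc_of% h1]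
  simp

/-- The dual of `indecTilting_hom`, with uniqueness recorded only through what it implies for
composites. -/
theorem indecTilting_hom_to {b c : B} {U W : C} (hU : S.IsIndecTilting ε b U)
    (he : ε (S.ρ b) = -1) (hW : S.IsEpsStandard ε c W) (hc : ¬ S.ρ c < S.ρ b) {f f' : W ⟶ U}
    (hf : f ≠ 0) (hf' : f' ≠ 0) : b = c ∧
      ∀ ⦃Y : C⦄ (p : U ⟶ Y), f ≫ p = 0 → f' ≫ p = 0 := by
  obtain ⟨h, s, hs⟩ := hS.op.indecTilting_hom hU.op (by simp [he]) hW.op hc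
    (f := f.op) (f' := f'.op) (fun h => hf (Quiver.Hom.op_inj h))
    (fun h => hf' (Quiver.Hom.op_inj h))
  refine ⟨h, fun Y p hp => Quiver.Hom.op_inj ?_⟩
  have hs' : f'.op = s.hom.app (Opposite.op U) ≫ f.op := hs
  have hn : p.op ≫ s.hom.app (Opposite.op U) = s.hom.app (Opposite.op Y) ≫ p.op :=
    s.hom.naturality p.op
  rw [op_comp, hs', ← Category.assoc, hn, Category.assoc]
  erw [← op_comp, hp]
  simp

/-- The bottom sections show that both labels lie in the same stratum. There the projection to
`∇_ε(c)` (sign `+`) or the inclusion of `Δ_ε(c)` (sign `-`) is a nonzero map that determines the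
label. -/
theorem indecTilting_label {b c : B} {U : C} (hU : S.IsIndecTilting ε b U)
    (hU' : S.IsIndecTilting ε c U) : b = c := by
  have key : ∀ {b c : B}, S.IsIndecTilting ε b U → S.IsIndecTilting ε c U → S.ρ b ≤ S.ρ c := by
    intro b c hU hU'
    obtain ⟨X, Q, i, p, h, hX, -⟩ := hU.exists_bottom
    have := h.mono
    refine hS.indecTilting_supp hU' b (hX.isCompositionFactor (f := i) fun h0 => hX.not_isZero ?_)
    rw [IsZero.iff_id_eq_zero, ← cancel_mono i, h0]
    simp
  have hbc := le_antisymm (key hU hU') (key hU' hU)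
  rcases Int.units_eq_one_or (ε (S.ρ b)) with he | he
  · obtain ⟨K, X, i, p, l, hs, hX, -⟩ := hU'.exists_top
    have := hs.epi
    have hp : p ≠ 0 := by
      intro h0
      refine hX.not_isZero ?_
      rw [IsZero.iff_id_eq_zero, ← cancel_epi p, h0]
      simp
    exact (hS.indecTilting_hom hU he hX (by rw [hbc]; exact lt_irrefl _) hp hp).1
  · obtain ⟨X, Q, i, p, hs, hX, -⟩ := hU'.exists_bottom
    have := hs.mono
    have hp : i ≠ 0 := by
      intro h0
      refine hX.not_isZero ?_
      rw [IsZero.iff_id_eq_zero, ← cancel_mono i, h0]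
      simp
    exact (hS.indecTilting_hom_to hU he hX (by rw [hbc]; exact lt_irrefl _) hp hp).1

/-- Every tilting object is a direct sum of the indecomposable ones `T(b)`. -/
theorem tilting_induction (hT : ∀ b, ∃ U, S.IsIndecTilting ε b U) {motive : C → Prop}
    (zero : ∀ X, IsZero X → motive X)
    (add : ∀ X Y Z : C, (Z ≅ X ⊞ Y) → motive X → motive Y → motive Z)
    (indec : ∀ b U, S.IsIndecTilting ε b U → motive U) {V : C} (hV : S.IsTilting ε V) :
    motive V := by
  induction V using len_induction with
  | h V ih =>
    obtain ⟨⟨l, hl⟩, hc⟩ := hV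
    rcases l.eq_nil_or_concat' with rfl | ⟨l, b, rfl⟩
    · exact zero V hl.isZero
    obtain ⟨X, Q, i, p, h, hX, hQ⟩ := hl.exists_bottom
    obtain ⟨U, hU⟩ := hT b
    obtain ⟨Y, R, j, q, h', hY, hR⟩ := hU.exists_bottom
    -- The bottom section of `V` splits off a copy of `T(b)`; the complement is tilting and shorter.
    obtain ⟨r⟩ := hS.retract_of_bottom hU.1 hU.isTilting.2 hc h' h hY hX hR ⟨l, hQ⟩
    obtain ⟨Z, ⟨e⟩⟩ := retract_summand r
    refine add U Z V e (indec b U hU) (ih Z ?_ ?_)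
    · rw [len_iso e, HasLength.len_add (Ses.biprod U Z)]
      have := len_pos hU.1.1
      omega
    · obtain ⟨r'⟩ := retract_biprod_right U Z
      exact (hS.isTilting_of_retract r' (IsTilting.iso ⟨⟨_, hl⟩, hc⟩ e))

/-- The standard approximation of `W` is an extension of `W` by a costandardly filtered object,
hence has both kinds of flags. -/
lemma exists_tilting_cover {W : C} (hW : S.costdFiltered ε W) :
    ∃ (K V : C) (k : K ⟶ V) (p : V ⟶ W), Ses k p ∧ S.costdFiltered ε K ∧ S.IsTilting ε V := by
  obtain ⟨K, V, k, p, h, hK, -, hV⟩ := hS.stdApprox W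
  exact ⟨K, V, k, p, h, hK, hV, costdFiltered_of_ses h hK hW⟩

end Setup

end Stratification

/-! ### Heads and socles -/

section HeadSocle

variable {C : Type u} [Category.{v} C] [Abelian C]

lemma isSemisimpleObj_of_simple {X : C} (hX : Simple X) : IsSemisimpleObj X :=
  ⟨1, fun _ => X, fun _ => hX, ⟨(coproductUniqueIso fun _ : Fin 1 => X).symm⟩⟩

/-- Each component of a map to a sum of simple objects is zero or agrees with `h` up to isomorphism,
so it kills the kernel of `h`. -/
lemma IsLocal.isHead {V H : C} {h : V ⟶ H} (hl : IsLocal h) : IsHead V H := by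
  have := hl.epi
  have := Abelian.hasFiniteBiproducts (C := C)
  refine ⟨isSemisimpleObj_of_simple hl.simple, h, hl.epi, fun X f hf ⟨n, Y, hY, ⟨e⟩⟩ => ?_⟩
  refine (Ses.of_epi h).desc f ?_
  rw [← cancel_mono (e ≪≫ (biproduct.isoCoproduct Y).symm).hom, zero_comp]
  refine biproduct.hom_ext _ _ fun j => ?_
  rw [zero_comp, Category.assoc, Category.assoc]
  by_cases h0 : f ≫ (e ≪≫ (biproduct.isoCoproduct Y).symm).hom ≫ biproduct.π Y j = 0
  · rw [h0, comp_zero]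
  · obtain ⟨t, ht⟩ := hl.to_simple (hY j) h0
    rw [← ht, kernel.condition_assoc, zero_comp]

lemma IsColocal.isSocle {V H : C} {h : H ⟶ V} (hl : IsColocal h) : IsSocle V H := by
  have := hl.mono
  refine ⟨isSemisimpleObj_of_simple (simple_unop hl.simple), h, hl.mono,
    fun X f hf ⟨n, Y, hY, ⟨e⟩⟩ => ?_⟩
  refine (Ses.of_mono h).lift f ?_
  rw [← cancel_epi e.inv, comp_zero]
  refine Sigma.hom_ext _ _ fun j => ?_
  rw [comp_zero]
  by_cases h0 : Sigma.ι Y j ≫ e.inv ≫ f = 0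
  · rw [reassoc_of% h0, zero_comp]
  · obtain ⟨t, ht⟩ := IsLocal.to_simple hl (simple_op (hY j)) (f := (Sigma.ι Y j ≫ e.inv ≫ f).op)
      fun h => h0 (Quiver.Hom.op_inj h)
    have ht' : t.hom.unop ≫ h = Sigma.ι Y j ≫ e.inv ≫ f := congrArg Quiver.Hom.unop ht
    rw [← reassoc_of% ht', cokernel.condition, comp_zero]

end HeadSocle

/-! ### Pushouts of short exact sequences -/

section PushoutSes

variable {C : Type u} [Category.{v} C] [Abelian C]

/-- A morphism of short exact sequences which is the identity on the right terms yields a short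
exact sequence of Mayer-Vietoris type. -/
lemma Ses.biprod_of_hom {A X Q V E : C} {i : A ⟶ X} {p : X ⟶ Q} (h : Ses i p) {a : V ⟶ E}
    {b : E ⟶ Q} (h' : Ses a b) (f : A ⟶ V) (x : X ⟶ E) (h1 : i ≫ x = f ≫ a) (h2 : x ≫ b = p) :
    Ses (biprod.lift i (-f)) (biprod.desc x a) := by
  have := h.mono
  have := h.epi
  have := h'.mono
  refine ⟨by simp [biprod.lift_desc, h1], ?_, ?_, fun Z z hz => ?_⟩
  · have : Mono (biprod.lift i (-f) ≫ biprod.fst) := by rw [biprod.lift_fst]; exact h.mono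
    exact mono_of_mono _ biprod.fst
  · refine Preadditive.epi_of_cancel_zero _ fun {Z} z hz => ?_
    have hz1 : x ≫ z = 0 := by simpa using congrArg (biprod.inl ≫ ·) hz
    have hz2 : a ≫ z = 0 := by simpa using congrArg (biprod.inr ≫ ·) hz
    obtain ⟨y, hy⟩ := h'.desc z hz2
    have : y = 0 := by rw [← cancel_epi p, ← h2, Category.assoc, hy, hz1, comp_zero]
    rw [← hy, this, comp_zero]
  · have hz' : (z ≫ biprod.fst) ≫ x + (z ≫ biprod.snd) ≫ a = 0 := by
      rw [← hz, biprod.desc_eq]; simp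
    have h3 : (z ≫ biprod.fst) ≫ p = 0 := by
      have := congrArg (· ≫ b) hz'
      simpa [h2, h'.w] using this
    obtain ⟨y, hy⟩ := h.lift _ h3
    refine ⟨y, ?_⟩
    ext
    · simpa using hy
    · rw [← cancel_mono a]
      rw [← hy, Category.assoc, h1] at hz'
      simp only [Category.assoc, biprod.lift_snd, Preadditive.comp_neg, Preadditive.neg_comp]
      rw [neg_eq_iff_add_eq_zero]
      simpa using hz'

/-- Two pushouts of the same short exact sequence are isomorphic. -/
lemma Ses.pushout_iso {A X Q V E E' : C} {i : A ⟶ X} {p : X ⟶ Q} (h : Ses i p) {a : V ⟶ E}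
    {b : E ⟶ Q} (h' : Ses a b) {a' : V ⟶ E'} {b' : E' ⟶ Q} (h'' : Ses a' b') (f : A ⟶ V)
    {x : X ⟶ E} {x' : X ⟶ E'} (h1 : i ≫ x = f ≫ a) (h2 : x ≫ b = p) (h1' : i ≫ x' = f ≫ a')
    (h2' : x' ≫ b' = p) : Nonempty (E ≅ E') := by
  have s := h.biprod_of_hom h' f x h1 h2
  have s' := h.biprod_of_hom h'' f x' h1' h2'
  have := s.epi
  have := s'.epi
  obtain ⟨g, hg⟩ := s.desc _ s'.w
  obtain ⟨g', hg'⟩ := s'.desc _ s.w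
  refine ⟨⟨g, g', ?_, ?_⟩⟩
  · rw [← cancel_epi (biprod.desc x a), reassoc_of% hg, hg', Category.comp_id]
  · rw [← cancel_epi (biprod.desc x' a'), reassoc_of% hg', hg, Category.comp_id]

end PushoutSes

/-! ### Ringel duality functors -/

lemma projective_of_retract {C : Type u} [Category.{v} C] {X Y : C} (r : Retract X Y)
    (h : Projective Y) : Projective X :=
  ⟨fun f e _ => ⟨r.i ≫ Projective.factorThru (r.r ≫ f) e, by simp⟩⟩

lemma map_bijective_of_retract {C : Type u} [Category.{v} C] {D : Type u'} [Category.{v'} D]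
    {F : C ⥤ D} {X Y : C} (r : Retract X Y)
    (h : ∀ Z : C, Function.Bijective (F.map : (Y ⟶ Z) → (F.obj Y ⟶ F.obj Z))) (Z : C) :
    Function.Bijective (F.map : (X ⟶ Z) → (F.obj X ⟶ F.obj Z)) := by
  constructor
  · intro f g hfg
    have : r.r ≫ f = r.r ≫ g := (h Z).1 (by
      rw [F.map_comp, F.map_comp, hfg])
    rw [← Category.id_comp f, ← Category.id_comp g, ← r.retract, Category.assoc, this,
      Category.assoc]
  · intro f
    obtain ⟨k, hk⟩ := (h Z).2 (F.map r.r ≫ f)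
    refine ⟨r.i ≫ k, ?_⟩
    rw [F.map_comp, hk, ← Category.assoc, ← F.map_comp, r.retract, F.map_id, Category.id_comp]

section RingelFunctor

open Stratification

variable {C : Type u} [Category.{v} C] [Abelian C] {B : Type w} {Λ : Type w'} [PartialOrder Λ]
  {D : Type u'} [Category.{v'} D] [Abelian D]

/-- The properties of the functor `Hom(T, -)`: it maps `T` to a projective generator and induces
bijections on morphisms from `T`. -/
structure IsRingelFunctor (T : C) (F : C ⥤ D) : Prop where
  projective : Projective (F.obj T)
  generator : ∀ X : D, ¬ IsZero X → ∃ f : F.obj T ⟶ X, f ≠ 0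
  bijective : ∀ V : C, Function.Bijective (F.map : (T ⟶ V) → (F.obj T ⟶ F.obj V))

variable {T : C} {F : C ⥤ D} [F.Additive] {S : Stratification C B Λ} {ε : Λ → ℤˣ}

lemma map_bijective_biprod {X Y : C}
    (hX : ∀ Z : C, Function.Bijective (F.map : (X ⟶ Z) → (F.obj X ⟶ F.obj Z)))
    (hY : ∀ Z : C, Function.Bijective (F.map : (Y ⟶ Z) → (F.obj Y ⟶ F.obj Z))) (Z : C) :
    Function.Bijective (F.map : (X ⊞ Y ⟶ Z) → (F.obj (X ⊞ Y) ⟶ F.obj Z)) := by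
  constructor
  · intro f g hfg
    ext
    · exact (hX Z).1 (by rw [F.map_comp, F.map_comp, hfg])
    · exact (hY Z).1 (by rw [F.map_comp, F.map_comp, hfg])
  · intro f
    obtain ⟨a, ha⟩ := (hX Z).2 (F.map biprod.inl ≫ f)
    obtain ⟨b, hb⟩ := (hY Z).2 (F.map biprod.inr ≫ f)
    refine ⟨biprod.desc a b, ?_⟩
    rw [biprod.desc_eq, F.map_add, F.map_comp, F.map_comp, ha, hb, ← Category.assoc,
      ← Category.assoc, ← F.map_comp, ← F.map_comp, ← Preadditive.add_comp, ← F.map_add,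
      biprod.total, F.map_id, Category.id_comp]

lemma hom_eq_zero_of_map_biprod {X Y : C} {Z : D} {f : F.obj (X ⊞ Y) ⟶ Z}
    (h1 : F.map biprod.inl ≫ f = 0) (h2 : F.map biprod.inr ≫ f = 0) : f = 0 := by
  rw [← Category.id_comp f, ← F.map_id, ← biprod.total, F.map_add, Preadditive.add_comp,
    F.map_comp, F.map_comp, Category.assoc, Category.assoc, h1, h2, comp_zero, comp_zero, add_zero]

/-- The functor `F` on a short exact sequence. -/
lemma IsRingelFunctor.map_ses [HasExt.{w} C] (hF : IsRingelFunctor T F) {U V W : C} {i : U ⟶ V}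
    {p : V ⟶ W} (h : Ses i p) (h1 : ExtZero.{w} 1 T U) : Ses (F.map i) (F.map p) := by
  have := h.mono
  have := hF.projective
  have hw : F.map i ≫ F.map p = 0 := by rw [← F.map_comp, h.w, F.map_zero]
  -- Everything is tested on maps from the projective generator `F T`, which come from maps out of
  -- `T`. Only surjectivity needs `Ext¹(T, U) = 0`.
  have hm : Mono (F.map i) := by
    refine Preadditive.mono_of_kernel_zero ?_
    by_contra hne
    obtain ⟨f, hf⟩ := hF.generator (kernel (F.map i)) fun h0 => hne (h0.eq_of_src _ _)
    obtain ⟨g, hg⟩ := (hF.bijective U).2 (f ≫ kernel.ι (F.map i))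
    have : g ≫ i = 0 := (hF.bijective V).1 (by
      rw [F.map_comp, hg, Category.assoc, kernel.condition, comp_zero, F.map_zero])
    have hg0 := zero_of_comp_mono i this
    rw [hg0, F.map_zero] at hg
    exact hf (zero_of_comp_mono _ hg.symm)
  have hk : ∀ f : F.obj T ⟶ F.obj V, f ≫ F.map p = 0 → ∃ g, g ≫ F.map i = f := by
    intro f hf
    obtain ⟨f, rfl⟩ := (hF.bijective V).2 f
    rw [← F.map_comp] at hf
    obtain ⟨g, hg⟩ := h.lift f ((hF.bijective W).1 (by rw [hf, F.map_zero]))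
    exact ⟨F.map g, by rw [← F.map_comp, hg]⟩
  have key : ∀ {X Y : D} (g : X ⟶ Y), (∀ f : F.obj T ⟶ Y, ∃ f', f' ≫ g = f) → Epi g := by
    intro X Y g hg
    refine Preadditive.epi_of_cokernel_zero ?_
    by_contra hne
    obtain ⟨f, hf⟩ := hF.generator (cokernel g) fun h0 => hne (h0.eq_of_tgt _ _)
    obtain ⟨f', hf'⟩ := hg (Projective.factorThru f (cokernel.π g))
    refine hf ?_
    rw [← Projective.factorThru_comp f (cokernel.π g), ← hf', Category.assoc,
      cokernel.condition, comp_zero]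
  have he : Epi (F.map p) := key _ fun f => by
    obtain ⟨f, rfl⟩ := (hF.bijective W).2 f
    obtain ⟨g, hg⟩ := ExtZero.lift h h1 f
    exact ⟨F.map g, by rw [← F.map_comp, hg]⟩
  have hl : Epi (kernel.lift (F.map p) (F.map i) hw) := key _ fun f => by
    obtain ⟨g, hg⟩ := hk (f ≫ kernel.ι _) (by rw [Category.assoc, kernel.condition, comp_zero])
    refine ⟨g, ?_⟩
    rw [← cancel_mono (kernel.ι (F.map p)), Category.assoc, kernel.lift_ι, hg]
  have hlm : Mono (kernel.lift (F.map p) (F.map i) hw) :=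
    mono_of_mono_fac (kernel.lift_ι (F.map p) (F.map i) hw)
  have := isIso_of_mono_of_epi (kernel.lift (F.map p) (F.map i) hw)
  refine ⟨hw, hm, he, fun Z f hf => ⟨kernel.lift _ f hf ≫
    inv (kernel.lift (F.map p) (F.map i) hw), ?_⟩⟩
  rw [Category.assoc, (IsIso.inv_comp_eq (kernel.lift (F.map p) (F.map i) hw)).2
    (kernel.lift_ι (F.map p) (F.map i) hw).symm, kernel.lift_ι]

lemma Stratification.Setup.exists_retract [HasLength C] (hS : S.Setup ε)
    (hT : S.IsTiltingGenerator ε T) {b : B} {U : C} (hU : S.IsIndecTilting ε b U) :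
    Nonempty (Retract U T) := by
  obtain ⟨U', hU', ⟨r⟩⟩ := hT.2 b
  obtain ⟨e⟩ := hS.indecTilting_iso hU hU'
  exact ⟨(Retract.ofIso e).trans r⟩

namespace IsRingelFunctor

variable [HasLength C] (hS : S.Setup ε) (hT : S.IsTiltingGenerator ε T)
  (hF : IsRingelFunctor T F)

include hS hT hF

/-- Both properties hold for `T` and pass to summands and finite sums, hence reach all tilting
objects. -/
lemma tilting_obj {V : C} (hV : S.IsTilting ε V) : Projective (F.obj V) ∧
    ∀ X : C, Function.Bijective (F.map : (V ⟶ X) → (F.obj V ⟶ F.obj X)) := by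
  refine hS.tilting_induction (motive := fun V => Projective (F.obj V) ∧
    ∀ X : C, Function.Bijective (F.map : (V ⟶ X) → (F.obj V ⟶ F.obj X)))
    (fun b => (hT.2 b).imp fun _ h => h.1) (fun X hX => ⟨?_, ?_⟩)
    (fun X Y Z e hX hY => ⟨?_, ?_⟩) (fun b U hU => ?_) hV
  · have : IsZero (F.obj X) := F.map_isZero hX
    exact ⟨fun f e _ => ⟨0, this.eq_of_src _ _⟩⟩
  · exact fun Y => ⟨fun f g _ => hX.eq_of_src _ _,
      fun f => ⟨0, (F.map_isZero hX).eq_of_src _ _⟩⟩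
  · have := hX.1
    have := hY.1
    have := preservesBinaryBiproducts_of_preservesBiproducts F
    have h1 : Projective (F.obj X ⊞ F.obj Y) := inferInstance
    have h2 : F.obj Z ≅ F.obj X ⊞ F.obj Y := F.mapIso e ≪≫ F.mapBiprod X Y
    exact Projective.of_iso h2.symm h1
  · exact map_bijective_of_retract (Retract.ofIso e) (map_bijective_biprod hX.2 hY.2)
  · obtain ⟨r⟩ := hS.exists_retract hT hU
    exact ⟨projective_of_retract (r.map F) hF.projective,
      map_bijective_of_retract r hF.bijective⟩

lemma ses {U V W : C} {i : U ⟶ V} {p : V ⟶ W} (h : Ses i p) (hU : S.costdFiltered ε U) :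
    Ses (F.map i) (F.map p) := by
  have := HasExt.standard C
  exact hF.map_ses h (hS.extZero 0 hT.1.1 hU)

/-- `F` is fully faithful on objects with costandard flags. -/
theorem map_bijective {W : C} (hW : S.costdFiltered ε W) (X : C) :
    Function.Bijective (F.map : (W ⟶ X) → (F.obj W ⟶ F.obj X)) := by
  -- Two tilting covers give a presentation `V' ⟶ V ⟶ W ⟶ 0` which `F` keeps exact. Bijectivity on
  -- maps out of `V` and `V'` passes to the cokernel `W`.
  obtain ⟨K, V, k, p, h, hK, hV⟩ := hS.exists_tilting_cover hW
  obtain ⟨K', V', k', p', h', hK', hV'⟩ := hS.exists_tilting_cover hK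
  have s := hF.ses hS hT h hK
  have s' := hF.ses hS hT h' hK'
  have := h.epi
  have := h'.epi
  have := s.epi
  have := s'.epi
  constructor
  · intro f g hfg
    rw [← cancel_epi p]
    exact ((hF.tilting_obj hS hT hV).2 X).1 (by rw [F.map_comp, F.map_comp, hfg])
  · intro f
    obtain ⟨g, hg⟩ := ((hF.tilting_obj hS hT hV).2 X).2 (F.map p ≫ f)
    have : p' ≫ k ≫ g = 0 := ((hF.tilting_obj hS hT hV').2 X).1 (by
      rw [F.map_comp, F.map_comp, hg, reassoc_of% s.w]
      simp)
    obtain ⟨t, ht⟩ := h.desc g (by rw [← cancel_epi p', this, comp_zero])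
    exact ⟨t, by rw [← cancel_epi (F.map p), ← F.map_comp, ht, hg]⟩

lemma map_ne_zero {W X : C} (hW : S.costdFiltered ε W) {f : W ⟶ X} (hf : f ≠ 0) :
    F.map f ≠ 0 := fun h0 => hf ((hF.map_bijective hS hT hW X).1 (by
      rw [h0, F.map_zero]))

/-- Idempotents of `F W` come from idempotents of `W`, and a local endomorphism ring has only the
trivial ones. -/
lemma map_indecomposable {W : C} (hW : S.costdFiltered ε W) (hi : Indecomposable W) :
    Indecomposable (F.obj W) := by
  refine indecomposable_of_idempotents (fun h0 => ?_) fun e he => ?_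
  · refine hF.map_ne_zero hS hT hW (f := 𝟙 W) (fun h => hi.1 ?_) (h0.eq_of_src _ _)
    rwa [IsZero.iff_id_eq_zero]
  · obtain ⟨e, rfl⟩ := (hF.map_bijective hS hT hW W).2 e
    have he' : e ≫ e = e := (hF.map_bijective hS hT hW W).1 (by
      rw [F.map_comp, he])
    rcases isIso_or_isIso_id_sub hi e with h | h
    · right
      have : e = 𝟙 W := by rw [← cancel_epi e, he', Category.comp_id]
      rw [this, F.map_id]
    · left
      have : e = 0 := by
        have : (𝟙 W - e) ≫ e = 0 := by simp [Preadditive.sub_comp, he']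
        exact (Preadditive.IsIso.comp_left_eq_zero _ _).1 this
      rw [this, F.map_zero]

lemma exists_iso_of_map_iso {U V : C} (hU : S.costdFiltered ε U) (hV : S.costdFiltered ε V)
    (e : F.obj U ≅ F.obj V) : Nonempty (U ≅ V) := by
  obtain ⟨f, hf⟩ := (hF.map_bijective hS hT hU V).2 e.hom
  obtain ⟨g, hg⟩ := (hF.map_bijective hS hT hV U).2 e.inv
  exact ⟨⟨f, g, (hF.map_bijective hS hT hU U).1 (by
    rw [F.map_comp, hf, hg, e.hom_inv_id, F.map_id]),
    (hF.map_bijective hS hT hV V).1 (by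
      rw [F.map_comp, hf, hg, e.inv_hom_id, F.map_id])⟩⟩

variable [HasLength D]

/-- The stratification on the target of a Ringel duality functor: the simple object labelled by
`b` is the head of the projective object `F T(b)`. -/
theorem exists_stratification : ∃ S' : Stratification D B Λᵒᵈ,
    (∀ b, S'.ρ b = OrderDual.toDual (S.ρ b)) ∧
    ∀ b U, S.IsIndecTilting ε b U → ProjectiveCoverOf (S'.L b) (F.obj U) := by
  choose U hU using fun b => (hT.2 b).imp fun _ h => h.1
  have hloc : ∀ b, ∃ (L : D) (π : F.obj (U b) ⟶ L), IsProjectiveCover π ∧ Simple L := by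
    intro b
    have hi := hF.map_indecomposable hS hT (hU b).isTilting.2 (hU b).1
    obtain ⟨L, π, hL, hπ⟩ := exists_simple_quotient _ hi.1
    have hP := (hF.tilting_obj hS hT (hU b).isTilting).1
    refine ⟨L, π, (isLocal_of_indecomposable_projective hP hi hL fun h0 => ?_).isProjectiveCover hP,
      hL⟩
    exact Simple.not_isZero L (by rw [IsZero.iff_id_eq_zero, ← cancel_epi π, h0]; simp)
  choose L π hπ hL using hloc
  refine ⟨⟨L, hL, fun b c ⟨e⟩ => ?_, fun X hX => ?_, fun b => OrderDual.toDual (S.ρ b)⟩,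
    fun _ => rfl, fun b V hV => ?_⟩
  -- Isomorphic heads have isomorphic projective covers, which come from isomorphic tilting objects,
  -- and these determine the label.
  · obtain ⟨φ, -⟩ := (hπ b).exists_iso (hπ c) e
    obtain ⟨φ'⟩ := hF.exists_iso_of_map_iso hS hT (hU b).isTilting.2 (hU c).isTilting.2 φ
    exact hS.indecTilting_label (hU b) ((hU c).iso φ'.symm)
  -- The generator `F T` is a sum of objects `F T(b)`, so one of these maps nontrivially to `X`,
  -- which is then its head.
  · have : ∃ b, ∃ f : F.obj (U b) ⟶ X, f ≠ 0 := by
      by_contra! hc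
      obtain ⟨f, hf⟩ := hF.generator X (Simple.not_isZero X)
      refine hf ?_
      refine hS.tilting_induction (motive := fun V => ∀ f : F.obj V ⟶ X, f = 0)
        (fun b => (hT.2 b).imp fun _ h => h.1)
        (fun X hX f => (F.map_isZero hX).eq_of_src _ _) (fun X Y Z e hX hY f => ?_)
        (fun b V hV f => ?_) hT.1 f
      · rw [← cancel_epi (F.map e.inv), comp_zero]
        exact hom_eq_zero_of_map_biprod (hX _) (hY _)
      · obtain ⟨e⟩ := hS.indecTilting_iso (hU b) hV
        rw [← cancel_epi (F.mapIso e).hom, comp_zero]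
        exact hc b _
    obtain ⟨b, f, hf⟩ := this
    obtain ⟨e, -⟩ := ((hπ b).isLocal (hL b)).to_simple hX hf
    exact ⟨b, ⟨e.symm⟩⟩
  · obtain ⟨e⟩ := hS.indecTilting_iso hV (hU b)
    have hP := (hF.tilting_obj hS hT hV.isTilting).1
    exact ⟨_, (((hπ b).isLocal (hL b)).iso_comp (F.mapIso e)).isProjectiveCover hP⟩

end IsRingelFunctor

end RingelFunctor

/-! ### Largest quotients -/

section General

variable {C : Type u} [Category.{v} C] [Abelian C] {B : Type w} {Λ : Type w'} [PartialOrder Λ]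

/-- Take an admissible quotient of maximal length. The image of `P` in its sum with another
admissible quotient is again admissible, so by maximality it projects isomorphically to the first.
-/
lemma Stratification.exists_largest_quotient [HasLength C] (S : Stratification C B Λ) (Γ : Set Λ)
    (P : C) : ∃ (V : C) (q : P ⟶ V), Epi q ∧ S.supp Γ V ∧
      ∀ ⦃W : C⦄ (f : P ⟶ W), Epi f → S.supp Γ W → ∃ g : V ⟶ W, q ≫ g = f := by
  classical
  let A : Set ℕ := {n | ∃ (V : C) (q : P ⟶ V), Epi q ∧ S.supp Γ V ∧ HasLength.len V = n}
  have hA : A.Nonempty :=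
    ⟨_, _, 0, (Ses.isZero_right P (isZero_zero C)).epi, supp_of_isZero (isZero_zero C), rfl⟩
  have hb : BddAbove A := by
    refine ⟨HasLength.len P, ?_⟩
    rintro n ⟨V, q, hq, -, rfl⟩
    exact len_le_of_epi q
  obtain ⟨V, q, hq, hV, hlen⟩ := Nat.sSup_mem hA hb
  refine ⟨V, q, hq, hV, fun W f hf hW => ?_⟩
  obtain ⟨I, p, i, hp, hi, hpi⟩ := Ses.image_factor (biprod.lift q f)
  have hI : S.supp Γ I := supp_of_mono (supp_biprod hV hW) i
  have h1 : p ≫ i ≫ biprod.fst = q := by rw [reassoc_of% hpi, biprod.lift_fst]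
  have h2 : p ≫ i ≫ biprod.snd = f := by rw [reassoc_of% hpi, biprod.lift_snd]
  have : Epi (p ≫ i ≫ biprod.fst) := by rw [h1]; exact hq
  have := epi_of_epi p (i ≫ biprod.fst)
  have : IsIso (i ≫ biprod.fst) := isIso_of_epi_of_len _ (by
    rw [hlen]
    exact le_csSup hb ⟨I, p, hp, hI, rfl⟩)
  refine ⟨inv (i ≫ biprod.fst) ≫ i ≫ biprod.snd, ?_⟩
  rw [← h1, Category.assoc, IsIso.hom_inv_id_assoc, h2]

end General

open Stratification

/-! ### The Ringel dual stratification -/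

section RingelDual

variable {C : Type u} [Category.{v} C] [Abelian C] {B : Type w} {Λ : Type w'} [PartialOrder Λ]
  {D : Type u'} [Category.{v'} D] [Abelian D]

/-- The stratification `S'` of `D` is Ringel dual to `S` via the functor `F`: the simple object
labelled by `b` is the head of `F T(b)`. -/
structure IsRingelDual (S : Stratification C B Λ) (ε : Λ → ℤˣ) (T : C) (F : C ⥤ D)
    (S' : Stratification D B Λᵒᵈ) : Prop where
  setup : S.Setup ε
  tilting : S.IsTiltingGenerator ε T
  functor : IsRingelFunctor T F
  ρ_eq : ∀ b, S'.ρ b = OrderDual.toDual (S.ρ b)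
  cover : ∀ b U, S.IsIndecTilting ε b U → ProjectiveCoverOf (S'.L b) (F.obj U)

lemma negSign_toDual {Λ : Type w'} (ε : Λ → ℤˣ) (x : Λ) :
    negSign ε (OrderDual.toDual x) = -ε x := rfl

variable {S : Stratification C B Λ} {ε : Λ → ℤˣ}

/-- This sequence becomes a projective presentation under `F`. The bound on labels holds because the
factors of `T(b)` have labels at most `ρ b`; in the opposite poset it is the bound required of
projective flags. -/
lemma Stratification.Setup.exists_cover_to_costd [HasLength C] (hS : S.Setup ε) {b : B} {U V : C}
    (hU : S.IsIndecTilting ε b U) (hV : S.IsEpsCostandard ε b V) :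
    ∃ (K : C) (i : K ⟶ U) (p : U ⟶ V) (l : List B), Ses i p ∧ Flag (S.IsEpsCostandard ε) l K ∧
      ∀ c ∈ l, S.ρ c ≤ S.ρ b := by
  obtain ⟨K, X, i, p, l, hs, hX, hl⟩ := hU.exists_top
  obtain ⟨e⟩ := hX.exists_iso hV
  refine ⟨K, i, p ≫ e.hom, l, hs.comp_iso e, hl, fun c hc => ?_⟩
  obtain ⟨V, hV⟩ := hS.std c
  obtain ⟨f, hf⟩ := hS.exists_hom_of_mem_costd_flag hl hc hV
  have := hs.mono
  exact hS.indecTilting_supp hU c (hV.isCompositionFactor (f := f ≫ i) fun h0 =>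
    hf (zero_of_comp_mono i h0))

variable {T : C} {F : C ⥤ D} {S' : Stratification D B Λᵒᵈ} (h : IsRingelDual S ε T F S')

namespace IsRingelDual

include h

lemma isCompositionFactor_iff {b : B} {U : C} (hU : S.IsIndecTilting ε b U) (X : D) :
    IsCompositionFactor (S'.L b) X ↔ ∃ f : F.obj U ⟶ X, f ≠ 0 := by
  obtain ⟨π, hπ⟩ := h.cover b U hU
  exact hπ.isCompositionFactor_iff (S'.simple b) X

lemma exists_indecTilting (b : B) : ∃ U, S.IsIndecTilting ε b U :=
  (h.tilting.2 b).imp fun _ hU => hU.1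

lemma isHead {b : B} {U : C} (hU : S.IsIndecTilting ε b U) : IsHead (F.obj U) (S'.L b) := by
  obtain ⟨π, hπ⟩ := h.cover b U hU
  exact (hπ.isLocal (S'.simple b)).isHead

variable [F.Additive] [HasLength C]

lemma exists_map_eq {b : B} {U V : C} (hU : S.IsIndecTilting ε b U) (f : F.obj U ⟶ F.obj V) :
    ∃ g, F.map g = f :=
  (h.functor.map_bijective h.setup h.tilting hU.isTilting.2 V).2 f

/-- The order is reversed here: such a factor amounts to a nonzero map `T(c) ⟶ ∇_ε(b)`, so `L b` is
a factor of `T(c)`. -/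
lemma le_of_isCompositionFactor {b c : B} {V : C} (hV : S.IsEpsCostandard ε b V)
    (hc : IsCompositionFactor (S'.L c) (F.obj V)) : S.ρ b ≤ S.ρ c := by
  obtain ⟨U, hU⟩ := h.exists_indecTilting c
  obtain ⟨f, hf⟩ := (h.isCompositionFactor_iff hU _).1 hc
  obtain ⟨f, rfl⟩ := h.exists_map_eq hU f
  refine h.setup.indecTilting_supp hU b (hV.isCompositionFactor (f := f) ?_)
  rintro rfl
  exact hf (F.map_zero _ _)

lemma map_supp {b : B} {V : C} (hV : S.IsEpsCostandard ε b V) :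
    S'.supp (Set.Iic (S'.ρ b)) (F.obj V) := fun c hc => by
  rw [Set.mem_Iic, h.ρ_eq, h.ρ_eq]
  exact h.le_of_isCompositionFactor hV hc

/-- A nonzero morphism from the image of a costandard object detects a composition factor. -/
lemma isCompositionFactor_of_ne_zero {c : B} {N : C} (hN : S.IsEpsCostandard ε c N) {X : D}
    {f : F.obj N ⟶ X} (hf : f ≠ 0) : IsCompositionFactor (S'.L c) X := by
  obtain ⟨U, hU⟩ := h.exists_indecTilting c
  obtain ⟨K, i, p, l, hs, hl, -⟩ := h.setup.exists_cover_to_costd hU hN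
  have := (h.functor.ses h.setup h.tilting hs ⟨l, hl⟩).epi
  refine (h.isCompositionFactor_iff hU X).2 ⟨F.map p ≫ f, fun h0 => hf ?_⟩
  rw [← cancel_epi (F.map p), h0, comp_zero]

lemma map_flag {D' : B → D → Prop} (hD : ∀ c N, S.IsEpsCostandard ε c N → D' c (F.obj N))
    {l : List B} {W : C} (hW : Flag (S.IsEpsCostandard ε) l W) : Flag D' l (F.obj W) := by
  induction l generalizing W with
  | nil => exact Flag.zero (F.map_isZero hW.isZero)
  | cons b l ih =>
    obtain ⟨U, X, i, p, hs, hU, hX⟩ := hW.exists_ses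
    exact Flag.cons_of_ses (h.functor.ses h.setup h.tilting hs ⟨l, hU⟩) (ih hU) (hD b X hX)

lemma hom_eq_zero_of_map_flag {l : List B} {K : C} (hK : Flag (S.IsEpsCostandard ε) l K) {X : D}
    (hX : ∀ c ∈ l, ¬ IsCompositionFactor (S'.L c) X) (f : F.obj K ⟶ X) : f = 0 := by
  refine hom_eq_zero_of_flag (h.map_flag
    (D' := fun c Y => ∀ Z (f : Y ⟶ Z), f ≠ 0 → IsCompositionFactor (S'.L c) Z)
    (fun c N hN Z f hf => h.isCompositionFactor_of_ne_zero hN hf) hK) (fun c hc Y hY g => ?_) f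
  by_contra hg
  exact hX c hc (hY _ g hg)

/-- For `ε = -` the sections of the kernel of `T(b) ⟶ ∇(b)` have labels strictly below `ρ b`, that
is, above it in the opposite poset. The image of this kernel under `F` hence maps to zero in every
quotient admissible for the new standard object. -/
lemma isStandard_map {b : B} {V : C} (hV : S.IsEpsCostandard ε b V) (he : ε (S.ρ b) = -1) :
    S'.IsStandard b (F.obj V) := by
  obtain ⟨U, hU⟩ := h.exists_indecTilting b
  obtain ⟨K, i, p, l, hs, hl, hle⟩ := h.setup.exists_cover_to_costd hU hV
  have hs' := h.functor.ses h.setup h.tilting hs ⟨l, hl⟩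
  -- A section not below `b` gives a map `Δ_ε(c) ⟶ T(b)` killed by `p`. It forces `c = b` and is
  -- essentially unique, but a lift of the canonical map `Δ_ε(b) ⟶ ∇_ε(b)` is not killed by `p`.
  have hlt : ∀ c ∈ l, S.ρ c < S.ρ b := by
    intro c hc
    by_contra hcb
    obtain ⟨X, hX⟩ := h.setup.std c
    obtain ⟨f, hf⟩ := h.setup.exists_hom_of_mem_costd_flag hl hc hX
    obtain ⟨Y, hY⟩ := h.setup.std b
    obtain ⟨g, hg⟩ := exists_hom_std_costd hY hV
    have := HasExt.standard C
    obtain ⟨g', hg'⟩ := ExtZero.lift hs (h.setup.extZero 0 ⟨_, Flag.single hY⟩ ⟨l, hl⟩) g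
    have := hs.mono
    have hfi : f ≫ i ≠ 0 := fun h0 => hf (zero_of_comp_mono i h0)
    obtain rfl := (h.setup.indecTilting_hom_to hU he hX hcb hfi hfi).1
    obtain ⟨e⟩ := hX.exists_iso hY
    have he0 : e.hom ≫ g' ≠ 0 := by
      intro h0
      refine hg ?_
      rw [← cancel_epi e.hom, ← hg', reassoc_of% h0, zero_comp, comp_zero]
    have := (h.setup.indecTilting_hom_to hU he hX hcb hfi he0).2 p (by
      rw [Category.assoc, hs.w, comp_zero])
    rw [Category.assoc, hg'] at this
    refine hg ?_
    rw [← cancel_epi e.hom, this, comp_zero]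
  refine ⟨F.obj U, F.map p, h.cover b U hU, hs'.epi, h.map_supp hV, fun W f hf hW => ?_⟩
  refine hs'.desc f (h.hom_eq_zero_of_map_flag hl (fun c hc hcW => ?_) _)
  have := hW c hcW
  rw [h.ρ_eq, h.ρ_eq] at this
  exact (hlt c hc).not_ge this

lemma exists_head {b : B} {U V : C} (hU : S.IsIndecTilting ε b U) (hV : S.IsEpsCostandard ε b V)
    {p : U ⟶ V} (hp : Epi (F.map p)) :
    ∃ h' : F.obj V ⟶ S'.L b, IsLocal (F.map p ≫ h') ∧ IsLocal h' := by
  obtain ⟨π, hπ⟩ := h.cover b U hU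
  have hπl := hπ.isLocal (S'.simple b)
  obtain ⟨h', e, hl⟩ := hπl.factor hp fun h0 =>
    h.functor.map_ne_zero h.setup h.tilting (W := V) ⟨_, Flag.single hV⟩ (f := 𝟙 V)
      (fun h1 => hV.not_isZero (by rwa [IsZero.iff_id_eq_zero])) (by
        rw [← cancel_epi (F.map p), h0]; simp)
  exact ⟨h', e ▸ hπl, hl⟩

/-- A factor of the radical in the stratum of `b` would give a nonzero map `T(c) ⟶ ∇̄(b)`. Then `c =
b` and this map is `p` up to an automorphism, yet `F p` reaches the head and does not land in the
radical. -/
lemma topProper_map {b : B} {V : C} (hV : S.IsEpsCostandard ε b V) (he : ε (S.ρ b) = 1) {U : C}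
    (hU : S.IsIndecTilting ε b U) {p : U ⟶ V} (hp : Epi (F.map p)) {h' : F.obj V ⟶ S'.L b}
    (hl : IsLocal (F.map p ≫ h')) :
    S'.supp (Set.Iio (S'.ρ b)) (kernel h') := by
  intro c hc
  rw [Set.mem_Iio, h.ρ_eq, h.ρ_eq, OrderDual.toDual_lt_toDual]
  refine lt_of_le_of_ne (h.le_of_isCompositionFactor hV (hc.of_mono (kernel.ι h'))) fun heq => ?_
  have key : ∀ {c : B} {U' : C}, S.IsIndecTilting ε c U' → ∀ y : F.obj U' ⟶ kernel h', y ≠ 0 →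
      ∃ f : U' ⟶ V, f ≠ 0 ∧ F.map f = y ≫ kernel.ι h' := by
    intro c U' hU' y hy
    obtain ⟨f, hf⟩ := h.exists_map_eq hU' (y ≫ kernel.ι h')
    refine ⟨f, ?_, hf⟩
    rintro rfl
    rw [F.map_zero] at hf
    exact hy (zero_of_comp_mono _ hf.symm)
  obtain ⟨U', hU'⟩ := h.exists_indecTilting c
  obtain ⟨y, hy⟩ := (h.isCompositionFactor_iff hU' _).1 hc
  obtain ⟨f, hf, -⟩ := key hU' y hy
  have hcb : c = b := (h.setup.indecTilting_hom hU' (by rw [← heq]; exact he) hV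
    (by rw [heq]; exact lt_irrefl _) hf hf).1
  subst hcb
  obtain ⟨y, hy⟩ := (h.isCompositionFactor_iff hU _).1 hc
  obtain ⟨f, hf, hfy⟩ := key hU y hy
  have hp0 : p ≠ 0 := by
    rintro rfl
    rw [F.map_zero, zero_comp] at hl
    exact hl.ne_zero rfl
  obtain ⟨-, s, hs⟩ := h.setup.indecTilting_hom hU he hV (lt_irrefl _) hp0 hf
  have h0 : F.map f ≫ h' = 0 := by rw [hfy, Category.assoc, kernel.condition, comp_zero]
  rw [hs, F.map_comp, Category.assoc] at h0
  exact hl.ne_zero ((Preadditive.IsIso.comp_left_eq_zero (F.map (s.hom.app U)) _).1 h0)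

variable [HasLength D]

/-- For `ε = +` the kernel of `T(b) ⟶ ∇̄(b)` may have sections in the stratum of `b`. These die only
in quotients whose radical lies strictly below in the opposite poset, which is the condition for the
proper standard object. -/
lemma isProperStandard_map {b : B} {V : C} (hV : S.IsEpsCostandard ε b V) (he : ε (S.ρ b) = 1) :
    S'.IsProperStandard b (F.obj V) := by
  obtain ⟨U, hU⟩ := h.exists_indecTilting b
  obtain ⟨K, i, p, l, hs, hl, hle⟩ := h.setup.exists_cover_to_costd hU hV
  have hs' := h.functor.ses h.setup h.tilting hs ⟨l, hl⟩
  have hp := hs'.epi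
  obtain ⟨h', hl', hh'⟩ := h.exists_head hU hV hp
  -- The standard object of the dual is not the `F`-image of `V` here, so it is constructed as a
  -- largest quotient.
  obtain ⟨E, q, hq, hE, huniv⟩ := S'.exists_largest_quotient (Set.Iic (S'.ρ b)) (F.obj U)
  obtain ⟨g, hg⟩ := huniv (F.map p) hp (h.map_supp hV)
  have hge : Epi g := by
    have : Epi (q ≫ g) := by rw [hg]; exact hp
    exact epi_of_epi q g
  refine ⟨E, g, ⟨F.obj U, q, h.cover b U hU, hq, hE, huniv⟩, hge,
    ⟨h', hh'.epi, h.topProper_map hV he hU hp hl'⟩, fun W f hf hW => ?_⟩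
  obtain ⟨N, n, t, hn, hN⟩ := S'.topProper_iff.1 hW
  have ht := hn.epi
  have h1 : q ≫ f ≫ t ≠ 0 := by
    intro h0
    have : t = 0 := by rw [← cancel_epi f, ← cancel_epi q, h0]; simp
    exact not_isZero_L S' b (by rw [IsZero.iff_id_eq_zero, ← cancel_epi t, this]; simp)
  obtain ⟨e, he'⟩ := hl'.to_simple (S'.simple b) h1
  obtain ⟨y, hy⟩ := hn.lift (F.map i ≫ q ≫ f) (by
    rw [Category.assoc, Category.assoc, ← he', Category.assoc, reassoc_of% hs'.w, zero_comp])
  have hy0 : y = 0 := h.hom_eq_zero_of_map_flag hl (fun c hc hcN => by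
    have := hN c hcN
    rw [Set.mem_Iio, h.ρ_eq, h.ρ_eq, OrderDual.toDual_lt_toDual] at this
    exact this.not_ge (hle c hc)) y
  rw [hy0, zero_comp] at hy
  obtain ⟨g', hg'⟩ := hs'.desc (q ≫ f) hy.symm
  exact ⟨g', by rw [← cancel_epi q, reassoc_of% hg, hg']⟩

/-- The functor `F` maps `∇_ε(b)` to `Δ_{-ε}(b)`. -/
theorem isEpsStandard_map {b : B} {V : C} (hV : S.IsEpsCostandard ε b V) :
    S'.IsEpsStandard (negSign ε) b (F.obj V) := by
  rw [IsEpsStandard, h.ρ_eq, negSign_toDual]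
  exact ⟨fun he => h.isStandard_map hV (by rw [← he, neg_neg]),
    fun he => h.isProperStandard_map hV (by rwa [neg_inj] at he)⟩

lemma map_stdFlag {l : List B} {W : C} (hW : Flag (S.IsEpsCostandard ε) l W) :
    Flag (S'.IsEpsStandard (negSign ε)) l (F.obj W) :=
  h.map_flag (fun _ _ hN => h.isEpsStandard_map hN) hW

theorem hasProjectiveFlags : S'.HasProjectiveFlags (negSign ε) := by
  intro b
  obtain ⟨U, hU⟩ := h.exists_indecTilting b
  obtain ⟨V, hV⟩ := h.setup.costd b
  obtain ⟨K, i, p, l, hs, hl, hle⟩ := h.setup.exists_cover_to_costd hU hV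
  refine ⟨F.obj U, l, (h.functor.tilting_obj h.setup h.tilting hU.isTilting).1,
    h.map_stdFlag (Flag.cons_of_ses hs hl hV), fun c hc => ?_⟩
  rw [h.ρ_eq, h.ρ_eq]
  exact hle c hc

/-- Extensions are lifted one section at a time. A tilting cover `V` of `N` has projective image, so
an extension of `F N` by `F W` is a pushout along a map `F K ⟶ F W`. By fullness this is `F f`, and
the pushout along `f` is the required preimage. -/
theorem exists_preimage {l : List B} {X : D} (hX : Flag (S'.IsEpsStandard (negSign ε)) l X) :
    ∃ W, S.costdFiltered ε W ∧ Nonempty (F.obj W ≅ X) := by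
  induction l generalizing X with
  | nil =>
    exact ⟨_, ⟨[], Flag.zero (isZero_zero C)⟩, ⟨(F.map_isZero (isZero_zero C)).iso hX.isZero⟩⟩
  | cons b l ih =>
    obtain ⟨Y, Z, a, c, hs, hY, hZ⟩ := hX.exists_ses
    obtain ⟨W, hW, ⟨e⟩⟩ := ih hY
    obtain ⟨N, hN⟩ := h.setup.costd b
    obtain ⟨e'⟩ := hZ.exists_iso (h.isEpsStandard_map hN)
    have hs1 := (hs.comp_iso e').iso_comp e
    have hNf : S.costdFiltered ε N := ⟨_, Flag.single hN⟩
    obtain ⟨K, V, k, p, hk, hK, hV⟩ := h.setup.exists_tilting_cover hNf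
    have hk' := h.functor.ses h.setup h.tilting hk hK
    have := (h.functor.tilting_obj h.setup h.tilting hV).1
    have := hs1.epi
    let x := Projective.factorThru (F.map p) (c ≫ e'.hom)
    have hx : x ≫ c ≫ e'.hom = F.map p := Projective.factorThru_comp _ _
    obtain ⟨t, ht⟩ := hs1.lift (F.map k ≫ x) (by rw [Category.assoc, hx, hk'.w])
    obtain ⟨f, rfl⟩ := (h.functor.map_bijective h.setup h.tilting hK W).2 t
    obtain ⟨E, a', b', g, hs2, h1, h2, -⟩ := hk.pushout f
    refine ⟨E, costdFiltered_of_ses hs2 hW hNf, ?_⟩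
    refine hk'.pushout_iso (h.functor.ses h.setup h.tilting hs2 hW) hs1 (F.map f) (x := F.map g)
      (x' := x) ?_ ?_ ht.symm hx
    · rw [← F.map_comp, h2, F.map_comp]
    · rw [← F.map_comp, h1]

theorem restrictsToEquivalence : RestrictsToEquivalence F (S.costdFiltered ε)
    (S'.stdFiltered (negSign ε)) := by
  refine ⟨fun X ⟨l, hl⟩ => ⟨l, h.map_stdFlag hl⟩, ?_⟩
  exact
    { faithful := ⟨fun {X Y f g} hfg => by
        apply ObjectProperty.hom_ext
        exact (h.functor.map_bijective h.setup h.tilting X.property Y.obj).1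
          (congrArg (fun f => f.hom) hfg)⟩
      full := ⟨fun {X Y} f => by
        obtain ⟨g, hg⟩ := (h.functor.map_bijective h.setup h.tilting X.property Y.obj).2 f.hom
        exact ⟨ObjectProperty.homMk g, ObjectProperty.hom_ext _ hg⟩⟩
      essSurj := ⟨fun Y => by
        obtain ⟨l, hl⟩ := Y.property
        obtain ⟨W, hW, ⟨e⟩⟩ := h.exists_preimage hl
        exact ⟨⟨W, hW⟩, ⟨ObjectProperty.isoMk _ e⟩⟩⟩ }

/-- The costandard flag of `I` has `∇_ε(b)` at the bottom, so its image supplies the standard half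
of the indecomposable tilting object labelled by `b`. -/
lemma map_injectiveHull {b : B} {I : C} (hI : InjectiveHullOf (S.L b) I) :
    Indecomposable (F.obj I) ∧
      ∃ l, Flag (S'.IsEpsStandard (negSign ε)) (l ++ [b]) (F.obj I) := by
  obtain ⟨l, hl, -⟩ := h.setup.injectiveHull_flag hI
  refine ⟨h.functor.map_indecomposable h.setup h.tilting ⟨_, hl⟩ ?_, l, h.map_stdFlag hl⟩
  obtain ⟨π, hπ⟩ := hI.op
  exact indecomposable_unop (hπ.isLocal (simple_op (S.simple b))).indecomposable

end IsRingelDual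

end RingelDual

/-! ### Comparison of extension groups -/

/-- This carries an isomorphism in degree `n` to degree `n + 1`, where extension groups are
quotients of those in degree `n`. -/
lemma exists_linearEquiv_of_surjective {k : Type w} [Ring k] {M N M' N' : Type*} [AddCommGroup M]
    [AddCommGroup N] [AddCommGroup M'] [AddCommGroup N'] [Module k M] [Module k N] [Module k M']
    [Module k N'] (d : M →ₗ[k] N) (d' : M' →ₗ[k] N') (hd : Function.Surjective d)
    (hd' : Function.Surjective d') (φ : M ≃ₗ[k] M') (h : ∀ m, d m = 0 ↔ d' (φ m) = 0) :
    ∃ ψ : N ≃ₗ[k] N', ∀ m, ψ (d m) = d' (φ m) := by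
  have hk : (LinearMap.ker d).map φ.toLinearMap = LinearMap.ker d' := by
    ext x
    constructor
    · rintro ⟨m, hm, rfl⟩
      exact (h m).1 hm
    · intro hx
      refine ⟨φ.symm x, (h _).2 ?_, φ.apply_symm_apply x⟩
      rw [φ.apply_symm_apply]
      exact hx
  refine ⟨(d.quotKerEquivOfSurjective hd).symm ≪≫ₗ Submodule.Quotient.equiv _ _ φ hk ≪≫ₗ
    d'.quotKerEquivOfSurjective hd', fun m => ?_⟩
  have : (d.quotKerEquivOfSurjective hd).symm (d m) = Submodule.Quotient.mk m := by
    rw [LinearEquiv.symm_apply_eq]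
    rfl
  simp only [LinearEquiv.trans_apply, this]
  rfl

/-! ### Products with classes of short exact sequences -/

section ExtClass

variable {C : Type u} [Category.{v} C] [Abelian C] [HasExt.{w} C] {A X Q A' X' Q' Y : C}
  {i : A ⟶ X} {p : X ⟶ Q} {i' : A' ⟶ X'} {p' : X' ⟶ Q'} {n : ℕ}

/-- The class of a short exact sequence. -/
def Ses.extClass (h : Ses i p) : Ext.{w} Q A 1 := h.shortExact.extClass

lemma Ses.exists_extClass_comp (h : Ses i p) (h1 : ExtZero.{w} (n + 1) X Y)
    (e : Ext.{w} Q Y (n + 1)) : ∃ α : Ext.{w} A Y n, h.extClass.comp α (add_comm 1 n) = e :=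
  Ext.contravariant_sequence_exact₃ h.shortExact Y e (h1 _) (add_comm 1 n)

lemma Ses.extClass_comp_eq_zero_iff (h : Ses i p) (α : Ext.{w} A Y n) :
    h.extClass.comp α (add_comm 1 n) = 0 ↔
      ∃ γ : Ext.{w} X Y n, (Ext.mk₀ i).comp γ (zero_add n) = α := by
  constructor
  · exact fun hα => Ext.contravariant_sequence_exact₁ h.shortExact Y α (add_comm 1 n) hα
  · rintro ⟨γ, rfl⟩
    exact h.shortExact.extClass_comp_assoc γ

lemma Ses.extClass_naturality (h : Ses i p) (h' : Ses i' p') (a : A ⟶ A') (x : X ⟶ X')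
    (q : Q ⟶ Q') (h1 : i ≫ x = a ≫ i') (h2 : p ≫ q = x ≫ p') :
    h.extClass.comp (Ext.mk₀ a) (add_zero 1) = (Ext.mk₀ q).comp h'.extClass (zero_add 1) :=
  ShortComplex.ShortExact.extClass_naturality h.shortExact h'.shortExact
    (ShortComplex.homMk a x q h1.symm h2.symm)

lemma Ses.exists_lift_of_extZero (h : Ses i p) (h' : Ses i' p') (h1 : ExtZero.{w} 1 X A')
    (q : Q ⟶ Q') : ∃ (a : A ⟶ A') (x : X ⟶ X'), i ≫ x = a ≫ i' ∧ p ≫ q = x ≫ p' := by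
  obtain ⟨x, hx⟩ := ExtZero.lift h' h1 (p ≫ q)
  obtain ⟨a, ha⟩ := h'.lift (i ≫ x) (by rw [Category.assoc, hx, reassoc_of% h.w, zero_comp])
  exact ⟨a, x, ha.symm, hx.symm⟩

end ExtClass

section Comparison

variable (k : Type w) [Field k] {C : Type u} [Category.{v} C] [Abelian C] [Linear k C]
  {D : Type u'} [Category.{v'} D] [Abelian D] [Linear k D]

universe t t'

/-- Conditions under which a functor induces isomorphisms of the extension groups between the
objects satisfying `P`: it is exact and fully faithful on these objects, and they have resolutions
by objects which are acyclic before and after applying the functor. -/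
structure ExtComparable [HasExt.{t} C] [HasExt.{t'} D] (F : C ⥤ D) (P : ObjectProperty C) :
    Prop where
  ses : ∀ ⦃U V W : C⦄ ⦃i : U ⟶ V⦄ ⦃p : V ⟶ W⦄, Ses i p → P U → P V → P W →
    Ses (F.map i) (F.map p)
  bijective : ∀ X Y, P X → P Y → Function.Bijective (F.map : (X ⟶ Y) → (F.obj X ⟶ F.obj Y))
  resolution : ∀ X, P X → ∃ (K V : C) (i : K ⟶ V) (p : V ⟶ X), Ses i p ∧ P K ∧ P V ∧
    ∀ n Y, P Y → ExtZero.{t} (n + 1) V Y ∧ ExtZero.{t'} (n + 1) (F.obj V) (F.obj Y)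

variable {F : C ⥤ D} {P : ObjectProperty C}

namespace ExtComparable

variable [HasExt.{t} C] [HasExt.{t'} D]

variable (F P) in
/-- A family of isomorphisms between the extension groups in degree `n`. -/
abbrev Family (n : ℕ) := ∀ X Y : C, P X → P Y →
  Ext.{t} X Y n ≃ₗ[k] Ext.{t'} (F.obj X) (F.obj Y) n

variable {k} in
/-- Naturality in the first variable. -/
def Natural {n : ℕ} (φ : Family k F P n) : Prop :=
  ∀ (X X' Y : C) (hX : P X) (hX' : P X') (hY : P Y) (f : X' ⟶ X) (α : Ext.{t} X Y n),
    φ X' Y hX' hY ((Ext.mk₀ f).comp α (zero_add n)) =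
      (Ext.mk₀ (F.map f)).comp (φ X Y hX hY α) (zero_add n)

variable {k} in
/-- Compatibility with multiplication by classes of short exact sequences. -/
def Linked (hF : ExtComparable F P) {n : ℕ} (φ : Family k F P n) (ψ : Family k F P (n + 1)) :
    Prop :=
  ∀ ⦃U V W : C⦄ ⦃i : U ⟶ V⦄ ⦃p : V ⟶ W⦄ (h : Ses i p) (hU : P U) (hV : P V) (hW : P W)
    (Y : C) (hY : P Y) (α : Ext.{t} U Y n),
    ψ W Y hW hY (h.extClass.comp α (add_comm 1 n)) =
      (hF.ses h hU hV hW).extClass.comp (φ U Y hU hY α) (add_comm 1 n)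

variable (hF : ExtComparable.{v, u, u', v', t, t'} F P)

include hF in
-- For a resolution `K ⟶ V ⟶ X` the group `Extⁿ⁺¹(X, Y)` is the cokernel of `Extⁿ(V, Y) ⟶ Extⁿ(K,
-- Y)`, on both sides of `F`; naturality in degree `n` matches the two maps.
lemma exists_family_succ {n : ℕ} {φ : Family k F P n} (hφ : Natural φ) :
    ∃ ψ : Family k F P (n + 1), Natural ψ ∧ hF.Linked φ ψ := by
  choose K V i p hs hK hV hz using hF.resolution
  have key : ∀ X Y (hX : P X) (hY : P Y), ∃ ψ : Ext.{t} X Y (n + 1) ≃ₗ[k]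
      Ext.{t'} (F.obj X) (F.obj Y) (n + 1), ∀ α : Ext.{t} (K X hX) Y n,
      ψ ((hs X hX).extClass.comp α (add_comm 1 n)) =
        (hF.ses (hs X hX) (hK X hX) (hV X hX) hX).extClass.comp (φ _ Y (hK X hX) hY α)
          (add_comm 1 n) := by
    intro X Y hX hY
    have hs' := hF.ses (hs X hX) (hK X hX) (hV X hX) hX
    refine exists_linearEquiv_of_surjective
      (Ext.bilinearCompOfLinear k X (K X hX) Y 1 n (n + 1) (add_comm 1 n) (hs X hX).extClass)
      (Ext.bilinearCompOfLinear k _ _ _ 1 n (n + 1) (add_comm 1 n) hs'.extClass)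
      ((hs X hX).exists_extClass_comp (hz X hX n Y hY).1)
      (hs'.exists_extClass_comp (hz X hX n Y hY).2) (φ _ Y (hK X hX) hY) fun α => ?_
    refine ((hs X hX).extClass_comp_eq_zero_iff α).trans
      (Iff.trans ?_ (hs'.extClass_comp_eq_zero_iff (φ _ Y (hK X hX) hY α)).symm)
    constructor
    · rintro ⟨γ, rfl⟩
      exact ⟨φ _ Y (hV X hX) hY γ, (hφ _ _ _ _ _ _ _ _).symm⟩
    · rintro ⟨γ, hγ⟩
      refine ⟨(φ _ Y (hV X hX) hY).symm γ, (φ _ Y (hK X hX) hY).injective ?_⟩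
      rw [hφ _ _ _ (hV X hX), LinearEquiv.apply_symm_apply, hγ]
  choose ψ hψ using key
  -- Independence of the chosen resolution: acyclicity of its middle term yields a map to any short
  -- exact sequence over `f`. The chosen sequences for `X'` give naturality, and `f = 𝟙 X` gives
  -- compatibility with arbitrary classes.
  have hlink : ∀ ⦃U V' X X' : C⦄ ⦃j : U ⟶ V'⦄ ⦃q : V' ⟶ X'⦄ (h : Ses j q) (hU : P U)
      (hV' : P V') (hX' : P X') (hX : P X) (f : X ⟶ X') (Y : C) (hY : P Y) (α : Ext.{t} U Y n),
      ψ X Y hX hY ((Ext.mk₀ f).comp (h.extClass.comp α (add_comm 1 n)) (zero_add _)) =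
        (Ext.mk₀ (F.map f)).comp ((hF.ses h hU hV' hX').extClass.comp (φ U Y hU hY α)
          (add_comm 1 n)) (zero_add _) := by
    intro U V' X X' j q h hU hV' hX' hX f Y hY α
    obtain ⟨a, x, h1, h2⟩ := (hs X hX).exists_lift_of_extZero h (hz X hX 0 U hU).1 f
    have e1 := (hs X hX).extClass_naturality h a x f h1 h2
    have e2 := (hF.ses (hs X hX) (hK X hX) (hV X hX) hX).extClass_naturality
      (hF.ses h hU hV' hX') (F.map a) (F.map x) (F.map f) (by
        rw [← F.map_comp, h1, F.map_comp]) (by rw [← F.map_comp, h2, F.map_comp])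
    rw [← Ext.comp_assoc _ _ _ (zero_add 1) (add_comm 1 n) (by omega), ← e1,
      ← Ext.comp_assoc _ _ _ (zero_add 1) (add_comm 1 n) (by omega), ← e2,
      Ext.comp_assoc_of_second_deg_zero, Ext.comp_assoc_of_second_deg_zero, hψ, hφ]
  refine ⟨ψ, fun X X' Y hX hX' hY f α => ?_, fun U V' X j q h hU hV' hX Y hY α => ?_⟩
  · obtain ⟨α, rfl⟩ := (hs X hX).exists_extClass_comp (hz X hX n Y hY).1 α
    rw [hlink (hs X hX) (hK X hX) (hV X hX) hX hX', hψ]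
  · have := hlink h hU hV' hX hX (𝟙 X) Y hY α
    rwa [Ext.mk₀_id_comp, F.map_id, Ext.mk₀_id_comp] at this

variable [F.Additive] [F.Linear k]

/-- The isomorphisms in degree `0`. -/
def family₀ : Family k F P 0 := fun X Y hX hY =>
  Ext.linearEquiv₀ ≪≫ₗ LinearEquiv.ofBijective (F.mapLinearMap k) (hF.bijective X Y hX hY) ≪≫ₗ
    Ext.linearEquiv₀.symm

lemma family₀_mk₀ {X Y : C} (hX : P X) (hY : P Y) (f : X ⟶ Y) :
    hF.family₀ k X Y hX hY (Ext.mk₀ f) = Ext.mk₀ (F.map f) := by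
  have : (Ext.linearEquiv₀ (R := k)) (Ext.mk₀ f) = f := Ext.homEquiv₀.apply_symm_apply f
  simp only [family₀, LinearEquiv.trans_apply, this]
  rfl

lemma natural_family₀ : Natural (hF.family₀ k) := by
  intro X X' Y hX hX' hY f α
  obtain ⟨g, rfl⟩ := (Ext.mk₀_bijective _ _).2 α
  rw [Ext.mk₀_comp_mk₀, family₀_mk₀, family₀_mk₀, Ext.mk₀_comp_mk₀, F.map_comp]

/-- The isomorphisms of the extension groups in all degrees. -/
def family : ∀ n, { φ : Family k F P n // Natural φ }
  | 0 => ⟨hF.family₀ k, hF.natural_family₀ k⟩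
  | n + 1 => ⟨(hF.exists_family_succ k (family n).2).choose,
      (hF.exists_family_succ k (family n).2).choose_spec.1⟩

lemma family_extClass_comp {n m : ℕ} (hm : 1 + n = m) ⦃U V W : C⦄ ⦃i : U ⟶ V⦄ ⦃p : V ⟶ W⦄
    (h : Ses i p) (hU : P U) (hV : P V) (hW : P W) (Y : C) (hY : P Y) (α : Ext.{t} U Y n) :
    (hF.family k m).1 W Y hW hY (h.extClass.comp α hm) =
      (hF.ses h hU hV hW).extClass.comp ((hF.family k n).1 U Y hU hY α) hm := by
  obtain rfl : m = n + 1 := by omega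
  exact (hF.exists_family_succ k (hF.family k n).2).choose_spec.2 h hU hV hW Y hY α

/-- Induction on the degree of the left factor, which is the class of a resolution times an element
of degree one less. Degree zero is naturality. -/
lemma family_comp (a b c : ℕ) (h : a + b = c) (X Y Z : C) (hX : P X) (hY : P Y) (hZ : P Z)
    (α : Ext.{t} X Y a) (β : Ext.{t} Y Z b) :
    (hF.family k c).1 X Z hX hZ (α.comp β h) =
      ((hF.family k a).1 X Y hX hY α).comp ((hF.family k b).1 Y Z hY hZ β) h := by
  induction a generalizing c X with
  | zero =>
    obtain rfl : b = c := by omega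
    obtain ⟨f, rfl⟩ := (Ext.mk₀_bijective _ _).2 α
    refine ((hF.family k b).2 Y X Z hY hX hZ f β).trans ?_
    congr 1
    exact (hF.family₀_mk₀ k hX hY f).symm
  | succ a ih =>
    subst h
    obtain ⟨K, V, i, p, hs, hK, hV, hz⟩ := hF.resolution X hX
    obtain ⟨α, rfl⟩ := hs.exists_extClass_comp (hz a Y hY).1 α
    have e1 : (hs.extClass.comp α (add_comm 1 a)).comp β rfl =
        hs.extClass.comp (α.comp β rfl) (by omega : 1 + (a + b) = a + 1 + b) :=
      Ext.comp_assoc _ _ _ _ _ (by omega)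
    rw [e1, hF.family_extClass_comp k _ hs hK hV hX Z hZ,
      hF.family_extClass_comp k _ hs hK hV hX Y hY, ih (a + b) rfl K hK α,
      Ext.comp_assoc _ _ _ (add_comm 1 a) rfl (by omega)]

end ExtComparable

variable (F P) in
theorem inducesExtIsos [F.Additive] [F.Linear k]
    (hF : letI : HasExt.{max u v} C := HasExt.standard C
    letI : HasExt.{max u' v'} D := HasExt.standard D
    ExtComparable.{v, u, u', v', max u v, max u' v'} F P) : InducesExtIsos k F P := by
  let : HasExt.{max u v} C := HasExt.standard C
  let : HasExt.{max u' v'} D := HasExt.standard D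
  have hE : ∀ E : ShortComplex C, E.ShortExact → P E.X₁ → P E.X₂ → P E.X₃ →
      (E.map F).ShortExact := fun E hE h₁ h₂ h₃ =>
    (hF.ses (Ses.of_shortExact hE) h₁ h₂ h₃).shortExact
  refine ⟨hE, fun X Y hX hY n => (hF.family k n).1 X Y hX hY,
    fun X Y hX hY f => hF.family₀_mk₀ k hX hY f, fun E hE h₁ h₂ h₃ => ?_,
    fun X Y Z hX hY hZ a b c h α β => hF.family_comp k a b c h X Y Z hX hY hZ α β⟩
  -- The class of `E` is its own product with the identity in degree zero.
  have := hF.family_extClass_comp k (add_zero 1) (Ses.of_shortExact hE) h₁ h₂ h₃ E.X₁ h₁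
    (Ext.mk₀ (𝟙 _))
  have h0 : (hF.family k 0).1 E.X₁ E.X₁ h₁ h₁ (Ext.mk₀ (𝟙 _)) = Ext.mk₀ (𝟙 _) :=
    (hF.family₀_mk₀ k h₁ h₁ (𝟙 _)).trans (by rw [F.map_id])
  rw [h0, Ext.comp_mk₀_id, Ext.comp_mk₀_id] at this
  exact this

end Comparison

/-! ### Pairs of Ringel duality functors -/

open Stratification

section ProjectiveInduction

variable {C : Type u} [Category.{v} C] [Abelian C] {B : Type w} {Λ : Type w'} [PartialOrder Λ]
  {S : Stratification C B Λ} {ε : Λ → ℤˣ}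

lemma Stratification.Setup.exists_projectiveCover (hS : S.Setup ε) (b : B) :
    ∃ P, ProjectiveCoverOf (S.L b) P := by
  obtain ⟨V, hV⟩ := hS.std b
  obtain ⟨P, q, h, hP, -⟩ := hV.exists_cover
  exact ⟨P, _, hP⟩

lemma Stratification.Setup.exists_injectiveHull (hS : S.Setup ε) (b : B) :
    ∃ I, InjectiveHullOf (S.L b) I := by
  obtain ⟨V, hV⟩ := hS.costd b
  exact hV.exists_hull

/-- Every projective object is a direct sum of projective covers of simple objects. -/
theorem Stratification.Setup.projective_induction [HasLength C] (hS : S.Setup ε)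
    {motive : C → Prop} (zero : ∀ X, IsZero X → motive X)
    (add : ∀ X Y Z : C, (Z ≅ X ⊞ Y) → motive X → motive Y → motive Z)
    (cover : ∀ b P, ProjectiveCoverOf (S.L b) P → motive P) {P : C} (hP : Projective P) :
    motive P := by
  induction P using len_induction with
  | h P ih =>
    by_cases h0 : IsZero P
    · exact zero P h0
    obtain ⟨L, π, hL, hπ⟩ := exists_simple_quotient P h0
    obtain ⟨b, ⟨e⟩⟩ := S.exists_iso L hL
    obtain ⟨Q, κ, hκ⟩ := hS.exists_projectiveCover b
    have := hκ.epi
    have := hκ.projective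
    have hf : Projective.factorThru (π ≫ e.hom) κ ≫ κ = π ≫ e.hom :=
      Projective.factorThru_comp _ _
    have : Epi (Projective.factorThru (π ≫ e.hom) κ) := hκ.essential _ (by
      rw [hf]
      infer_instance)
    obtain ⟨Z, ⟨i⟩⟩ := retract_summand (X := Q) (Y := P)
      ⟨Projective.factorThru (𝟙 Q) (Projective.factorThru (π ≫ e.hom) κ),
        Projective.factorThru (π ≫ e.hom) κ, Projective.factorThru_comp _ _⟩
    refine add Q Z P i (cover b Q ⟨κ, hκ⟩) (ih Z ?_ ?_)
    · rw [len_iso i, HasLength.len_add (Ses.biprod Q Z)]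
      have := len_pos ((hκ.isLocal (S.simple b)).not_isZero)
      omega
    · obtain ⟨r⟩ := retract_biprod_right Q Z
      exact projective_of_retract (r.trans (Retract.ofIso i.symm)) hP

end ProjectiveInduction

section Duality

variable {C : Type u} [Category.{v} C] [Abelian C] {B : Type w} {Λ : Type w'} [PartialOrder Λ]
  {D : Type u'} [Category.{v'} D] [Abelian D]

/-- The functors `F` and `G` exhibit the stratification `S'` as the Ringel dual of `S`. -/
structure IsRingelDuality (S : Stratification C B Λ) (ε : Λ → ℤˣ) (T : C) (F G : C ⥤ D)
    (S' : Stratification D B Λᵒᵈ) : Prop where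
  left : IsRingelDual S ε T F S'
  right : IsRingelDual S.op (-ε) (Opposite.op T) G.op S'.op
  iso : ∀ b I P, InjectiveHullOf (S.L b) I → ProjectiveCoverOf (S.L b) P →
    Nonempty (F.obj I ≅ G.obj P)
  schur : ∀ (b : B) (f : S'.L b ⟶ S'.L b), f ≠ 0 → ∃ s : 𝟭 D ≅ 𝟭 D, s.hom.app (S'.L b) = f

variable {S : Stratification C B Λ} {ε : Λ → ℤˣ} {T : C} {F G : C ⥤ D} [F.Additive] [G.Additive]
  {S' : Stratification D B Λᵒᵈ} [HasLength C]

universe t t'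

/-- Tilting covers are acyclic on both sides: before `F` by vanishing of `Ext` from standard to
costandard flags, after `F` because their images are projective. -/
theorem IsRingelDual.extComparable [HasExt.{t} C] [HasExt.{t'} D]
    (h : IsRingelDual S ε T F S') :
    ExtComparable.{v, u, u', v', t, t'} F (S.costdFiltered ε) where
  ses _ _ _ _ _ hs hU _ _ := h.functor.ses h.setup h.tilting hs hU
  bijective X Y hX _ := h.functor.map_bijective h.setup h.tilting hX Y
  resolution X hX := by
    obtain ⟨K, V, i, p, hs, hK, hV⟩ := h.setup.exists_tilting_cover hX
    have := (h.functor.tilting_obj h.setup h.tilting hV).1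
    exact ⟨K, V, i, p, hs, hK, hV.2, fun n Y hY => ⟨h.setup.extZero n hV.1 hY,
      ExtZero.of_projective _ _ n⟩⟩

namespace IsRingelDual

variable (h : IsRingelDual S.op (-ε) (Opposite.op T) G.op S'.op)

include h

lemma ses_unop {U V W : C} {i : U ⟶ V} {p : V ⟶ W} (hs : Ses i p) (hW : S.stdFiltered ε W) :
    Ses (G.map i) (G.map p) :=
  (h.functor.ses h.setup h.tilting hs.op (stdFiltered_op hW)).unop

lemma map_bijective_unop {X W : C} (hW : S.stdFiltered ε W) :
    Function.Bijective (G.map : (X ⟶ W) → (G.obj X ⟶ G.obj W)) := by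
  have hb := h.functor.map_bijective h.setup h.tilting (stdFiltered_op hW) (Opposite.op X)
  refine ⟨fun f g hfg => Quiver.Hom.op_inj (hb.1 (congrArg Quiver.Hom.op hfg)), fun f => ?_⟩
  obtain ⟨g, hg⟩ := hb.2 f.op
  exact ⟨g.unop, congrArg Quiver.Hom.unop hg⟩

variable [HasLength D]

lemma isEpsCostandard_map {b : B} {V : C} (hV : S.IsEpsStandard ε b V) :
    S'.IsEpsCostandard (negSign ε) b (G.obj V) :=
  IsEpsStandard.unop (h.isEpsStandard_map hV.op)

lemma map_costdFiltered {V : C} (hV : S.stdFiltered ε V) :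
    S'.costdFiltered (negSign ε) (G.obj V) := by
  obtain ⟨l, hl⟩ := stdFiltered_op hV
  exact stdFiltered_unop (V := Opposite.op (G.obj V)) ⟨l, h.map_stdFlag hl⟩

theorem restrictsToEquivalence_unop : RestrictsToEquivalence G (S.stdFiltered ε)
    (S'.costdFiltered (negSign ε)) := by
  refine ⟨fun X hX => h.map_costdFiltered hX, ?_⟩
  exact
    { faithful := ⟨fun {X Y f g} hfg => by
        apply ObjectProperty.hom_ext
        exact (h.map_bijective_unop (X := X.obj) Y.property).1
          (congrArg (fun f => f.hom) hfg)⟩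
      full := ⟨fun {X Y} f => by
        obtain ⟨g, hg⟩ := (h.map_bijective_unop (X := X.obj) Y.property).2 f.hom
        exact ⟨ObjectProperty.homMk g, ObjectProperty.hom_ext _ hg⟩⟩
      essSurj := ⟨fun Y => by
        obtain ⟨l, hl⟩ := costdFiltered_op Y.property
        obtain ⟨W, hW, ⟨e⟩⟩ := h.exists_preimage hl
        exact ⟨⟨W.unop, costdFiltered_unop hW⟩, ⟨ObjectProperty.isoMk _ e.unop.symm⟩⟩⟩ }

lemma map_projectiveCover {b : B} {P : C} (hP : ProjectiveCoverOf (S.L b) P) :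
    Indecomposable (G.obj P) ∧
      ∃ l, Flag (S'.IsEpsCostandard (negSign ε)) (b :: l) (G.obj P) := by
  obtain ⟨hi, l, hl⟩ := h.map_injectiveHull hP.op
  refine ⟨indecomposable_unop hi, l.reverse, ?_⟩
  have := hl.unop (D := S'.IsEpsCostandard (negSign ε)) fun _ _ hX => IsEpsStandard.unop hX
  rwa [List.reverse_append] at this

end IsRingelDual

namespace IsRingelDuality

variable [HasLength D] (h : IsRingelDuality S ε T F G S')

include h

theorem setup : S'.Setup (negSign ε) where
  finite := h.left.setup.finite
  schur := h.schur
  std b := by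
    obtain ⟨V, hV⟩ := h.left.setup.costd b
    exact ⟨_, h.left.isEpsStandard_map hV⟩
  costd b := by
    obtain ⟨V, hV⟩ := h.left.setup.std b
    exact ⟨_, h.right.isEpsCostandard_map hV⟩
  flags := h.left.hasProjectiveFlags

/-- `F I` carries the standard flag and `G P` the costandard one; the isomorphism between them lets
each object have both. -/
theorem isIndecTilting {b : B} {I P : C} (hI : InjectiveHullOf (S.L b) I)
    (hP : ProjectiveCoverOf (S.L b) P) : S'.IsIndecTilting (negSign ε) b (F.obj I) ∧
      S'.IsIndecTilting (negSign ε) b (G.obj P) ∧ Nonempty (F.obj I ≅ G.obj P) := by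
  obtain ⟨hi, l, hl⟩ := h.left.map_injectiveHull hI
  obtain ⟨hi', l', hl'⟩ := h.right.map_projectiveCover hP
  obtain ⟨e⟩ := h.iso b I P hI hP
  exact ⟨⟨hi, ⟨l, hl⟩, l', hl'.iso e.symm⟩, ⟨hi', ⟨l, hl.iso e⟩, l', hl'⟩, ⟨e⟩⟩

lemma map_projective_stdFiltered {P : C} (hP : Projective P) :
    S'.stdFiltered (negSign ε) (G.obj P) := by
  refine h.left.setup.projective_induction
    (motive := fun P => S'.stdFiltered (negSign ε) (G.obj P))
    (fun X hX => ⟨[], Flag.zero (G.map_isZero hX)⟩) (fun X Y Z e hX hY => ?_)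
    (fun b P hP => ?_) hP
  · have := preservesBinaryBiproducts_of_preservesBiproducts G
    obtain ⟨l, hl⟩ := stdFiltered_of_ses (Ses.biprod (G.obj X) (G.obj Y)) hX hY
    exact ⟨l, hl.iso (G.mapIso e ≪≫ G.mapBiprod X Y).symm⟩
  · obtain ⟨I, hI⟩ := h.left.setup.exists_injectiveHull b
    exact (h.isIndecTilting hI hP).2.1.isTilting.1

/-- Resolutions by projective objects `P` avoid any passage to the opposite category. They remain
acyclic because `G P` is a sum of the tilting objects `G P(b)` and so has a standard flag, while `G
Y` has a costandard one. -/
theorem extComparable_right [HasExt.{t} C] [HasExt.{t'} D] :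
    ExtComparable.{v, u, u', v', t, t'} G (S.stdFiltered ε) where
  ses _ _ _ _ _ hs _ _ hW := h.right.ses_unop hs hW
  bijective X Y _ hY := h.right.map_bijective_unop hY
  resolution X hX := by
    obtain ⟨P, π, hP, hπ⟩ := h.left.setup.exists_projective_epi X
    have hPf := h.left.setup.stdFiltered_of_projective P
    exact ⟨_, P, _, π, Ses.of_epi π, h.left.setup.stdFiltered_kernel (Ses.of_epi π) hPf hX, hPf,
      fun n Y hY => ⟨ExtZero.of_projective P Y n, h.setup.extZero n
        (h.map_projective_stdFiltered hP) (h.right.map_costdFiltered hY)⟩⟩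

end IsRingelDuality

end Duality

/-! ### Finite-dimensional modules -/

section FDModules

variable {k : Type v} [Field k] {A : Type v} [Ring A] [Algebra k A]

open scoped ModuleCat

namespace FDMod

instance (M : FDMod k A) : Module.Finite k M.obj := M.property

/-- A linear map, as a morphism of finite-dimensional modules. -/
abbrev ofLinearMap {M N : FDMod k A} (f : M.obj →ₗ[A] N.obj) : M ⟶ N :=
  ObjectProperty.homMk (ModuleCat.ofHom f)

lemma hom_ext {M N : FDMod k A} {f g : M ⟶ N} (h : ∀ x : M.obj, f.hom.hom x = g.hom.hom x) :
    f = g :=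
  ObjectProperty.hom_ext _ (ModuleCat.hom_ext (LinearMap.ext h))

lemma injective_of_mono {M N : FDMod k A} (f : M ⟶ N) [Mono f] : Function.Injective f.hom.hom := by
  rw [← LinearMap.ker_eq_bot]
  let i := ModuleCat.ofHom (LinearMap.ker f.hom.hom).subtype
  have : Mono i := (ModuleCat.mono_iff_injective _).2 (Submodule.injective_subtype _)
  let K : FDMod k A := ⟨_, (isFD k A).prop_of_mono i M.property⟩
  let j : K ⟶ M := ObjectProperty.homMk i
  have hj : j = 0 := zero_of_comp_mono f (hom_ext fun x => x.2)
  refine (Submodule.eq_bot_iff _).2 fun x hx => ?_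
  have : j.hom.hom ⟨x, hx⟩ = (0 : K ⟶ M).hom.hom ⟨x, hx⟩ := by rw [hj]
  exact this

lemma surjective_of_epi {M N : FDMod k A} (f : M ⟶ N) [Epi f] :
    Function.Surjective f.hom.hom := by
  rw [← LinearMap.range_eq_top]
  let p := ModuleCat.ofHom (LinearMap.range f.hom.hom).mkQ
  have : Epi p := (ModuleCat.epi_iff_surjective _).2 (Submodule.mkQ_surjective _)
  let Q : FDMod k A := ⟨_, (isFD k A).prop_of_epi p N.property⟩
  let q : N ⟶ Q := ObjectProperty.homMk p
  have hq : q = 0 := zero_of_epi_comp f (hom_ext fun x =>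
    (Submodule.Quotient.mk_eq_zero _).2 ⟨x, rfl⟩)
  refine eq_top_iff.2 fun x _ => ?_
  have : q.hom.hom x = (0 : N ⟶ Q).hom.hom x := by rw [hq]
  exact (Submodule.Quotient.mk_eq_zero _).1 this

lemma exists_ne_zero {M : FDMod k A} (hM : ¬ IsZero M) : ∃ x : M.obj, x ≠ 0 := by
  by_contra! h
  refine hM ((IsZero.iff_id_eq_zero _).2 (hom_ext fun x => ?_))
  exact h x

/-- A module which is free on one generator is a projective generator. -/
lemma projective_of_free {M : FDMod k A} (m : M.obj)
    (hM : ∀ (N : FDMod k A) (x : N.obj), ∃ f : M ⟶ N, f.hom.hom m = x)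
    (hM' : ∀ (N : FDMod k A) (f g : M ⟶ N), f.hom.hom m = g.hom.hom m → f = g) :
    Projective M ∧ ∀ N : FDMod k A, ¬ IsZero N → ∃ f : M ⟶ N, f ≠ 0 := by
  refine ⟨⟨fun {E X} f e he => ?_⟩, fun N hN => ?_⟩
  · obtain ⟨x, hx⟩ := surjective_of_epi e (f.hom.hom m)
    obtain ⟨g, hg⟩ := hM E x
    refine ⟨g, hM' _ _ _ ?_⟩
    rw [← hx, ← hg]
    rfl
  · obtain ⟨x, hx⟩ := exists_ne_zero hN
    obtain ⟨f, hf⟩ := hM N x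
    refine ⟨f, ?_⟩
    rintro rfl
    exact hx hf.symm

lemma isFD_of_generator [Module.Finite k A] {M : ModuleCat.{v} A} (m : M)
    (h : ∀ x : M, ∃ a : A, a • m = x) : isFD k A M :=
  Module.Finite.of_surjective ((LinearMap.toSpanSingleton A M m).restrictScalars k) h

/-- The regular module. -/
abbrev regular (k : Type v) [Field k] (A : Type v) [Ring A] [Algebra k A]
    (h : Module.Finite k A) : FDMod k A :=
  ⟨ModuleCat.of A A, isFD_of_generator (1 : A) fun x => ⟨x, mul_one x⟩⟩

lemma projective_regular (h : Module.Finite k A) :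
    Projective (regular k A h) ∧
      ∀ N : FDMod k A, ¬ IsZero N → ∃ f : regular k A h ⟶ N, f ≠ 0 := by
  refine projective_of_free (M := regular k A h) (1 : A) (fun N x => ?_) fun N f g hfg => ?_
  · exact ⟨ofLinearMap (LinearMap.toSpanSingleton A N.obj x), one_smul A x⟩
  · refine hom_ext fun x => ?_
    have hx : ∀ f : regular k A h ⟶ N, f.hom.hom x = (show A from x) • f.hom.hom (1 : A) :=
      fun f => by
        rw [← map_smul]
        exact congrArg _ (mul_one (show A from x)).symm
    rw [hx f, hx g, hfg]

end FDMod

end FDModules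

/-! ### Finite abelian categories -/

section FiniteAbelian

variable (k : Type v) [Field k]

instance (A : Type v) [Ring A] [Algebra k A] [h : Module.Finite k A] :
    IsFiniteAbelian k (FDMod k A) :=
  ⟨A, inferInstance, inferInstance, CategoryTheory.Equivalence.refl, h,
    inferInstanceAs (Functor.Additive (𝟭 _)), inferInstanceAs (Functor.Linear k (𝟭 _))⟩

variable (C : Type u) [Category.{v'} C] [Abelian C] [Linear k C] [IsFiniteAbelian k C]

include k in
lemma IsFiniteAbelian.exists_projective_generator :
    ∃ P : C, Projective P ∧ ∀ X : C, ¬ IsZero X → ∃ f : P ⟶ X, f ≠ 0 := by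
  obtain ⟨A, _, _, e, hA, _, _⟩ := IsFiniteAbelian.exists_equiv (k := k) (C := C)
  obtain ⟨h1, h2⟩ := FDMod.projective_regular hA
  refine ⟨e.inverse.obj (FDMod.regular k A hA), e.symm.toAdjunction.map_projective _ h1,
    fun X hX => ?_⟩
  obtain ⟨f, hf⟩ := h2 (e.functor.obj X) fun h0 => hX
    ((e.inverse.map_isZero h0).of_iso (e.unitIso.app X))
  refine ⟨(e.symm.toAdjunction.homEquiv _ _).symm f, fun h0 => hf ?_⟩
  rw [Equiv.symm_apply_eq] at h0
  rw [h0, Adjunction.homEquiv_unit]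
  change _ ≫ e.functor.map 0 = 0
  rw [e.functor.map_zero, comp_zero]

/-- The length function given by the dimension of morphisms from a projective generator. -/
@[reducible] def IsFiniteAbelian.hasLength : HasLength C where
  len X := Module.finrank k ((IsFiniteAbelian.exists_projective_generator k C).choose ⟶ X)
  len_eq_zero X := by
    have h := (IsFiniteAbelian.exists_projective_generator k C).choose_spec.2
    rw [Module.finrank_zero_iff]
    constructor
    · intro hs
      by_contra hX
      obtain ⟨f, hf⟩ := h X hX
      exact hf (hs.elim _ _)
    · exact fun hX => ⟨fun f g => hX.eq_of_tgt _ _⟩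
  len_add {A X Q i p} h := by
    have := (IsFiniteAbelian.exists_projective_generator k C).choose_spec.1
    generalize (IsFiniteAbelian.exists_projective_generator k C).choose = P at this
    have := h.mono
    have := h.epi
    have h1 := (Linear.rightComp k P p).finrank_range_add_finrank_ker
    have h2 : LinearMap.range (Linear.rightComp k P p) = ⊤ := eq_top_iff.2 fun f _ =>
      ⟨Projective.factorThru f p, Projective.factorThru_comp f p⟩
    have h3 : LinearMap.ker (Linear.rightComp k P p) =
        LinearMap.range (Linear.rightComp k P i) := by
      ext f
      constructor
      · intro hf
        obtain ⟨g, hg⟩ := h.lift f hf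
        exact ⟨g, hg⟩
      · rintro ⟨g, rfl⟩
        change (g ≫ i) ≫ p = 0
        rw [Category.assoc, h.w, comp_zero]
    have h4 : Function.Injective (Linear.rightComp k P i) := fun f g hfg =>
      (cancel_mono i).1 hfg
    rw [h2, h3, finrank_top, LinearMap.finrank_range_of_inj h4] at h1
    rw [← h1, add_comm]

/-- By Schur's lemma `f` is a nonzero scalar, and scalars act naturally on all objects. -/
lemma exists_natIso_of_simple [IsAlgClosed k] {X : C} (hX : Simple X) {f : X ⟶ X} (hf : f ≠ 0) :
    ∃ s : 𝟭 C ≅ 𝟭 C, s.hom.app X = f := by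
  obtain ⟨c, rfl⟩ := endomorphism_simple_eq_smul_id k f
  have hc : c ≠ 0 := by
    rintro rfl
    exact hf (zero_smul _ _)
  refine ⟨⟨⟨fun X => c • 𝟙 X, fun X Y f => ?_⟩, ⟨fun X => c⁻¹ • 𝟙 X, fun X Y f => ?_⟩, ?_, ?_⟩,
    rfl⟩
  · simp
  · simp
  · ext X
    simp [smul_smul, hc]
  · ext X
    simp [smul_smul, hc]

end FiniteAbelian

/-! ### The functors `Hom(T, -)` and `Hom(-, T)^*` -/

section Functors

variable (k : Type v) [Field k] {C : Type u} [Category.{v} C] [Abelian C] [Linear k C]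
  [IsFiniteAbelian k C] (T : C)

open scoped ModuleCat

instance : Module.Finite k (End T)ᵐᵒᵖ :=
  haveI : Module.Finite k (End T) := inferInstanceAs (Module.Finite k (T ⟶ T))
  Module.Finite.equiv (MulOpposite.opLinearEquiv k)

/-- `F T` is the regular module, free on `𝟙 T`. -/
lemma ringelF_exists_hom (N : RingelDual k T) (x : N.obj) :
    ∃ f : (ringelF k T).obj T ⟶ N, f.hom.hom (𝟙 T) = x := by
  refine ⟨FDMod.ofLinearMap
    { toFun := fun h => MulOpposite.op (show End T from h) • x
      map_add' := fun h h' => add_smul (MulOpposite.op (show End T from h)) (MulOpposite.op h') x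
      map_smul' := fun a h => ?_ }, one_smul _ x⟩
  exact mul_smul a (MulOpposite.op (show End T from h)) x

lemma ringelF_hom_ext (N : RingelDual k T) (f g : (ringelF k T).obj T ⟶ N)
    (h : f.hom.hom (𝟙 T) = g.hom.hom (𝟙 T)) : f = g := by
  refine FDMod.hom_ext fun x => ?_
  have hx : ∀ f : (ringelF k T).obj T ⟶ N,
      f.hom.hom x = MulOpposite.op (show End T from x) • f.hom.hom (𝟙 T) := fun f =>
    (congrArg f.hom.hom (Category.comp_id (show T ⟶ T from x)).symm).trans
      (f.hom.hom.map_smul (MulOpposite.op (show End T from x))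
        (show ((ringelF k T).obj T).obj from 𝟙 T))
  rw [hx f, hx g, h]

theorem isRingelFunctor_ringelF : IsRingelFunctor T (ringelF k T) := by
  obtain ⟨h1, h2⟩ := FDMod.projective_of_free (M := (ringelF k T).obj T) (𝟙 T)
    (ringelF_exists_hom k T) (ringelF_hom_ext k T)
  refine ⟨h1, h2, fun V => ⟨fun f g hfg => ?_, fun φ => ?_⟩⟩
  · have := congrArg (fun φ : (ringelF k T).obj T ⟶ (ringelF k T).obj V => φ.hom.hom (𝟙 T)) hfg
    exact (Category.id_comp f).symm.trans (this.trans (Category.id_comp g))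
  · exact ⟨φ.hom.hom (𝟙 T), ringelF_hom_ext k T _ _ _ (Category.id_comp _)⟩

instance : (ringelF k T).Linear k where
  map_smul {V W} f r := FDMod.hom_ext fun h => by
    change (show T ⟶ V from h) ≫ (r • f) = (r • 𝟙 T) ≫ (show T ⟶ V from h) ≫ f
    rw [Linear.smul_comp, Category.id_comp]
    exact Linear.comp_smul ..

variable {k T}

/-- Evaluation of an element of `Hom(V, T)^*`, as a linear functional. -/
def ringelGEval {V : C} (f : V ⟶ T) : ((ringelG k T).obj V).obj →ₗ[k] k where
  toFun φ := (show Module.Dual k (V ⟶ T) from φ) f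
  map_add' _ _ := rfl
  map_smul' c φ := by
    change (show Module.Dual k (V ⟶ T) from φ) (f ≫ (c • 𝟙 T)) = c • _
    rw [Linear.comp_smul, Category.comp_id, map_smul]

lemma ringelG_ext {V : C} {φ ψ : ((ringelG k T).obj V).obj}
    (h : ∀ f : V ⟶ T, ringelGEval f φ = ringelGEval f ψ) : φ = ψ :=
  LinearMap.ext h

lemma ringelGEval_smul {V : C} (f : V ⟶ T) (a : (End T)ᵐᵒᵖ) (φ : ((ringelG k T).obj V).obj) :
    ringelGEval f (a • φ) = ringelGEval (f ≫ a.unop) φ := rfl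

lemma ringelGEval_map {V W : C} (f : W ⟶ T) (g : V ⟶ W) (φ : ((ringelG k T).obj V).obj) :
    ringelGEval f (((ringelG k T).map g).hom.hom φ) = ringelGEval (g ≫ f) φ := rfl

/-- The element of `Hom(V, T)^*` given by a linear functional. -/
def ringelGMk {V : C} (φ : Module.Dual k (V ⟶ T)) : ((ringelG k T).obj V).obj := φ

/-- A linear map to `Hom(V, T)^*`, given by a pairing. -/
def ringelGHom {M : RingelDual k T} {V : C} (β : M.obj →ₗ[k] Module.Dual k (V ⟶ T))
    (h : ∀ (m : M.obj) (a : (End T)ᵐᵒᵖ) (f : V ⟶ T), β (a • m) f = β m (f ≫ a.unop)) :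
    M ⟶ (ringelG k T).obj V :=
  FDMod.ofLinearMap
    { toFun := fun m => ringelGMk (β m)
      map_add' := fun m n => β.map_add m n
      map_smul' := fun a m => ringelG_ext fun f => h m a f }

lemma ringelGEval_ringelGHom {M : RingelDual k T} {V : C}
    (β : M.obj →ₗ[k] Module.Dual k (V ⟶ T))
    (h : ∀ (m : M.obj) (a : (End T)ᵐᵒᵖ) (f : V ⟶ T), β (a • m) f = β m (f ≫ a.unop))
    (f : V ⟶ T) (m : M.obj) : ringelGEval f ((ringelGHom β h).hom.hom m) = β m f := rfl

lemma ringelG_hom_ext {M : RingelDual k T} {f g : M ⟶ (ringelG k T).obj T}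
    (h : ∀ m, ringelGEval (𝟙 T) (f.hom.hom m) = ringelGEval (𝟙 T) (g.hom.hom m)) : f = g := by
  refine FDMod.hom_ext fun m => ringelG_ext fun a => ?_
  have ha : ∀ f : M ⟶ (ringelG k T).obj T, ringelGEval a (f.hom.hom m) =
      ringelGEval (𝟙 T) (f.hom.hom (MulOpposite.op (show End T from a) • m)) := fun f => by
    rw [map_smul, ringelGEval_smul]
    exact congrArg (fun b => ringelGEval b (f.hom.hom m)) (Category.id_comp a).symm
  rw [ha f, ha g, h]

/-- `G T` is the dual of the regular module, so maps into it correspond to linear functionals,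
recovered by evaluation at `𝟙 T`. -/
lemma ringelG_exists_hom {M : RingelDual k T} (ℓ : M.obj →ₗ[k] k) :
    ∃ f : M ⟶ (ringelG k T).obj T, ∀ m, ringelGEval (𝟙 T) (f.hom.hom m) = ℓ m := by
  let β : M.obj →ₗ[k] Module.Dual k (T ⟶ T) :=
    LinearMap.mk₂ k (fun m a => ℓ (MulOpposite.op (show End T from a) • m))
      (fun m n a => by rw [smul_add, map_add])
      (fun c m a => by rw [smul_comm, map_smul])
      (fun m a b => by
        rw [← map_add, ← add_smul]
        rfl)
      (fun c m a => by
        rw [← map_smul, ← smul_assoc]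
        rfl)
  refine ⟨ringelGHom β fun m a f => ?_, fun m => ?_⟩
  · change ℓ (MulOpposite.op (show End T from f) • a • m) = ℓ _
    rw [← mul_smul]
    rfl
  · rw [ringelGEval_ringelGHom]
    exact congrArg ℓ (one_smul _ m)

instance : Injective ((ringelG k T).obj T) where
  factors {X Y} g f _ := by
    let fk : X.obj →ₗ[k] Y.obj := f.hom.hom.restrictScalars k
    -- Injectivity reduces to extending a functional, for which a linear retraction suffices.
    obtain ⟨r, hr⟩ := LinearMap.exists_leftInverse_of_injective fk
      (LinearMap.ker_eq_bot.2 (FDMod.injective_of_mono f))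
    obtain ⟨h, hh⟩ := ringelG_exists_hom (k := k) (T := T) (M := Y)
      ((ringelGEval (𝟙 T)).comp ((g.hom.hom.restrictScalars k).comp r))
    refine ⟨h, ringelG_hom_ext fun m => (hh _).trans ?_⟩
    change ringelGEval (𝟙 T) (g.hom.hom (r (fk m))) = _
    rw [show r (fk m) = m from LinearMap.congr_fun hr m]

variable (k T)

/-- Maps `G V ⟶ G T` are functionals on `Hom(V, T)^*`, that is, elements of `Hom(V, T)` by
finite-dimensional biduality. -/
theorem isRingelFunctor_ringelG : IsRingelFunctor (Opposite.op T) (ringelG k T).op where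
  projective := inferInstanceAs (Projective (Opposite.op ((ringelG k T).obj T)))
  generator X hX := by
    obtain ⟨x, hx⟩ := FDMod.exists_ne_zero (M := X.unop) fun h => hX h.op
    obtain ⟨ℓ, hℓ⟩ : ∃ ℓ : Module.Dual k X.unop.obj, ℓ x ≠ 0 := by
      by_contra! h
      exact hx ((Module.forall_dual_apply_eq_zero_iff k x).1 h)
    obtain ⟨f, hf⟩ := ringelG_exists_hom (k := k) (T := T) ℓ
    refine ⟨f.op, fun h0 => hℓ ?_⟩
    have : f = 0 := Quiver.Hom.op_inj h0
    rw [← hf, this]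
    exact map_zero _
  bijective V := by
    have key : ∀ (f : V.unop ⟶ T) (φ : ((ringelG k T).obj V.unop).obj),
        ringelGEval (𝟙 T) (((ringelG k T).map f).hom.hom φ) = ringelGEval f φ := fun f φ => by
      rw [ringelGEval_map, Category.comp_id]
    constructor
    · intro f g hfg
      have h0 : (ringelG k T).map f.unop = (ringelG k T).map g.unop := Quiver.Hom.op_inj hfg
      refine Quiver.Hom.unop_inj (sub_eq_zero.1
        ((Module.forall_dual_apply_eq_zero_iff k (f.unop - g.unop)).1 fun φ => ?_))
      rw [map_sub, sub_eq_zero]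
      have := key f.unop (ringelGMk φ)
      rw [h0, key] at this
      exact this.symm
    · intro θ
      let θ' : (ringelG k T).obj V.unop ⟶ (ringelG k T).obj T := θ.unop
      let ℓ : Module.Dual k (Module.Dual k (V.unop ⟶ T)) :=
        { toFun := fun φ => ringelGEval (𝟙 T) (θ'.hom.hom (ringelGMk φ))
          map_add' := fun φ ψ => by
            rw [← map_add, ← map_add]
            rfl
          map_smul' := fun c φ => by
            have : ringelGMk (T := T) (c • φ) = c • ringelGMk φ := ringelG_ext fun f => by
              rw [map_smul]
              rfl
            rw [this]
            exact ((ringelGEval (𝟙 T)).comp (θ'.hom.hom.restrictScalars k)).map_smul c _ }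
      let g := (Module.evalEquiv k (V.unop ⟶ T)).symm ℓ
      have hg : ∀ φ, φ g = ℓ φ := fun φ =>
        LinearMap.congr_fun ((Module.evalEquiv k (V.unop ⟶ T)).apply_symm_apply ℓ) φ
      have : (ringelG k T).map g = θ' := ringelG_hom_ext fun φ => (key g φ).trans (hg φ)
      exact ⟨g.op, congrArg Quiver.Hom.op this⟩

instance : (ringelG k T).Linear k where
  map_smul {V W} f r := FDMod.hom_ext fun φ => ringelG_ext fun g => by
    rw [ringelGEval_map]
    refine Eq.trans ?_ ((ringelGEval g).map_smul r (((ringelG k T).map f).hom.hom φ)).symm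
    rw [ringelGEval_map, Linear.smul_comp]
    exact map_smul (show Module.Dual k (V ⟶ T) from φ) r (f ≫ g)

variable {k T}

/-- Applied to the socle of `G U`, this shows that it is the head of `F U`. If `m` in `X` pairs
nontrivially through `x` with some `g : U ⟶ T`, then `h ↦ (h ≫ g) • m` is the required map, nonzero
at the retraction. -/
lemma exists_hom_ne_zero_of_retract {U : C} (r : Retract U T) {X : RingelDual k T}
    {x : X ⟶ (ringelG k T).obj U} (hx : x ≠ 0) : ∃ y : (ringelF k T).obj U ⟶ X, y ≠ 0 := by
  obtain ⟨m, g, hg⟩ : ∃ m g, ringelGEval g (x.hom.hom m) ≠ 0 := by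
    by_contra! h
    exact hx (FDMod.hom_ext fun m => ringelG_ext fun g => (h m g).trans (map_zero _).symm)
  refine ⟨FDMod.ofLinearMap
    { toFun := fun h => MulOpposite.op (show End T from (show T ⟶ U from h) ≫ g) • m
      map_add' := fun h h' => ?_
      map_smul' := fun a h => ?_ }, fun h0 => hg ?_⟩
  · rw [← add_smul]
    exact congrArg (fun b => MulOpposite.op (show End T from b) • m)
      (Preadditive.add_comp _ _ _ (show T ⟶ U from h) h' g)
  · refine Eq.trans ?_ (mul_smul a (MulOpposite.op (show End T from (show T ⟶ U from h) ≫ g)) m)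
    exact congrArg (fun b => MulOpposite.op (show End T from b) • m)
      (Category.assoc a.unop (show T ⟶ U from h) g)
  · have h1 : MulOpposite.op (show End T from r.r ≫ g) • m = 0 :=
      congrArg (fun y : (ringelF k T).obj U ⟶ X => y.hom.hom r.r) h0
    have h2 := ringelGEval_smul r.i (MulOpposite.op (show End T from r.r ≫ g)) (x.hom.hom m)
    rw [← map_smul, h1, map_zero, map_zero] at h2
    rw [h2]
    exact congrArg (fun b => ringelGEval b (x.hom.hom m)) (by simp)

end Functors

/-! ### Ringel duality -/

open Stratification

/-! ### Pairing maps from a projective cover with maps to an injective hull -/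

section Pairing

variable {C : Type u} [Category.{v} C] [Abelian C] {L P I X : C} {π : P ⟶ L} {ι : L ⟶ I}

/-- The image of `f` still has head `L`, and the composite of that head with `ι` extends from the
image to `X`. -/
lemma IsLocal.exists_comp_eq (hπ : IsLocal π) [Injective I] {f : P ⟶ X} (hf : f ≠ 0) :
    ∃ h : X ⟶ I, f ≫ h = π ≫ ι := by
  obtain ⟨J, p, i, h', hp, hi, hpi, hph, -⟩ := hπ.factor_image hf
  refine ⟨Injective.factorThru (h' ≫ ι) i, ?_⟩
  rw [← hpi, Category.assoc, Injective.comp_factorThru, reassoc_of% hph]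

lemma IsColocal.exists_comp_eq (hι : IsColocal ι) [Projective P] {h : X ⟶ I} (hh : h ≠ 0) :
    ∃ f : P ⟶ X, f ≫ h = π ≫ ι := by
  obtain ⟨g, hg⟩ := IsLocal.exists_comp_eq (ι := π.op) hι (f := h.op) fun h0 =>
    hh (Quiver.Hom.op_inj h0)
  exact ⟨g.unop, congrArg Quiver.Hom.unop hg⟩

end Pairing

lemma InjectiveHullOf.iso {C : Type u} [Category.{v} C] [Abelian C] {X Y I : C}
    (h : InjectiveHullOf X I) (hX : Simple X) (e : X ≅ Y) :
    InjectiveHullOf Y I := by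
  obtain ⟨π, hπ⟩ := h.op
  exact ProjectiveCoverOf.unop
    ⟨_, ((hπ.isLocal (simple_op hX)).comp_iso e.op.symm).isProjectiveCover hπ.projective⟩

/-! ### Finiteness of the set of labels -/

section FiniteLabels

variable {C : Type u} [Category.{v} C] [Abelian C] [HasLength C] {B : Type w} {Λ : Type w'}
  [PartialOrder Λ]

lemma Stratification.finite_compositionFactors (S : Stratification C B Λ) (X : C) :
    {b | IsCompositionFactor (S.L b) X}.Finite := by
  induction X using len_induction with
  | h X ih =>
    by_cases h0 : IsZero X
    · exact Set.finite_empty.subset fun b hb => hb.not_isZero h0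
    obtain ⟨L, p, hL, hp⟩ := exists_simple_quotient X h0
    obtain ⟨c, ⟨e⟩⟩ := S.exists_iso L hL
    have hs := Ses.of_epi p
    refine ((ih (kernel p) ?_).union (Set.finite_singleton c)).subset fun b hb => ?_
    · rw [HasLength.len_add hs]
      have := len_pos (Simple.not_isZero L)
      omega
    · rcases IsCompositionFactor.of_ses hs hb with h | h
      · exact Or.inl h
      · obtain ⟨e'⟩ := h.iso_of_simple hL
        exact Or.inr (S.eq_of_iso b c ⟨e' ≪≫ e⟩)

end FiniteLabels

/-! ### Construction of the Ringel dual -/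

section Main

variable {k : Type v} [Field k] {C : Type u} [Category.{v} C] [Abelian C] [Linear k C]
  [IsFiniteAbelian k C] {B : Type w} {Λ : Type w'} [PartialOrder Λ]
  {S : Stratification C B Λ} {ε : Λ → ℤˣ} {T : C}

variable (k) in
-- The flags of the `T(b)` supply the standard and costandard objects. Each `L b` is a factor of
-- `T`, which has finite length, so there are finitely many labels.
theorem IsTiltingGenerator.setup [IsAlgClosed k] (hT : S.IsTiltingGenerator ε T)
    (hS : S.HasProjectiveFlags ε) : S.Setup ε where
  finite := by
    have := IsFiniteAbelian.hasLength k C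
    refine Set.finite_univ_iff.1 ((S.finite_compositionFactors T).subset fun b _ => ?_)
    obtain ⟨U, hU, ⟨r⟩⟩ := hT.2 b
    obtain ⟨X, Q, i, p, h, hX, -⟩ := hU.exists_bottom
    obtain ⟨t, ht, -⟩ := hX.head
    have := h.mono
    have := ht.epi
    exact ((IsCompositionFactor.of_simple_epi (S.simple b) t).of_mono i).of_mono r.i
  schur b f hf := exists_natIso_of_simple k C (S.simple b) hf
  std b := by
    obtain ⟨U, hU, -⟩ := hT.2 b
    obtain ⟨X, -, -, -, -, hX, -⟩ := hU.exists_bottom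
    exact ⟨X, hX⟩
  costd b := by
    obtain ⟨U, hU, -⟩ := hT.2 b
    obtain ⟨-, X, -, -, -, -, hX, -⟩ := hU.exists_top
    exact ⟨X, hX⟩
  flags := hS

open scoped ModuleCat in
/-- An isomorphism of finite-dimensional modules from a bijective morphism. -/
def FDMod.isoOfBijective {A : Type v} [Ring A] [Algebra k A] {M N : FDMod k A} (f : M ⟶ N)
    (hf : Function.Bijective f.hom.hom) : M ≅ N where
  hom := f
  inv := FDMod.ofLinearMap (LinearEquiv.ofBijective f.hom.hom hf).symm.toLinearMap
  hom_inv_id := FDMod.hom_ext (LinearEquiv.ofBijective f.hom.hom hf).symm_apply_apply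
  inv_hom_id := FDMod.hom_ext (LinearEquiv.ofBijective f.hom.hom hf).apply_symm_apply

variable (k T) in
open scoped ModuleCat in
-- Compose `P ⟶ T ⟶ I` and apply a functional `ℓ` that is nonzero on `P ⟶ L ⟶ I`. Every nonzero map
-- out of `P` or into `I` can be completed to this composite, so the pairing is perfect; being
-- balanced over `End T`, it identifies `F I` with the dual of `Hom(P, T)`.
theorem exists_iso_ringelF_ringelG {L I P : C} (hL : Simple L) (hI : InjectiveHullOf L I)
    (hP : ProjectiveCoverOf L P) :
    Nonempty ((ringelF k T).obj I ≅ (ringelG k T).obj P) := by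
  obtain ⟨π, hπ⟩ := hP
  obtain ⟨ι', hι'⟩ := hI.op
  obtain ⟨_, hI⟩ := hI
  have := hI.injective
  have := hπ.projective
  have hπl := hπ.isLocal hL
  have hιl : IsColocal ι'.unop := hι'.isLocal (simple_op hL)
  generalize ι'.unop = ι at hιl
  have := hπ.epi
  obtain ⟨ℓ, hℓ⟩ : ∃ ℓ : Module.Dual k (P ⟶ I), ℓ (π ≫ ι) ≠ 0 := by
    by_contra! h
    have := (Module.forall_dual_apply_eq_zero_iff k (π ≫ ι)).1 h
    exact hιl.ne_zero (zero_of_epi_comp π this)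
  let β : ((ringelF k T).obj I).obj →ₗ[k] Module.Dual k (P ⟶ T) :=
    LinearMap.mk₂ k (fun h f => ℓ (f ≫ (show T ⟶ I from h)))
      (fun h h' f => (congrArg ℓ (Preadditive.comp_add _ _ _ f _ _)).trans (map_add ℓ _ _))
      (fun c h f => by
        rw [← map_smul]
        refine congrArg ℓ ?_
        change f ≫ (c • 𝟙 T) ≫ (show T ⟶ I from h) = _
        rw [Linear.smul_comp, Category.id_comp]
        exact Linear.comp_smul ..)
      (fun h f f' => (congrArg ℓ (Preadditive.add_comp _ _ _ f f' _)).trans (map_add ℓ _ _))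
      (fun c h f => by
        rw [← map_smul]
        exact congrArg ℓ (Linear.smul_comp ..))
  have : Module.Finite k ((ringelF k T).obj I).obj := ((ringelF k T).obj I).property
  have h1 : Function.Injective β := by
    refine (injective_iff_map_eq_zero _).2 fun h h0 => by_contra fun hh => ?_
    obtain ⟨f, hf⟩ := hιl.exists_comp_eq (π := π) (X := T) (h := h) hh
    refine hℓ ?_
    rw [← hf]
    exact LinearMap.congr_fun h0 f
  have h2 : Function.Injective β.flip := by
    refine (injective_iff_map_eq_zero _).2 fun f h0 => by_contra fun hf => ?_
    obtain ⟨h, hh⟩ := hπl.exists_comp_eq (ι := ι) hf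
    refine hℓ ?_
    rw [← hh]
    exact LinearMap.congr_fun h0 h
  have h3 := LinearMap.IsPerfPair.of_injective h1 h2
  exact ⟨FDMod.isoOfBijective (ringelGHom β fun h a f => congrArg ℓ (Category.assoc ..).symm)
    h3.bijective_left⟩

/-- `F` and `G` each produce a stratification, the second through socles of the `G T(b)`. It remains
to see that both label the simple modules in the same way. -/
theorem exists_isRingelDuality [IsAlgClosed k] (hS : S.HasProjectiveFlags ε)
    (hT : S.IsTiltingGenerator ε T) : ∃ S' : Stratification (RingelDual k T) B Λᵒᵈ,
      IsRingelDuality S ε T (ringelF k T) (ringelG k T) S' := by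
  have := IsFiniteAbelian.hasLength k C
  have := IsFiniteAbelian.hasLength k (RingelDual k T)
  have hC := IsTiltingGenerator.setup k hT hS
  have hF := isRingelFunctor_ringelF k T
  have hG := isRingelFunctor_ringelG k T
  obtain ⟨S', hρ, hS'⟩ := hF.exists_stratification hC hT
  obtain ⟨S'', hρ', hS''⟩ := hG.exists_stratification hC.op hT.op
  refine ⟨S', ⟨hC, hT, hF, hρ, hS'⟩, ⟨hC.op, hT.op, hG, hρ, fun b U hU => ?_⟩,
    fun b I P hI hP => exists_iso_ringelF_ringelG k T (S.simple b) hI hP,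
    fun b f hf => exists_natIso_of_simple k _ (S'.simple b) hf⟩
  obtain ⟨r⟩ := hC.exists_retract hT hU.unop
  obtain ⟨π, hπ⟩ := hS' b U.unop hU.unop
  have hI := (hS'' b U hU).unop
  obtain ⟨ι, hι⟩ := hI
  have hL := simple_unop (S''.simple b)
  have := hι.mono
  -- The socle of `G T(b)` receives a nonzero map from `F T(b)`, hence is isomorphic to its head
  -- `S'.L b`.
  obtain ⟨y, hy⟩ := exists_hom_ne_zero_of_retract (k := k) r (x := ι) fun h0 =>
    Simple.not_isZero (S''.L b).unop (by rw [IsZero.iff_id_eq_zero, ← cancel_mono ι, h0]; simp)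
  obtain ⟨e, -⟩ := (hπ.isLocal (S'.simple b)).to_simple hL hy
  exact (InjectiveHullOf.iso ⟨ι, hι⟩ hL e.symm).op

end Main

end

end RingelDuality

theorem theorem3 {k : Type v} [Field k] [IsAlgClosed k]
    {C : Type u} [Category.{v} C] [Abelian C] [Linear k C] [IsFiniteAbelian k C]
    {B : Type w} {Λ : Type w'} [PartialOrder Λ]
    (S : Stratification C B Λ) (ε : Λ → ℤˣ) (hS : S.IsFiniteStratified ε k)
    (T : C) (hT : S.IsTiltingGenerator ε T) :
    ∃ (S' : Stratification (RingelDual k T) B Λᵒᵈ),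
      (∀ b, S'.ρ b = OrderDual.toDual (S.ρ b)) ∧
      S'.IsFiniteStratified (negSign ε) k ∧
      (∀ (b : B) (U : C), S.IsIndecTilting ε b U →
        ProjectiveCoverOf (S'.L b) ((ringelF k T).obj U) ∧
        InjectiveHullOf (S'.L b) ((ringelG k T).obj U) ∧
        IsHead ((ringelF k T).obj U) (S'.L b) ∧
        IsSocle ((ringelG k T).obj U) (S'.L b)) ∧
      (∀ (b : B) (V : C), S.IsEpsCostandard ε b V →
        S'.IsEpsStandard (negSign ε) b ((ringelF k T).obj V)) ∧
      (∀ (b : B) (V : C), S.IsEpsStandard ε b V →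
        S'.IsEpsCostandard (negSign ε) b ((ringelG k T).obj V)) ∧
      (∀ (b : B) (I P : C), InjectiveHullOf (S.L b) I →
        ProjectiveCoverOf (S.L b) P →
        S'.IsIndecTilting (negSign ε) b ((ringelF k T).obj I) ∧
        S'.IsIndecTilting (negSign ε) b ((ringelG k T).obj P) ∧
        Nonempty ((ringelF k T).obj I ≅ (ringelG k T).obj P)) ∧
      RestrictsToEquivalence (ringelF k T)
        (S.costdFiltered ε) (S'.stdFiltered (negSign ε)) ∧
      RestrictsToEquivalence (ringelG k T)
        (S.stdFiltered ε) (S'.costdFiltered (negSign ε)) ∧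
      InducesExtIsos k (ringelF k T) (S.costdFiltered ε) ∧
      InducesExtIsos k (ringelG k T) (S.stdFiltered ε) := by
  obtain ⟨S', h⟩ := exists_isRingelDuality (k := k) hS.2 hT
  have := IsFiniteAbelian.hasLength k C
  have := IsFiniteAbelian.hasLength k (RingelDual k T)
  refine ⟨S', h.left.ρ_eq, ⟨inferInstance, h.left.hasProjectiveFlags⟩, fun b U hU => ?_,
    fun b V hV => h.left.isEpsStandard_map hV, fun b V hV => h.right.isEpsCostandard_map hV,
    fun b I P hI hP => h.isIndecTilting hI hP, h.left.restrictsToEquivalence,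
    h.right.restrictsToEquivalence_unop, ?_, ?_⟩
  · obtain ⟨ι, hι⟩ := h.right.cover b _ hU.op
    have hs : IsColocal ι.unop := hι.isLocal (simple_op (S'.simple b))
    exact ⟨h.left.cover b U hU, (h.right.cover b _ hU.op).unop, h.left.isHead hU, hs.isSocle⟩
  · let : HasExt.{max u v} C := HasExt.standard C
    let : HasExt.{max (v + 1) v} (RingelDual k T) := HasExt.standard (RingelDual k T)
    exact inducesExtIsos k _ _ h.left.extComparable
  · let : HasExt.{max u v} C := HasExt.standard C
    let : HasExt.{max (v + 1) v} (RingelDual k T) := HasExt.standard (RingelDual k T)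
    exact inducesExtIsos k _ _ h.extComparable_right
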